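/- Let $\Sigma=\{0,1\}$. A function is in FP if it is computed by a deterministic polynomial-time Turing machine; tuples and finite sets of strings are coded as strings in a standard way (finite sets by the tuple of their elements in lexicographical order), and $\|X\|$ denotes cardinality. A set $A\subseteq\Sigma^*$ is P-selective ($A\in\mathrm{P\text{-}Sel}$) if there is an FP function $f$ such that for all $x,y\in\Sigma^*$, $f(x,y)\in\{x,y\}$, and $f(x,y)\in A$ whenever $x\in A$ or $y\in A$. For $k\ge 1$, $\mathrm{S}(k)$ is the class of sets $L$ for which there is an FP function $f$ such that for each $n\ge 1$ and each set $Y$ of $n$ strings, $f(Y)\subseteq Y$, and if $\|L\cap Y\|\ge k$ then $f(Y)\subseteq L$ and $\|f(Y)\|\ge 1$. Let $\mathrm{SH}=\bigcup_{k\ge1}\mathrm{S}(k)$. For functions $g_1,g_2,g_3$ from positive integers to positive integers, $\mathrm{GC}(g_1(n),g_2(n),g_3(n))$ is the class of sets $L$ for which there is an FP function $f$ such that for each $n\ge 1$ and each set $Y$ of $n$ strings, (i) $f(Y)\subseteq Y$ and $\|f(Y)\|\le g_2(n)$, and (ii) if $\|L\cap Y\|\ge g_1(n)$ then $\|L\cap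 f(Y)\|\ge g_3(n)$. The class $\mathrm{Fair\text{-}GC}(g_1(n),g_2(n),g_3(n))$ is defined in the same way, but (i) and (ii) are required only for sets $Y$ of $n$ strings each of which has length at most $n$. As a threshold, "$n-1$" stands for $\max(n-1,1)$. For classes $\mathcal C,\mathcal D$ of sets and a binary operation $\mathbf{op}$ on sets, $\mathcal C\ \mathbf{op}\ \mathcal D=\{A\,\mathrm{op}\,B : A\in\mathcal C, B\in\mathcal D\}$; here $\mathrm{xor}$ is symmetric difference and $A\ \mathrm{nxor}\ B=(A\cap B)\cup(\overline A\cap\overline B)$. The $k$-ary join of $A_0,\dots,A_{k-1}$ is $\bigcup_{i<k}\{\underline{i}x : x\in A_i\}$, where $\underline{i}$ is the binary representation of $i$ with $\lceil\log_2 k\rceil$ bits. Let $\oplus_k(\mathrm{P\text{-}Sel})$ and $\cup_k(\mathrm{P\text{-}Sel})$ be the classes of $k$-ary joins and of $k$-ary unions of P-selective sets. **Theorem.** 1. For each $k\ge 2$: (a) $\oplus_k(\mathrm{P\text{-}Sel})\subseteq\mathrm{GC}(1,k,1)$, but $\oplus_k(\mathrm{P\text{-}Sel})\not\subseteq\mathrm{SH}\cup\mathrm{GC}(1,k-1,1)$;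 (b) $\cup_k(\mathrm{P\text{-}Sel})\subseteq\mathrm{GC}(1,k,1)$, but $\cup_k(\mathrm{P\text{-}Sel})\not\subseteq\mathrm{SH}\cup\mathrm{GC}(1,k-1,1)$. 2. $\mathrm{P\text{-}Sel}\cap\mathrm{P\text{-}Sel}$ (the class of all intersections of two P-selective sets) is not contained in $\mathrm{GC}(1,2,1)$; but for each integer-valued FP function $k(0^n)$ with $1\le k(0^n)\le n$ for all $n\ge1$, it is contained in $\mathrm{GC}(\lceil n/k(0^n)\rceil,k(0^n),1)$. 3. For each $\mathbf{op}\in\{\text{intersection},\mathrm{xor},\mathrm{nxor}\}$, $\mathrm{P\text{-}Sel}\ \mathbf{op}\ \mathrm{P\text{-}Sel}\not\subseteq\mathrm{Fair\text{-}GC}(1,n-1,1)$. -/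

import Mathlib

/-! Generalized selectivity classes of languages over the alphabet `{0, 1}`. -/

namespace GenSel

/-- Strings over `Σ = {0, 1}`; `false` is the symbol `0` and `true` is the symbol `1`. -/
abbrev Str : Type := List Bool

/-- Languages, i.e. sets of strings. -/
abbrev Lang : Type := Set Str

/-- The function `f : α → β` is computed by a deterministic polynomial-time (multi-stack) Turing
machine, inputs and outputs being presented through the codings `ea` and `eb`. -/
def PolyTime {α β αΓ βΓ : Type} (ea : α → List αΓ) (eb : β → List βΓ) (f : α → β) : Prop :=
  Nonempty (Turing.TM2ComputableInPolyTime ea eb f)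

/-! ### Coding of tuples and of finite sets of strings as strings -/

/-- Self-delimiting code of one string: `b₁ ⋯ bₘ` becomes `1 b₁ ⋯ 1 bₘ 0`. -/
def codeStr : Str → Str
  | [] => [false]
  | b :: x => true :: b :: codeStr x

/-- A tuple of strings is coded as the concatenation of the self-delimiting codes. -/
def codeTuple : List Str → Str
  | [] => []
  | x :: l => codeStr x ++ codeTuple l

/-- The code of a pair of strings. -/
def codePair (p : Str × Str) : Str := codeTuple [p.1, p.2]

/-- A finite set of strings is coded as the tuple of its elements in lexicographical order. -/
def codeFinset (Y : Finset Str) : Str := codeTuple (Y.sort (· ≤ ·))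

theorem codeStr_append_inj {x y s t : Str} (h : codeStr x ++ s = codeStr y ++ t) :
    x = y ∧ s = t := by
  induction x generalizing y with
  | nil => cases y <;> simp_all [codeStr]
  | cons b x ih =>
    cases y with
    | nil => simp [codeStr] at h
    | cons c y =>
      simp only [codeStr, List.cons_append, List.cons.injEq, true_and] at h
      obtain ⟨rfl, h⟩ := h
      obtain ⟨rfl, rfl⟩ := ih h
      exact ⟨rfl, rfl⟩

theorem codeTuple_injective : Function.Injective codeTuple := by
  intro l
  induction l with
  | nil =>
    intro m h
    cases m with
    | nil => rfl
    | cons y m => cases y <;> simp [codeTuple, codeStr] at h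
  | cons x l ih =>
    intro m h
    cases m with
    | nil => cases x <;> simp [codeTuple, codeStr] at h
    | cons y m =>
      obtain ⟨rfl, h'⟩ := codeStr_append_inj h
      rw [ih h']

theorem codeFinset_injective : Function.Injective codeFinset := by
  intro Y Z h
  have := congrArg List.toFinset (codeTuple_injective h)
  simpa using this

/-! ### Selectivity classes -/

/-- `P-Sel`, the class of P-selective sets. -/
def PSel : Set Lang :=
  {A | ∃ f : Str × Str → Str, PolyTime codePair id f ∧
    ∀ x y : Str, (f (x, y) = x ∨ f (x, y) = y) ∧ (x ∈ A ∨ y ∈ A → f (x, y) ∈ A)}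

/-- The class `S(g₁(·), g₂(·))`. -/
def S (g₁ g₂ : ℕ → ℕ) : Set Lang :=
  {L | ∃ f : Finset Str → Finset Str, PolyTime codeFinset codeFinset f ∧
    ∀ Y : Finset Str, Y.Nonempty →
      f Y ⊆ Y ∧
      (g₁ Y.card ≤ (L ∩ (Y : Set Str)).ncard → (f Y : Set Str) ⊆ L ∧ g₂ Y.card ≤ (f Y).card)}

/-- The hierarchy `SH`, the union over all `k ≥ 1` of `S(k) = S(k, 1)`. -/
def SH : Set Lang := {L | ∃ k : ℕ, 1 ≤ k ∧ L ∈ S (fun _ => k) (fun _ => 1)}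

/-- What a `GC(g₁(·), g₂(·), g₃(·))`-selector `f` for `L` has to satisfy on the input set `Y`. -/
def GCCondition (g₁ g₂ g₃ : ℕ → ℕ) (L : Lang) (f : Finset Str → Finset Str) (Y : Finset Str) :
    Prop :=
  f Y ⊆ Y ∧ (f Y).card ≤ g₂ Y.card ∧
    (g₁ Y.card ≤ (L ∩ (Y : Set Str)).ncard → g₃ Y.card ≤ (L ∩ (f Y : Set Str)).ncard)

/-- The class `GC(g₁(·), g₂(·), g₃(·))`. -/
def GC (g₁ g₂ g₃ : ℕ → ℕ) : Set Lang :=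
  {L | ∃ f : Finset Str → Finset Str, PolyTime codeFinset codeFinset f ∧
    ∀ Y : Finset Str, Y.Nonempty → GCCondition g₁ g₂ g₃ L f Y}

/-- The class `Fair-GC(g₁(·), g₂(·), g₃(·))`: the selector has to meet the requirements only on
sets of `n` strings each of which has length at most `n`. -/
def FairGC (g₁ g₂ g₃ : ℕ → ℕ) : Set Lang :=
  {L | ∃ f : Finset Str → Finset Str, PolyTime codeFinset codeFinset f ∧
    ∀ Y : Finset Str, Y.Nonempty → (∀ y ∈ Y, y.length ≤ Y.card) → GCCondition g₁ g₂ g₃ L f Y}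

/-- The threshold function written `n - 1`. Threshold functions take positive values, so its value
at `n = 1` is `1` (and not `0`). -/
def predThreshold (n : ℕ) : ℕ := max (n - 1) 1

/-! ### Boolean operations and joins -/

/-- `A xor B`, the symmetric difference. -/
def xorLang (A B : Lang) : Lang := (A ∩ Bᶜ) ∪ (Aᶜ ∩ B)

/-- `A nxor B`, the equivalence. -/
def nxorLang (A B : Lang) : Lang := (A ∩ B) ∪ (Aᶜ ∩ Bᶜ)

/-- The class `𝒞 op 𝒟` of all languages `A op B` with `A ∈ 𝒞` and `B ∈ 𝒟`. -/
def opClass (op : Lang → Lang → Lang) (C D : Set Lang) : Set Lang :=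
  {L | ∃ A ∈ C, ∃ B ∈ D, L = op A B}

/-- The binary representation of `i` with `w` bits, most significant bit first. -/
def indexBits (w i : ℕ) : Str := List.ofFn fun j : Fin w => i.testBit (w - 1 - j)

/-- The `k`-ary join: the `i`-th set is marked by the prefix of `⌈log₂ k⌉` bits that represents `i`
in binary, where the `k` sets are numbered `0, …, k - 1`. For `k = 2` the two prefixes are the
symbols `0` and `1`. -/
def join (k : ℕ) (A : Fin k → Lang) : Lang :=
  {z | ∃ i : Fin k, ∃ x ∈ A i, z = indexBits (Nat.clog 2 k) i ++ x}

/-- The class of `k`-ary joins of sets in `C`. -/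
def joinClass (k : ℕ) (C : Set Lang) : Set Lang :=
  {L | ∃ A : Fin k → Lang, (∀ i, A i ∈ C) ∧ L = join k A}

/-- The class of `k`-ary unions of sets in `C`. -/
def unionClass (k : ℕ) (C : Set Lang) : Set Lang :=
  {L | ∃ A : Fin k → Lang, (∀ i, A i ∈ C) ∧ L = ⋃ i, A i}

end GenSel

open GenSel

/-! Upper bounds. A selector `f` for `A` yields a champion of a finite set: in a knock-out
tournament the winner lies in `A` as soon as some participant does. For a union of `k` P-selective
sets the `k` champions are the selected strings. A join is a union of sets marked by prefixes, and
marking preserves P-selectivity (`append_image_mem_PSel`). For `A ∩ B` put `q = ⌈n/k⌉`. Insertion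
sort by a selector for `A` puts the elements of `A` in front. The sorted list is cut into at most
`k` blocks of `q` strings, and each block sends its champion with respect to `B`. If `q` elements of
`A ∩ B` are present, then, in the initial segment of elements of `A`, either a completed block
contains one of them, or all of them fill the last block exactly; in both cases some champion is in
`A ∩ B` (`exists_mem_block`).

Lower bounds. An initial segment of the lexicographical order is P-selective, however complicated
its boundary. The boundary is an infinite branch built in stages, stage `n` defeating the `n`-th
function of a list of all polynomial-time functions on finite sets. A string that does not extend
the current prefix of the branch keeps its membership for ever (`mem_cut_iff`). For joins, `k`
independent branches allow any choice, stage by stage, of the parts whose test strings belong to the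
language (`exists_join`). For Boolean operations, one branch is approached from below by `A` and
from above by `B`: among the strings of the length of a stage, exactly the prefix of the branch lies
in both sets and every other string in exactly one (`mem_cut_flip_cut`). So `A ∩ B` and `A nxor B`
single out one string of a large cube, chosen to be one that the selector drops. The case of xor
follows by complementing `B`.

Polynomial time. Turing machines are shown to be equivalent to while programs on stacks
(`polyTime_iff_comp`). The programs give closure properties for functions on tree-coded data, from
which the selectors of the upper bounds are assembled. Being countable in number, they also give the
list used in the diagonalizations. -/

/-! ### While programs on stacks -/

namespace StackProg

open Function

/-- While programs over stacks indexed by natural numbers whose symbols are natural numbers. -/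
inductive Cmd : Type
  | skip : Cmd
  | push (k a : ℕ) : Cmd
  | pop (k : ℕ) : Cmd
  | seq (c d : Cmd) : Cmd
  | ite (k : ℕ) (S : List ℕ) (c d : Cmd) : Cmd
  | loop (k : ℕ) (S : List ℕ) (c : Cmd) : Cmd

/-- The contents of all stacks. -/
abbrev Store : Type := ℕ → List ℕ

/-- Whether the top symbol (if any) of a stack belongs to `S`. -/
def test (S : List ℕ) : Option ℕ → Bool
  | none => false
  | some a => decide (a ∈ S)

@[simp] theorem test_none (S : List ℕ) : test S none = false := rfl

@[simp] theorem test_some (S : List ℕ) (a : ℕ) : test S (some a) = decide (a ∈ S) := rfl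

/-- `Exec c s s' t`: started on `s`, the program `c` stops with `s'` after `t` steps. -/
inductive Exec : Cmd → Store → Store → ℕ → Prop
  | skip (s) : Exec .skip s s 1
  | push (k a s) : Exec (.push k a) s (update s k (a :: s k)) 1
  | pop (k s) : Exec (.pop k) s (update s k (s k).tail) 1
  | seq {c d s s' s'' t t'} : Exec c s s' t → Exec d s' s'' t' → Exec (.seq c d) s s'' (t + t')
  | ite_pos {k S c d s s' t} : test S (s k).head? = true → Exec c s s' t →
      Exec (.ite k S c d) s s' (1 + t)
  | ite_neg {k S c d s s' t} : test S (s k).head? = false → Exec d s s' t →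
      Exec (.ite k S c d) s s' (1 + t)
  | loop_done {k S c s} : test S (s k).head? = false → Exec (.loop k S c) s s 1
  | loop_step {k S c s s' s'' t t'} : test S (s k).head? = true → Exec c s s' t →
      Exec (.loop k S c) s' s'' t' → Exec (.loop k S c) s s'' (1 + (t + t'))

/-- A program thus determines the function it computes, which makes the polynomial-time functions
countable. -/
theorem Exec.det {c s s₁ t₁} (h : Exec c s s₁ t₁) : ∀ {s₂ t₂}, Exec c s s₂ t₂ → s₁ = s₂ := by
  induction h with
  | skip s => intro s₂ t₂ h; cases h; rfl
  | push k a s => intro s₂ t₂ h; cases h; rfl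
  | pop k s => intro s₂ t₂ h; cases h; rfl
  | seq _ _ ih ih' =>
    intro s₂ t₂ h
    cases h with
    | seq h h' => cases ih h; exact ih' h'
  | ite_pos hc _ ih =>
    intro s₂ t₂ h
    cases h with
    | ite_pos _ h => exact ih h
    | ite_neg hc' h => simp [hc] at hc'
  | ite_neg hc _ ih =>
    intro s₂ t₂ h
    cases h with
    | ite_pos hc' h => simp [hc] at hc'
    | ite_neg _ h => exact ih h
  | loop_done hc =>
    intro s₂ t₂ h
    cases h with
    | loop_done => rfl
    | loop_step hc' => simp [hc] at hc'
  | loop_step hc _ _ ih ih' =>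
    intro s₂ t₂ h
    cases h with
    | loop_done hc' => simp [hc] at hc'
    | loop_step _ h h' => cases ih h; exact ih' h'

/-- No stack grows by more than the number of steps. -/
theorem Exec.length_le {c s s' t} (h : Exec c s s' t) (k : ℕ) :
    (s' k).length ≤ (s k).length + t := by
  induction h with
  | skip s => omega
  | push j a s => by_cases hj : k = j <;> simp [hj]
  | pop j s => by_cases hj : k = j <;> simp [hj]; omega
  | seq _ _ ih ih' => omega
  | ite_pos hc _ ih => omega
  | ite_neg hc _ ih => omega
  | loop_done hc => omega
  | loop_step hc _ _ ih ih' => omega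

/-- `Run c s s' T`: started on `s`, the program `c` stops with `s'` after at most `T` steps. -/
def Run (c : Cmd) (s s' : Store) (T : ℕ) : Prop := ∃ t ≤ T, Exec c s s' t

theorem Run.mono {c s s' T T'} (h : Run c s s' T) (hT : T ≤ T') : Run c s s' T' := by
  obtain ⟨t, ht, h⟩ := h
  exact ⟨t, ht.trans hT, h⟩

theorem Run.congr {c s s' s₁ s₁' T T'} (h : Run c s s' T) (hs : s = s₁) (hs' : s' = s₁')
    (hT : T ≤ T') : Run c s₁ s₁' T' := by
  subst hs hs'
  exact h.mono hT

theorem Run.length_le {c s s' T} (h : Run c s s' T) (k : ℕ) :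
    (s' k).length ≤ (s k).length + T := by
  obtain ⟨t, ht, h⟩ := h
  have := h.length_le k
  omega

theorem Run.skip (s) : Run .skip s s 1 := ⟨1, le_rfl, .skip s⟩

theorem Run.push (k a s) : Run (.push k a) s (update s k (a :: s k)) 1 := ⟨1, le_rfl, .push k a s⟩

theorem Run.pop (k s) : Run (.pop k) s (update s k (s k).tail) 1 := ⟨1, le_rfl, .pop k s⟩

theorem Run.seq {c d s s' s'' T T'} (h : Run c s s' T) (h' : Run d s' s'' T') :
    Run (.seq c d) s s'' (T + T') := by
  obtain ⟨t, ht, h⟩ := h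
  obtain ⟨t', ht', h'⟩ := h'
  exact ⟨t + t', by omega, .seq h h'⟩

theorem Run.ite_pos {k S c d s s' T} (hc : test S (s k).head? = true) (h : Run c s s' T) :
    Run (.ite k S c d) s s' (1 + T) := by
  obtain ⟨t, ht, h⟩ := h
  exact ⟨1 + t, by omega, .ite_pos hc h⟩

theorem Run.ite_neg {k S c d s s' T} (hc : test S (s k).head? = false) (h : Run d s s' T) :
    Run (.ite k S c d) s s' (1 + T) := by
  obtain ⟨t, ht, h⟩ := h
  exact ⟨1 + t, by omega, .ite_neg hc h⟩

theorem Run.loop_done {k S c s} (hc : test S (s k).head? = false) : Run (.loop k S c) s s 1 :=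
  ⟨1, le_rfl, .loop_done hc⟩

theorem Run.loop_step {k S c s s' s'' T T'} (hc : test S (s k).head? = true) (h : Run c s s' T)
    (h' : Run (.loop k S c) s' s'' T') : Run (.loop k S c) s s'' (1 + (T + T')) := by
  obtain ⟨t, ht, h⟩ := h
  obtain ⟨t', ht', h'⟩ := h'
  exact ⟨1 + (t + t'), by omega, .loop_step hc h h'⟩

/-! ### Renaming of stacks -/

/-- Renaming of the stacks of a program. -/
def Cmd.rename (ρ : ℕ → ℕ) : Cmd → Cmd
  | .skip => .skip
  | .push k a => .push (ρ k) a
  | .pop k => .pop (ρ k)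
  | .seq c d => .seq (c.rename ρ) (d.rename ρ)
  | .ite k S c d => .ite (ρ k) S (c.rename ρ) (d.rename ρ)
  | .loop k S c => .loop (ρ k) S (c.rename ρ)

/-- With stacks renamed injectively, a program runs as before and leaves all other stacks alone; two
programs can therefore work side by side in one store. -/
theorem Exec.rename {ρ : ℕ → ℕ} (hρ : Injective ρ) {c s s' t} (h : Exec c s s' t) :
    ∀ {r : Store}, r ∘ ρ = s →
      ∃ r' : Store, r' ∘ ρ = s' ∧ (∀ k, k ∉ Set.range ρ → r' k = r k) ∧
        Exec (c.rename ρ) r r' t := by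
  have key : ∀ (r : Store) (k : ℕ) (l : List ℕ), update r (ρ k) l ∘ ρ = update (r ∘ ρ) k l := by
    intro r k l
    funext j
    by_cases hj : j = k
    · subst hj; simp
    · simp [hj, hρ.eq_iff]
  have key' : ∀ (r : Store) (k : ℕ) (l : List ℕ) (j : ℕ), j ∉ Set.range ρ →
      update r (ρ k) l j = r j := by
    intro r k l j hj
    rw [update_of_ne]
    rintro rfl
    exact hj ⟨k, rfl⟩
  induction h with
  | skip s => intro r hr; exact ⟨r, hr, fun _ _ => rfl, .skip r⟩
  | push k a s =>
    rintro r rfl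
    exact ⟨_, key r k _, fun j hj => key' r k _ j hj, .push _ _ _⟩
  | pop k s =>
    rintro r rfl
    exact ⟨_, key r k _, fun j hj => key' r k _ j hj, .pop _ _⟩
  | seq _ _ ih ih' =>
    intro r hr
    obtain ⟨r₁, h₁, k₁, e₁⟩ := ih hr
    obtain ⟨r₂, h₂, k₂, e₂⟩ := ih' h₁
    exact ⟨r₂, h₂, fun k hk => (k₂ k hk).trans (k₁ k hk), .seq e₁ e₂⟩
  | ite_pos hc _ ih =>
    rintro r rfl
    obtain ⟨r₁, h₁, k₁, e₁⟩ := ih rfl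
    exact ⟨r₁, h₁, k₁, .ite_pos hc e₁⟩
  | ite_neg hc _ ih =>
    rintro r rfl
    obtain ⟨r₁, h₁, k₁, e₁⟩ := ih rfl
    exact ⟨r₁, h₁, k₁, .ite_neg hc e₁⟩
  | loop_done hc =>
    rintro r rfl
    exact ⟨r, rfl, fun _ _ => rfl, .loop_done hc⟩
  | loop_step hc _ _ ih ih' =>
    rintro r rfl
    obtain ⟨r₁, h₁, k₁, e₁⟩ := ih rfl
    obtain ⟨r₂, h₂, k₂, e₂⟩ := ih' h₁
    exact ⟨r₂, h₂, fun k hk => (k₂ k hk).trans (k₁ k hk), .loop_step hc e₁ e₂⟩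

/-- A version of `Exec.rename` with given final store. -/
theorem Run.rename {ρ : ℕ → ℕ} (hρ : Injective ρ) {c s s' T} (h : Run c s s' T) {r r' : Store}
    (hr : r ∘ ρ = s) (hr' : r' ∘ ρ = s') (hrr : ∀ k, k ∉ Set.range ρ → r' k = r k) :
    Run (c.rename ρ) r r' T := by
  obtain ⟨t, ht, h⟩ := h
  obtain ⟨r₁, h₁, k₁, e₁⟩ := h.rename hρ hr
  have : r₁ = r' := by
    funext k
    by_cases hk : k ∈ Set.range ρ
    · obtain ⟨j, rfl⟩ := hk
      exact congrFun (h₁.trans hr'.symm) j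
    · rw [k₁ k hk, hrr k hk]
  exact ⟨t, ht, this ▸ e₁⟩

/-! ### Countability -/

/-- A numbering of programs. -/
def Cmd.toNat : Cmd → ℕ
  | .skip => Nat.pair 0 0
  | .push k a => Nat.pair 1 (Nat.pair k a)
  | .pop k => Nat.pair 2 k
  | .seq c d => Nat.pair 3 (Nat.pair c.toNat d.toNat)
  | .ite k S c d =>
    Nat.pair 4 (Nat.pair k (Nat.pair (Encodable.encode S) (Nat.pair c.toNat d.toNat)))
  | .loop k S c => Nat.pair 5 (Nat.pair k (Nat.pair (Encodable.encode S) c.toNat))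

theorem Cmd.toNat_injective : Injective Cmd.toNat := by
  intro c
  induction c with
  | skip => intro d h; cases d <;> simp_all [Cmd.toNat]
  | push k a => intro d h; cases d <;> simp_all [Cmd.toNat]
  | pop k => intro d h; cases d <;> simp_all [Cmd.toNat]
  | seq c₁ c₂ ih₁ ih₂ =>
    intro d h
    cases d with
    | seq d₁ d₂ =>
      simp only [Cmd.toNat, Nat.pair_eq_pair, true_and] at h
      rw [ih₁ h.1, ih₂ h.2]
    | _ => simp [Cmd.toNat] at h
  | ite k S c₁ c₂ ih₁ ih₂ =>
    intro d h
    cases d with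
    | ite j S' d₁ d₂ =>
      simp only [Cmd.toNat, Nat.pair_eq_pair, true_and, Encodable.encode_inj] at h
      rw [h.1, h.2.1, ih₁ h.2.2.1, ih₂ h.2.2.2]
    | _ => simp [Cmd.toNat] at h
  | loop k S c ih =>
    intro d h
    cases d with
    | loop j S' d =>
      simp only [Cmd.toNat, Nat.pair_eq_pair, true_and, Encodable.encode_inj] at h
      rw [h.1, h.2.1, ih h.2.2]
    | _ => simp [Cmd.toNat] at h

instance : Countable Cmd := Cmd.toNat_injective.countable

/-! ### Basic programs -/

/-- `st [l₀, …, lₘ]` is the store whose first stacks are `l₀, …, lₘ`, the others being empty. -/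
def st (L : List (List ℕ)) : Store := fun k => L.getD k []

@[simp] theorem st_cons_zero (l L) : st (l :: L) 0 = l := rfl

@[simp] theorem st_cons_succ (l L k) : st (l :: L) (k + 1) = st L k := rfl

@[simp] theorem st_nil (k) : st [] k = [] := rfl

/-- Trailing empty stacks are invisible: auxiliary stacks can be listed when they are needed and
dropped once they are empty again. -/
theorem st_append_nil (L : List (List ℕ)) : st (L ++ [[]]) = st L := by
  funext k
  simp only [st, List.getD_eq_getElem?_getD]
  rcases lt_trichotomy k L.length with h | h | h
  · rw [List.getElem?_append_left h]
  · subst h; simp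
  · simp [List.getElem?_append_right h.le, List.getElem?_eq_none h.le,
      Nat.sub_eq_iff_eq_add h.le, Nat.ne_of_gt h]

theorem st_two (l) : st [l, []] = st [l] := st_append_nil [l]

theorem st_three (l) : st [l, [], []] = st [l] := (st_append_nil [l, []]).trans (st_two l)

theorem st_four (l) : st [l, [], [], []] = st [l] := (st_append_nil [l, [], []]).trans (st_three l)

theorem update_st (L : List (List ℕ)) {k : ℕ} (hk : k < L.length) (l : List ℕ) :
    update (st L) k l = st (L.set k l) := by
  funext j
  by_cases hj : j = k
  · subst hj; simp [st, hk]
  · simp [st, hj, List.getElem?_set_ne (Ne.symm hj)]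

theorem Run.push_st {k a : ℕ} {L : List (List ℕ)} (hk : k < L.length) :
    Run (.push k a) (st L) (st (L.set k (a :: L.getD k []))) 1 := by
  rw [← update_st L hk]
  exact Run.push k a (st L)

theorem Run.pop_st {k : ℕ} {L : List (List ℕ)} (hk : k < L.length) :
    Run (.pop k) (st L) (st (L.set k (L.getD k []).tail)) 1 := by
  rw [← update_st L hk]
  exact Run.pop k (st L)

/-- Select the program `F a` by the top symbol `a ∈ S` of stack `k`. -/
def Cmd.switch (k : ℕ) : List ℕ → (ℕ → Cmd) → Cmd
  | [], _ => .skip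
  | a :: S, F => .ite k [a] (F a) (Cmd.switch k S F)

theorem Run.switch {k : ℕ} {S : List ℕ} {F : ℕ → Cmd} {s s' : Store} {T a : ℕ}
    (ha : (s k).head? = some a) (haS : a ∈ S) (h : Run (F a) s s' T) :
    Run (Cmd.switch k S F) s s' (S.length + T) := by
  induction S with
  | nil => simp at haS
  | cons b S ih =>
    by_cases hab : a = b
    · subst hab
      refine (Run.ite_pos (by simp [ha]) h).mono ?_
      simp only [List.length_cons]; omega
    · have := ih (by simpa [hab] using haS)
      refine (Run.ite_neg (by simp [ha, hab]) this).mono ?_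
      simp only [List.length_cons]; omega

/-- Move stack `i` onto stack `j`, translating its symbols (from `S`) by `g`. -/
def Cmd.move (i j : ℕ) (S : List ℕ) (g : ℕ → ℕ) : Cmd :=
    .loop i S (Cmd.switch i S fun a => .seq (.pop i) (.push j (g a)))

/-- Each symbol costs one loop test, at most `S.length` branchings and two stack operations, whence
`S.length + 3`. A transfer reverses the order, so order is restored by transferring twice. -/
theorem Run.move {i j : ℕ} (hij : i ≠ j) {S : List ℕ} {g : ℕ → ℕ} {s : Store}
    (hS : ∀ a ∈ s i, a ∈ S) :
    Run (Cmd.move i j S g) s (update (update s i []) j (((s i).map g).reverse ++ s j))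
      ((S.length + 3) * (s i).length + 1) := by
  generalize hl : s i = l at *
  induction l generalizing s with
  | nil =>
    refine (Run.loop_done (by simp [hl])).congr rfl ?_ (by simp)
    funext k
    by_cases hk : k = j
    · subst hk; simp
    · by_cases hk' : k = i
      · subst hk'; simp [hk, hl]
      · simp [hk, hk']
  | cons a l ih =>
    have h1 : Run (Cmd.switch i S fun a => .seq (.pop i) (.push j (g a))) s
        (update (update s i l) j (g a :: s j)) (S.length + 2) := by
      refine Run.switch (a := a) (by simp [hl]) (hS a (by simp)) ?_
      refine ((Run.pop i s).seq (Run.push j (g a) _)).congr rfl ?_ le_rfl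
      simp [hl, hij.symm]
    have h2 := ih (s := update (update s i l) j (g a :: s j)) (by simp [hij])
      (fun b hb => hS b (by simp [hb]))
    refine (Run.loop_step (by simp [hl, hS a (by simp)]) h1 h2).congr rfl ?_ ?_
    · funext k
      by_cases hk : k = j
      · subst hk; simp
      · by_cases hk' : k = i
        · subst hk'; simp [hk]
        · simp [hk, hk']
    · simp only [List.length_cons]; ring_nf; omega

theorem Run.move_st {i j : ℕ} (hij : i ≠ j) {S : List ℕ} {g : ℕ → ℕ} {L : List (List ℕ)}
    (hi : i < L.length) (hj : j < L.length) (hS : ∀ a ∈ L.getD i [], a ∈ S) :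
    Run (Cmd.move i j S g) (st L)
      (st ((L.set i []).set j (((L.getD i []).map g).reverse ++ L.getD j [])))
      ((S.length + 3) * (L.getD i []).length + 1) := by
  rw [← update_st _ (by simpa using hj), ← update_st _ hi]
  exact Run.move hij hS

/-- Empty stack `i`, whose symbols are in `S`. -/
def Cmd.clear (i : ℕ) (S : List ℕ) : Cmd := .loop i S (.pop i)

theorem Run.clear {i : ℕ} {S : List ℕ} {s : Store} (hS : ∀ a ∈ s i, a ∈ S) :
    Run (Cmd.clear i S) s (update s i []) (2 * (s i).length + 1) := by
  generalize hl : s i = l at *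
  induction l generalizing s with
  | nil =>
    refine (Run.loop_done (by simp [hl])).congr rfl ?_ (by simp)
    rw [← hl, update_eq_self]
  | cons a l ih =>
    have h2 := ih (s := update s i l) (by simp) (fun b hb => hS b (by simp [hb]))
    refine (Run.loop_step (by simp [hl, hS a (by simp)])
      ((Run.pop i s).congr (s₁' := update s i l) rfl (by simp [hl]) le_rfl) h2).congr rfl ?_ ?_
    · simp
    · simp only [List.length_cons]; omega

theorem Run.clear_st {i : ℕ} {S : List ℕ} {L : List (List ℕ)} (hi : i < L.length)
    (hS : ∀ a ∈ L.getD i [], a ∈ S) :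
    Run (Cmd.clear i S) (st L) (st (L.set i [])) (2 * (L.getD i []).length + 1) := by
  rw [← update_st _ hi]
  exact Run.clear hS

end StackProg

/-! ### Compilation of while programs into stack machines -/

namespace StackProg

open Function Turing

/-- The labels used by the compiled program. -/
def Cmd.Lab : Cmd → Type
  | .skip => Unit
  | .push _ _ => Unit
  | .pop _ => Unit
  | .seq c d => c.Lab ⊕ d.Lab
  | .ite _ _ c d => Option (c.Lab ⊕ d.Lab)
  | .loop _ _ c => Option c.Lab

noncomputable instance Cmd.fintypeLab : (c : Cmd) → Fintype c.Lab
  | .skip => inferInstanceAs (Fintype Unit)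
  | .push _ _ => inferInstanceAs (Fintype Unit)
  | .pop _ => inferInstanceAs (Fintype Unit)
  | .seq c d =>
    have := c.fintypeLab
    have := d.fintypeLab
    inferInstanceAs (Fintype (c.Lab ⊕ d.Lab))
  | .ite _ _ c d =>
    have := c.fintypeLab
    have := d.fintypeLab
    inferInstanceAs (Fintype (Option (c.Lab ⊕ d.Lab)))
  | .loop _ _ c =>
    have := c.fintypeLab
    inferInstanceAs (Fintype (Option c.Lab))

/-- The first label of the compiled program. -/
def Cmd.entry : (c : Cmd) → c.Lab
  | .skip => ()
  | .push _ _ => ()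
  | .pop _ => ()
  | .seq c _ => .inl c.entry
  | .ite _ _ _ _ => none
  | .loop _ _ _ => none

/-- All stacks of the program have numbers less than `n`. -/
def Cmd.Below (n : ℕ) : Cmd → Prop
  | .skip => True
  | .push k _ => k < n
  | .pop k => k < n
  | .seq c d => c.Below n ∧ d.Below n
  | .ite k _ c d => k < n ∧ c.Below n ∧ d.Below n
  | .loop k _ c => k < n ∧ c.Below n

theorem Cmd.Below.mono {n m : ℕ} (h : n ≤ m) {c : Cmd} (hc : c.Below n) : c.Below m := by
  induction c with
  | skip => trivial
  | push k a => exact lt_of_lt_of_le hc h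
  | pop k => exact lt_of_lt_of_le hc h
  | seq c d ih ih' => exact ⟨ih hc.1, ih' hc.2⟩
  | ite k S c d ih ih' => exact ⟨lt_of_lt_of_le hc.1 h, ih hc.2.1, ih' hc.2.2⟩
  | loop k S c ih => exact ⟨lt_of_lt_of_le hc.1 h, ih hc.2⟩

theorem Cmd.exists_below (c : Cmd) : ∃ n, c.Below n := by
  induction c with
  | skip => exact ⟨0, trivial⟩
  | push k a => exact ⟨k + 1, Nat.lt_succ_self k⟩
  | pop k => exact ⟨k + 1, Nat.lt_succ_self k⟩
  | seq c d ih ih' =>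
    obtain ⟨n, hn⟩ := ih
    obtain ⟨m, hm⟩ := ih'
    exact ⟨max n m, hn.mono (le_max_left _ _), hm.mono (le_max_right _ _)⟩
  | ite k S c d ih ih' =>
    obtain ⟨n, hn⟩ := ih
    obtain ⟨m, hm⟩ := ih'
    exact ⟨max (k + 1) (max n m), lt_of_lt_of_le (Nat.lt_succ_self k) (le_max_left _ _),
      hn.mono (by simp), hm.mono (by simp)⟩
  | loop k S c ih =>
    obtain ⟨n, hn⟩ := ih
    exact ⟨max (k + 1) n, lt_of_lt_of_le (Nat.lt_succ_self k) (le_max_left _ _),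
      hn.mono (by simp)⟩

/-- The alphabets of the compiled machine: one stack of bits for input and output, and `n + 1`
stacks of natural numbers. -/
@[reducible] def Alph (n : ℕ) : Option (Fin (n + 1)) → Type
  | none => Bool
  | some _ => ℕ

/-- Statements of the compiled machine; its internal state is an optional bit. -/
abbrev MStmt (n : ℕ) (L : Type) : Type := TM2.Stmt (Alph n) L (Option Bool)

/-- The stack of the compiled machine that represents stack `k` of the program. -/
abbrev idx (n k : ℕ) : Option (Fin (n + 1)) := some (Fin.ofNat (n + 1) k)

/-- Jump according to whether the top symbol of stack `k` is in `S`. -/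
def jumpTest {L : Type} (n k : ℕ) (S : List ℕ) (l₁ l₂ : L) : MStmt n L :=
  .peek (idx n k) (fun _ (o : Option ℕ) => if test S o then some true else none)
    (.branch Option.isSome (.goto fun _ => l₁) (.goto fun _ => l₂))

/-- The code of a program, its labels being embedded by `emb`. -/
def Cmd.code (n : ℕ) {L : Type} : (c : Cmd) → (c.Lab → L) → L → c.Lab → MStmt n L
  | .skip, _, e => fun _ => .goto fun _ => e
  | .push k a, _, e => fun _ => .push (idx n k) (fun _ => (a : ℕ)) (.goto fun _ => e)
  | .pop k, _, e => fun _ => .pop (idx n k) (fun v _ => v) (.goto fun _ => e)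
  | .seq c d, emb, e =>
    Sum.elim (c.code n (fun l => emb (.inl l)) (emb (.inr d.entry)))
      (d.code n (fun l => emb (.inr l)) e)
  | .ite k S c d, emb, e => fun l => match l with
    | none => jumpTest n k S (emb (some (.inl c.entry))) (emb (some (.inr d.entry)))
    | some (.inl l) => c.code n (fun l => emb (some (.inl l))) e l
    | some (.inr l) => d.code n (fun l => emb (some (.inr l))) e l
  | .loop k S c, emb, e => fun l => match l with
    | none => jumpTest n k S (emb (some c.entry)) e
    | some l => c.code n (fun l => emb (some l)) (emb none) l

/-- The stacks of the compiled machine. -/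
def stk (n : ℕ) (s : Store) (z : List Bool) : ∀ k, List (Alph n k)
  | none => z
  | some i => s i

theorem update_stk_some {n : ℕ} (i : Fin (n + 1)) (s : Store) (z : List Bool) (l : List ℕ) :
    update (stk n s z) (some i) l = stk n (update s i l) z := by
  funext j
  cases j with
  | none => rfl
  | some j =>
    by_cases h : j = i
    · subst h
      rw [update_self]
      simp [stk]
    · rw [update_of_ne (by simpa using h)]
      have : (j : ℕ) ≠ i := fun h' => h (Fin.ext h')
      simp [stk, this]

theorem update_stk {n k : ℕ} (hk : k < n + 1) (s : Store) (z : List Bool) (l : List ℕ) :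
    update (stk n s z) (idx n k) l = stk n (update s k l) z := by
  have h : ((Fin.ofNat (n + 1) k : Fin (n + 1)) : ℕ) = k := Nat.mod_eq_of_lt hk
  exact (update_stk_some (Fin.ofNat (n + 1) k) s z l).trans (by rw [h])

theorem stk_idx {n k : ℕ} (hk : k < n + 1) (s : Store) (z : List Bool) :
    stk n s z (idx n k) = s k :=
  congrArg s (Nat.mod_eq_of_lt hk)

/-- Reachability in exactly `t` steps. -/
def Reach {σ : Type*} (f : σ → Option σ) (t : ℕ) (a b : σ) : Prop :=
  (flip bind f)^[t] (some a) = some b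

theorem Reach.trans {σ : Type*} {f : σ → Option σ} {t t' : ℕ} {a b c : σ} (h : Reach f t a b)
    (h' : Reach f t' b c) : Reach f (t + t') a c := by
  unfold Reach at *
  rw [Nat.add_comm, iterate_add_apply, h, h']

theorem Reach.single {σ : Type*} {f : σ → Option σ} {a b : σ} (h : f a = some b) :
    Reach f 1 a b := h

theorem step_jumpTest {n k : ℕ} (hk : k < n + 1) {L : Type} {m : L → MStmt n L} {l l₁ l₂ : L}
    {S : List ℕ} (hm : m l = jumpTest n k S l₁ l₂) (v : Option Bool) (s : Store) (z : List Bool) :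
    ∃ v', Reach (TM2.step m) 1 ⟨some l, v, stk n s z⟩
      ⟨some (if test S (s k).head? then l₁ else l₂), v', stk n s z⟩ := by
  refine ⟨if test S (s k).head? then some true else none, Reach.single ?_⟩
  have h : (stk n s z (idx n k)).head? = (s k).head? :=
    congrArg (List.head? (α := ℕ)) (stk_idx hk s z)
  rw [TM2.step, hm, jumpTest]
  simp only [TM2.stepAux, Option.some.injEq]
  erw [h]
  by_cases ht : test S (s k).head? <;> simp [ht]

/-- Every step of the program becomes exactly one step of the machine, so `t` is kept. The embedding
`emb` and the exit label `e` are arbitrary because subprograms have exits of their own: the exit of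
a loop body is the test of the loop. -/
theorem Exec.reach {n : ℕ} {c s s' t} (h : Exec c s s' t) (hc : c.Below (n + 1)) {L : Type}
    {m : L → MStmt n L} {z : List Bool} {emb : c.Lab → L} {e : L}
    (hm : ∀ l, m (emb l) = c.code n emb e l) (v : Option Bool) :
    ∃ v', Reach (TM2.step m) t ⟨some (emb c.entry), v, stk n s z⟩ ⟨some e, v', stk n s' z⟩ := by
  induction h generalizing v e with
  | skip s =>
    refine ⟨v, Reach.single ?_⟩
    rw [TM2.step, hm]
    rfl
  | push k a s =>
    refine ⟨v, Reach.single ?_⟩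
    rw [TM2.step, hm, Cmd.code, ← update_stk hc]
    simp only [TM2.stepAux]
    erw [stk_idx hc]
  | pop k s =>
    refine ⟨v, Reach.single ?_⟩
    rw [TM2.step, hm, Cmd.code, ← update_stk hc]
    simp only [TM2.stepAux]
    erw [stk_idx hc]
  | @seq c d s s' s'' t t' _ _ ih ih' =>
    obtain ⟨v₁, h₁⟩ := ih hc.1 (emb := fun l => emb (.inl l)) (fun l => hm (.inl l)) v
    obtain ⟨v₂, h₂⟩ := ih' hc.2 (emb := fun l => emb (.inr l)) (fun l => hm (.inr l)) v₁
    exact ⟨v₂, h₁.trans h₂⟩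
  | @ite_pos k S c d s s' t ht _ ih =>
    obtain ⟨v₁, h₁⟩ := step_jumpTest hc.1 (hm none) v s z
    rw [if_pos ht] at h₁
    obtain ⟨v₂, h₂⟩ := ih hc.2.1 (emb := fun l => emb (some (.inl l)))
      (fun l => hm (some (.inl l))) v₁
    exact ⟨v₂, h₁.trans h₂⟩
  | @ite_neg k S c d s s' t ht _ ih =>
    obtain ⟨v₁, h₁⟩ := step_jumpTest hc.1 (hm none) v s z
    rw [if_neg (by simp [ht])] at h₁
    obtain ⟨v₂, h₂⟩ := ih hc.2.2 (emb := fun l => emb (some (.inr l)))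
      (fun l => hm (some (.inr l))) v₁
    exact ⟨v₂, h₁.trans h₂⟩
  | @loop_done k S c s ht =>
    obtain ⟨v₁, h₁⟩ := step_jumpTest hc.1 (hm none) v s z
    rw [if_neg (by simp [ht])] at h₁
    exact ⟨v₁, h₁⟩
  | @loop_step k S c s s' s'' t t' ht _ _ ih ih' =>
    obtain ⟨v₁, h₁⟩ := step_jumpTest hc.1 (hm none) v s z
    rw [if_pos ht] at h₁
    obtain ⟨v₂, h₂⟩ := ih hc.2 (emb := fun l => emb (some l)) (fun l => hm (some l)) v₁
    obtain ⟨v₃, h₃⟩ := ih' hc hm v₂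
    exact ⟨v₃, h₁.trans (h₂.trans h₃)⟩

/-- Bits as symbols of a program. -/
def bits (x : List Bool) : List ℕ := x.map Bool.toNat

/-- The code of the complete machine: it moves the input to stack `0` (reversing it), runs the
program, and moves the contents of stack `0` to the output stack (reversing it). -/
def machineCode (n : ℕ) (c : Cmd) : c.Lab ⊕ Bool → MStmt n (c.Lab ⊕ Bool)
  | .inr false =>
    .pop none (fun _ (o : Option Bool) => o)
      (.branch Option.isSome
        (.push (idx n 0) (fun v => ((v.getD false).toNat : ℕ)) (.goto fun _ => .inr false))
        (.goto fun _ => .inl c.entry))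
  | .inr true =>
    .pop (idx n 0) (fun _ (o : Option ℕ) => o.map fun a => decide (a = 1))
      (.branch Option.isSome
        (.push none (fun v => (v.getD false : Bool)) (.goto fun _ => .inr true))
        .halt)
  | .inl l => c.code n .inl (.inr true) l

/-- The complete machine. -/
noncomputable def machine (n : ℕ) (c : Cmd) : FinTM2 where
  K := Option (Fin (n + 1))
  k₀ := none
  k₁ := none
  Γ := Alph n
  Λ := c.Lab ⊕ Bool
  main := .inr false
  σ := Option Bool
  initialState := none
  Γk₀Fin := inferInstanceAs (Fintype Bool)
  m := machineCode n c

theorem reach_input (n : ℕ) (c : Cmd) (z : List Bool) (s : Store) (v : Option Bool) :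
    Reach (TM2.step (machineCode n c)) (z.length + 1) ⟨some (.inr false), v, stk n s z⟩
      ⟨some (.inl c.entry), none, stk n (update s 0 ((bits z).reverse ++ s 0)) []⟩ := by
  induction z generalizing s v with
  | nil =>
    refine Reach.single ?_
    simp only [bits, List.map_nil, List.reverse_nil, List.nil_append, update_eq_self]
    have hu : update (stk n s []) none (stk n s [] none).tail = stk n s [] := by
      funext j
      cases j <;> rfl
    simp only [TM2.step, machineCode, TM2.stepAux]
    rw [hu]
    rfl
  | cons b z ih =>
    have h1 : Reach (TM2.step (machineCode n c)) 1 ⟨some (.inr false), v, stk n s (b :: z)⟩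
        ⟨some (.inr false), some b, stk n (update s 0 (b.toNat :: s 0)) z⟩ := by
      refine Reach.single ?_
      rw [← update_stk (Nat.succ_pos n)]
      simp only [TM2.step, machineCode, TM2.stepAux]
      have hu : update (stk n s (b :: z)) none (stk n s (b :: z) none).tail = stk n s z := by
        funext j
        cases j <;> rfl
      rw [hu]
      erw [stk_idx (Nat.succ_pos n)]
      rfl
    have := h1.trans (ih (update s 0 (b.toNat :: s 0)) (some b))
    simpa [bits, Nat.add_comm 1] using this

theorem reach_output (n : ℕ) (c : Cmd) (x z : List Bool) (s : Store) (v : Option Bool)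
    (hs : s 0 = bits x) :
    Reach (TM2.step (machineCode n c)) (x.length + 1) ⟨some (.inr true), v, stk n s z⟩
      ⟨none, none, stk n (update s 0 []) (x.reverse ++ z)⟩ := by
  induction x generalizing s v z with
  | nil =>
    refine Reach.single ?_
    rw [← update_stk (Nat.succ_pos n)]
    simp only [TM2.step, machineCode, TM2.stepAux]
    erw [stk_idx (Nat.succ_pos n)]
    rw [hs]
    rfl
  | cons b x ih =>
    have h1 : Reach (TM2.step (machineCode n c)) 1 ⟨some (.inr true), v, stk n s z⟩
        ⟨some (.inr true), some b, stk n (update s 0 (bits x)) (b :: z)⟩ := by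
      refine Reach.single ?_
      simp only [TM2.step, machineCode, TM2.stepAux]
      erw [stk_idx (Nat.succ_pos n)]
      rw [hs]
      have hb : decide (b.toNat = 1) = b := by cases b <;> rfl
      have hu : update (stk n (update s 0 (bits x)) z) none (b :: z)
          = stk n (update s 0 (bits x)) (b :: z) := by
        funext j
        cases j <;> rfl
      have ho : Option.map (fun a => decide (a = 1)) (bits (b :: x)).head? = some b :=
        congrArg some hb
      erw [ho, update_stk (Nat.succ_pos n)]
      exact congrArg some (congrArg _ hu)
    have := h1.trans (ih (b :: z) (update s 0 (bits x)) (some b) (by simp))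
    simpa [Nat.add_comm 1] using this

/-- Functions computed by a while program in polynomial time, with respect to given codings. -/
def Comp {α β : Type*} (ea : α → List ℕ) (eb : β → List ℕ) (f : α → β) : Prop :=
  ∃ (c : Cmd) (p : Polynomial ℕ), ∀ a,
    Run c (st [ea a]) (st [eb (f a)]) (p.eval (ea a).length)

theorem eval_mono (p : Polynomial ℕ) : Monotone fun n => p.eval n := by
  intro m n h
  simp only [Polynomial.eval_eq_sum_range]
  exact Finset.sum_le_sum fun i _ => Nat.mul_le_mul_left _ (Nat.pow_le_pow_left h i)

theorem Comp.length_le {α β : Type*} {ea : α → List ℕ} {eb : β → List ℕ} {f : α → β}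
    (h : Comp ea eb f) : ∃ p : Polynomial ℕ, ∀ a, (eb (f a)).length ≤ p.eval (ea a).length := by
  obtain ⟨c, p, h⟩ := h
  refine ⟨.X + p, fun a => ?_⟩
  simpa using (h a).length_le 0

/-- A program pushes at most one symbol per step, so the intermediate result has polynomial length
`q`, and the second program takes time at most `r.comp q`. -/
theorem Comp.comp {α β γ : Type*} {ea : α → List ℕ} {eb : β → List ℕ} {ec : γ → List ℕ}
    {f : α → β} {g : β → γ} (hg : Comp eb ec g) (hf : Comp ea eb f) :
    Comp ea ec fun a => g (f a) := by
  obtain ⟨q, hq⟩ := hf.length_le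
  obtain ⟨c, p, hf⟩ := hf
  obtain ⟨d, r, hg⟩ := hg
  refine ⟨.seq c d, p + r.comp q, fun a => ((hf a).seq (hg (f a))).mono ?_⟩
  simp only [Polynomial.eval_add, Polynomial.eval_comp]
  exact Nat.add_le_add_left (eval_mono r (hq a)) _

/-- A program that reverses a string of bits. -/
theorem comp_reverse {α : Type*} (ea : α → List Bool) :
    Comp (fun a => bits (ea a)) (fun a => bits (ea a).reverse) id := by
  refine ⟨.seq (.move 0 1 [0, 1] id) (.seq (.move 1 2 [0, 1] id) (.move 2 0 [0, 1] id)),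
    15 * .X + 3, fun a => ?_⟩
  have hb : ∀ x : List Bool, ∀ a ∈ bits x, a ∈ [0, 1] := by
    intro x a ha
    simp only [bits, List.mem_map] at ha
    obtain ⟨b, -, rfl⟩ := ha
    cases b <;> simp
  have h1 := Run.move_st (i := 0) (j := 1) (by simp) (S := [0, 1]) (g := id)
    (L := [bits (ea a), [], []]) (by simp) (by simp) (by simpa using hb (ea a))
  have h2 := Run.move_st (i := 1) (j := 2) (by simp) (S := [0, 1]) (g := id)
    (L := [[], bits (ea a).reverse, []]) (by simp) (by simp) (by simpa using hb (ea a).reverse)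
  have h3 := Run.move_st (i := 2) (j := 0) (by simp) (S := [0, 1]) (g := id)
    (L := [[], [], bits (ea a)]) (by simp) (by simp) (by simpa using hb (ea a))
  simp only [List.set_cons_zero, List.set_cons_succ, List.getD_cons_zero, List.getD_cons_succ,
    List.append_nil, List.map_id_fun, id_eq, st_three, bits, List.map_reverse,
    List.reverse_reverse] at h1 h2 h3
  refine (h1.seq (h2.seq h3)).congr rfl ?_ ?_
  · simp [bits]
  · simp [bits]
    omega

theorem Comp.polyTime {α β : Type} {ea : α → List Bool} {eb : β → List Bool} {f : α → β}
    (h : Comp (fun a => bits (ea a)) (fun b => bits (eb b)) f) : GenSel.PolyTime ea eb f := by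
  -- The machine reverses the word when it loads the input and again when it unloads the result;
  -- hence it is given a program for the reversed codings.
  obtain ⟨c, p, hc⟩ : Comp (fun a => bits (ea a).reverse) (fun b => bits (eb b).reverse) f := by
    have h1 : Comp (fun a => bits (ea a).reverse) (fun a => bits (ea a)) id := by
      simpa using comp_reverse fun a => (ea a).reverse
    exact (comp_reverse eb).comp (h.comp h1)
  obtain ⟨q, hq⟩ := h.length_le
  obtain ⟨n, hn⟩ := c.exists_below
  have hn' := hn.mono (Nat.le_succ n)
  refine ⟨⟨⟨machine n c, Equiv.refl Bool, Equiv.refl Bool⟩, (.X + 1) + (p + (q + 1)), fun a => ?_⟩⟩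
  have key : ∃ t ≤ ((.X + 1) + (p + (q + 1)) : Polynomial ℕ).eval (ea a).length,
      Reach (TM2.step (machineCode n c)) t ⟨some (.inr false), none, stk n (st []) (ea a)⟩
        ⟨none, none, stk n (st []) (eb (f a))⟩ := by
    obtain ⟨t, ht, he⟩ := hc a
    have h1 := reach_input n c (ea a) (st []) none
    obtain ⟨v, h2⟩ := he.reach hn' (m := machineCode n c) (z := []) (emb := .inl)
      (e := .inr true) (fun l => rfl) none
    have h3 := reach_output n c (eb (f a)).reverse [] (st [bits (eb (f a)).reverse]) v rfl
    have e1 : update (st []) 0 ((bits (ea a)).reverse ++ st [] 0) = st [bits (ea a).reverse] := by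
      funext k
      cases k <;> simp [bits]
    have e2 : update (st [bits (eb (f a)).reverse]) 0 [] = st [] := by
      funext k
      cases k <;> simp
    rw [e1] at h1
    rw [e2, List.append_nil, List.reverse_reverse] at h3
    refine ⟨_, ?_, h1.trans (h2.trans h3)⟩
    have h4 := hq a
    simp [bits] at ht h4 ⊢
    omega
  refine ⟨⟨key.choose, ?_⟩, key.choose_spec.1⟩
  have hi : ∀ x : List Bool, initList (machine n c) x
      = ⟨some (.inr false), none, stk n (st []) x⟩ := by
    intro x
    unfold initList
    congr 1
    funext k
    cases k <;> rfl
  have ho : ∀ x : List Bool, haltList (machine n c) x = ⟨none, none, stk n (st []) x⟩ := by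
    intro x
    unfold haltList
    congr 1
    funext k
    cases k <;> rfl
  have e3 : ∀ x : List Bool, List.map (Equiv.refl Bool).invFun x = x := fun x => List.map_id x
  have := key.choose_spec.2
  unfold Reach at this
  refine Eq.trans ?_ (this.trans ?_)
  · congr 2
    erw [e3]
    exact hi _
  · erw [e3]
    exact congrArg some (ho _).symm

end StackProg

/-! ### Simulation of stack machines by while programs -/

namespace StackProg

open Function Turing

section Simulation

variable {K : Type} {Γ : K → Type} {Λ σ : Type}

/-- The symbols that a statement may push. -/
def pushes : TM2.Stmt Γ Λ σ → Set (Σ k, Γ k)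
  | .push k f q => Set.range (fun v => ⟨k, f v⟩) ∪ pushes q
  | .peek _ _ q => pushes q
  | .pop _ _ q => pushes q
  | .load _ q => pushes q
  | .branch _ q r => pushes q ∪ pushes r
  | .goto _ => ∅
  | .halt => ∅

/-- The internal states are finite in number, so a statement can push only finitely many symbols.
Hence only finitely many symbols ever occur on the stacks, even over infinite stack alphabets, and a
program can branch over all of them. -/
theorem finite_pushes [Finite σ] (q : TM2.Stmt Γ Λ σ) : (pushes q).Finite := by
  induction q with
  | push k f q ih => exact (Set.finite_range _).union ih
  | peek k f q ih => exact ih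
  | pop k f q ih => exact ih
  | load f q ih => exact ih
  | branch p q r ih ih' => exact ih.union ih'
  | goto l => exact Set.finite_empty
  | halt => exact Set.finite_empty

variable (kn : K → ℕ) (enc : (Σ k, Γ k) → ℕ) (ln : Λ × σ → ℕ)

/-- Branch on the top symbol of stack `k`. -/
def caseTop [DecidableEq K] (k : K) (F : Option (Γ k) → Cmd) : List (Σ k, Γ k) → Cmd
  | [] => F none
  | a :: l =>
    if h : a.1 = k then .ite (kn k) [enc a] (F (some (h ▸ a.2))) (caseTop k F l)
    else caseTop k F l

/-- The program that executes a statement in the internal state `v` and then pushes the code of the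
next label and of the next state on stack `1`. -/
def transStmt [DecidableEq K] (U : List (Σ k, Γ k)) : TM2.Stmt Γ Λ σ → σ → Cmd
  | .push k f q, v => .seq (.push (kn k) (enc ⟨k, f v⟩)) (transStmt U q v)
  | .peek k f q, v => caseTop kn enc k (fun o => transStmt U q (f v o)) U
  | .pop k f q, v => caseTop kn enc k (fun o => .seq (.pop (kn k)) (transStmt U q (f v o))) U
  | .load f q, v => transStmt U q (f v)
  | .branch p q r, v => if p v then transStmt U q v else transStmt U r v
  | .goto l, v => .push 1 (ln (l v, v))
  | .halt, _ => .skip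

open Classical in
/-- The store that represents the stacks `S` of a machine, stack `1` containing `pc`. -/
noncomputable def rep (pc : List ℕ) (S : ∀ k, List (Γ k)) : Store := fun j =>
  if j = 1 then pc else if h : ∃ k, kn k = j then (S h.choose).map fun a => enc ⟨_, a⟩ else []

/-- The contents of stack `1` that represents label and state of a configuration. -/
def pcOf (c : TM2.Cfg Γ Λ σ) : List ℕ :=
  match c.l with
  | none => []
  | some l => [ln (l, c.var)]

variable {kn enc ln}

theorem rep_one (pc : List ℕ) (S : ∀ k, List (Γ k)) : rep kn enc pc S 1 = pc := rfl

theorem rep_kn (hkn : Injective kn) (hk2 : ∀ k, 2 ≤ kn k) (pc : List ℕ) (S : ∀ k, List (Γ k))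
    (k : K) : rep kn enc pc S (kn k) = (S k).map fun a => enc ⟨k, a⟩ := by
  have h1 : kn k ≠ 1 := by have := hk2 k; omega
  have h : ∃ j, kn j = kn k := ⟨k, rfl⟩
  have h2 : h.choose = k := hkn h.choose_spec
  rw [rep, if_neg h1, dif_pos h, h2]

theorem rep_of_ne {pc : List ℕ} {S : ∀ k, List (Γ k)} {j : ℕ} (h1 : j ≠ 1)
    (h2 : ∀ k, kn k ≠ j) : rep kn enc pc S j = [] := by
  rw [rep, if_neg h1, dif_neg]
  rintro ⟨k, hk⟩
  exact h2 k hk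

theorem update_rep_one (pc pc' : List ℕ) (S : ∀ k, List (Γ k)) :
    update (rep kn enc pc S) 1 pc' = rep kn enc pc' S := by
  funext j
  by_cases h : j = 1
  · subst h; simp [rep]
  · simp [rep, h]

theorem update_rep [DecidableEq K] (hkn : Injective kn) (hk2 : ∀ k, 2 ≤ kn k) (pc : List ℕ)
    (S : ∀ k, List (Γ k)) (k : K) (l : List (Γ k)) :
    update (rep kn enc pc S) (kn k) (l.map fun a => enc ⟨k, a⟩)
      = rep kn enc pc (update S k l) := by
  funext j
  by_cases h1 : j = 1
  · subst h1
    rw [update_of_ne (by have := hk2 k; omega)]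
    rfl
  by_cases h : ∃ k', kn k' = j
  · obtain ⟨k', rfl⟩ := h
    rw [rep_kn hkn hk2]
    by_cases hk : k' = k
    · subst hk; simp
    · rw [update_of_ne (hkn.ne hk), update_of_ne hk, rep_kn hkn hk2]
  · push Not at h
    rw [update_of_ne (h k).symm, rep_of_ne h1 h, rep_of_ne h1 h]

/-- As `enc` is injective on `U`, the first test that succeeds identifies the top symbol; if none
succeeds, the stack is empty. -/
theorem Run.caseTop [DecidableEq K] (hkn : Injective kn) (hk2 : ∀ k, 2 ≤ kn k) {U : List (Σ k, Γ k)}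
    (hU : Set.InjOn enc {a | a ∈ U}) {k : K} {F : Option (Γ k) → Cmd} {pc : List ℕ}
    {S : ∀ k, List (Γ k)} (hS : ∀ a ∈ S k, (⟨k, a⟩ : Σ k, Γ k) ∈ U) {s' : Store} {T : ℕ}
    (h : Run (F (S k).head?) (rep kn enc pc S) s' T) :
    Run (caseTop kn enc k F U) (rep kn enc pc S) s' (U.length + T) := by
  have key : ∀ V : List (Σ k, Γ k), V ⊆ U → (∀ a, (S k).head? = some a → ⟨k, a⟩ ∈ V) →
      Run (StackProg.caseTop kn enc k F V) (rep kn enc pc S) s' (V.length + T) := by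
    intro V
    induction V with
    | nil =>
      intro _ hV
      have : (S k).head? = none := by
        cases hh : (S k).head? with
        | none => rfl
        | some a => exact absurd (hV a hh) (by simp)
      rw [this] at h
      simpa [StackProg.caseTop] using h
    | cons b V ih =>
      intro hVU hV
      have hbU : b ∈ U := hVU (by simp)
      have hVU' : V ⊆ U := fun x hx => hVU (by simp [hx])
      obtain ⟨k', b⟩ := b
      by_cases hk : k' = k
      · subst hk
        simp only [StackProg.caseTop, dif_pos]
        by_cases hb : (S k').head? = some b
        · refine (Run.ite_pos ?_ (hb ▸ h)).mono (by simp only [List.length_cons]; omega)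
          rw [rep_kn hkn hk2, List.head?_map, hb]
          simp
        · refine (Run.ite_neg ?_ (ih hVU' fun a ha => ?_)).mono
            (by simp only [List.length_cons]; omega)
          · rw [rep_kn hkn hk2, List.head?_map]
            cases hh : (S k').head? with
            | none => rfl
            | some a =>
              simp only [Option.map_some, test_some, List.mem_singleton, decide_eq_false_iff_not]
              intro hab
              have := hU (hS a (List.mem_of_mem_head? (by simp [hh]))) hbU hab
              cases this
              exact hb hh
          · have := hV a ha
            rw [List.mem_cons] at this
            rcases this with h' | h'
            · cases h'
              exact absurd ha hb
            · exact h'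
      · simp only [StackProg.caseTop, dif_neg hk]
        refine (ih hVU' fun a ha => ?_).mono (by simp only [List.length_cons]; omega)
        have := hV a ha
        rw [List.mem_cons] at this
        rcases this with h' | h'
        · cases h'
          exact absurd rfl hk
        · exact h'
  exact key U (fun x hx => hx) fun a ha => hS a (List.mem_of_mem_head? (by simp [ha]))

/-- A statement has no loops, so its cost `C` depends neither on the internal state nor on the
stacks. That all symbols remain in `U` is carried along since the next simulated step needs it. -/
theorem run_transStmt [DecidableEq K] (hkn : Injective kn) (hk2 : ∀ k, 2 ≤ kn k) {U : List (Σ k, Γ k)}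
    (hU : Set.InjOn enc {a | a ∈ U}) (q : TM2.Stmt Γ Λ σ) (hq : ∀ a ∈ pushes q, a ∈ U) :
    ∃ C, ∀ (v : σ) (S : ∀ k, List (Γ k)), (∀ k, ∀ a ∈ S k, (⟨k, a⟩ : Σ k, Γ k) ∈ U) →
      Run (transStmt kn enc ln U q v) (rep kn enc [] S)
        (rep kn enc (pcOf ln (TM2.stepAux q v S)) (TM2.stepAux q v S).stk) C ∧
      ∀ k, ∀ a ∈ (TM2.stepAux q v S).stk k, (⟨k, a⟩ : Σ k, Γ k) ∈ U := by
  induction q with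
  | push k f q ih =>
    obtain ⟨C, hC⟩ := ih fun a ha => hq a (.inr ha)
    refine ⟨1 + C, fun v S hS => ?_⟩
    have hS' : ∀ j, ∀ a ∈ update S k (f v :: S k) j, (⟨j, a⟩ : Σ k, Γ k) ∈ U := by
      intro j a ha
      by_cases hj : j = k
      · subst hj
        rw [update_self, List.mem_cons] at ha
        rcases ha with rfl | ha
        · exact hq _ (.inl ⟨v, rfl⟩)
        · exact hS j a ha
      · rw [update_of_ne hj] at ha
        exact hS j a ha
    obtain ⟨h1, h2⟩ := hC v _ hS'
    refine ⟨Run.seq ((Run.push _ _ _).congr rfl ?_ le_rfl) h1, h2⟩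
    rw [← update_rep hkn hk2, rep_kn hkn hk2]
    rfl
  | peek k f q ih =>
    obtain ⟨C, hC⟩ := ih hq
    refine ⟨U.length + C, fun v S hS => ?_⟩
    obtain ⟨h1, h2⟩ := hC (f v (S k).head?) S hS
    exact ⟨Run.caseTop hkn hk2 hU (hS k) h1, h2⟩
  | pop k f q ih =>
    obtain ⟨C, hC⟩ := ih hq
    refine ⟨U.length + (1 + C), fun v S hS => ?_⟩
    have hS' : ∀ j, ∀ a ∈ update S k (S k).tail j, (⟨j, a⟩ : Σ k, Γ k) ∈ U := by
      intro j a ha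
      by_cases hj : j = k
      · subst hj
        rw [update_self] at ha
        exact hS j a (List.mem_of_mem_tail ha)
      · rw [update_of_ne hj] at ha
        exact hS j a ha
    obtain ⟨h1, h2⟩ := hC (f v (S k).head?) _ hS'
    refine ⟨Run.caseTop hkn hk2 hU (hS k)
      (Run.seq ((Run.pop _ _).congr rfl ?_ le_rfl) h1), h2⟩
    rw [← update_rep hkn hk2, rep_kn hkn hk2, List.map_tail]
  | load f q ih =>
    obtain ⟨C, hC⟩ := ih hq
    exact ⟨C, fun v S hS => hC (f v) S hS⟩
  | branch p q r ih ih' =>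
    obtain ⟨C, hC⟩ := ih fun a ha => hq a (.inl ha)
    obtain ⟨C', hC'⟩ := ih' fun a ha => hq a (.inr ha)
    refine ⟨C + C', fun v S hS => ?_⟩
    cases hp : p v with
    | true =>
      simp only [transStmt, TM2.stepAux, hp, if_true, cond_true]
      exact ⟨(hC v S hS).1.mono (by omega), (hC v S hS).2⟩
    | false =>
      simp only [transStmt, TM2.stepAux, hp, cond_false]
      exact ⟨(hC' v S hS).1.mono (by omega), (hC' v S hS).2⟩
  | goto l =>
    refine ⟨1, fun v S hS => ⟨(Run.push _ _ _).congr rfl ?_ le_rfl, hS⟩⟩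
    rw [rep_one, update_rep_one]
    rfl
  | halt => exact ⟨1, fun v S hS => ⟨Run.skip _, hS⟩⟩

/-- The program that simulates a machine until it halts. -/
noncomputable def transMain [DecidableEq K] [Nonempty (Λ × σ)] (kn : K → ℕ) (enc : (Σ k, Γ k) → ℕ)
    (ln : Λ × σ → ℕ) (U : List (Σ k, Γ k)) (m : Λ → TM2.Stmt Γ Λ σ) (labels : List ℕ) : Cmd :=
  .loop 1 labels (.switch 1 labels fun a =>
    .seq (.pop 1) (transStmt kn enc ln U (m (invFun ln a).1) (invFun ln a).2))

theorem run_transMain [DecidableEq K] [Nonempty (Λ × σ)] [Finite Λ] (hkn : Injective kn) (hk2 : ∀ k, 2 ≤ kn k)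
    (hln : Injective ln) {U : List (Σ k, Γ k)} (hU : Set.InjOn enc {a | a ∈ U})
    {m : Λ → TM2.Stmt Γ Λ σ} (hm : ∀ l, ∀ a ∈ pushes (m l), a ∈ U) {labels : List ℕ}
    (hlab : ∀ x, ln x ∈ labels) :
    ∃ C, ∀ (n : ℕ) (c c' : TM2.Cfg Γ Λ σ), c'.l = none →
      (∀ k, ∀ a ∈ c.stk k, (⟨k, a⟩ : Σ k, Γ k) ∈ U) → Reach (TM2.step m) n c c' →
      Run (transMain kn enc ln U m labels) (rep kn enc (pcOf ln c) c.stk) (rep kn enc [] c'.stk)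
        (C * n + 1) ∧ ∀ k, ∀ a ∈ c'.stk k, (⟨k, a⟩ : Σ k, Γ k) ∈ U := by
  have h0 := fun l => run_transStmt (ln := ln) hkn hk2 hU (m l) (hm l)
  choose C hC using h0
  -- Finitely many labels: one constant bounds the cost of simulating any step.
  obtain ⟨D, hD⟩ := (Set.finite_range C).bddAbove
  refine ⟨labels.length + D + 2, fun n => ?_⟩
  induction n with
  | zero =>
    intro c c' hc' hS h
    cases h
    refine ⟨?_, hS⟩
    have : pcOf ln c = [] := by rw [pcOf, hc']
    rw [this]
    exact (Run.loop_done rfl).mono (by omega)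
  | succ n ih =>
    rintro ⟨_ | l, v, S⟩ c' hc' hS h
    -- A halted configuration has no successor, so it reaches nothing in a positive number of steps.
    · exfalso
      have hn : ∀ n, (flip bind (TM2.step m))^[n] none = none := by
        intro n
        induction n with
        | zero => rfl
        | succ n ih => rw [iterate_succ_apply]; exact ih
      have : (none : Option (TM2.Cfg Γ Λ σ)) = some c' := (hn n).symm.trans h
      cases this
    · obtain ⟨h1, h2⟩ := hC l v S hS
      obtain ⟨h3, h4⟩ := ih (TM2.stepAux (m l) v S) c' hc' h2 h
      refine ⟨?_, h4⟩
      have hi : invFun ln (ln (l, v)) = (l, v) := leftInverse_invFun hln _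
      have hl : C l ≤ D := hD ⟨l, rfl⟩
      refine (Run.loop_step (T := labels.length + (1 + D)) ?_ (Run.switch (a := ln (l, v)) rfl
        (hlab _) (Run.seq (Run.pop _ _) ?_)) h3).mono ?_
      · exact decide_eq_true (hlab _)
      · rw [hi, rep_one, update_rep_one]
        exact h1.mono hl
      · ring_nf; omega

end Simulation

theorem mem_bits {a : ℕ} {x : List Bool} (h : a ∈ bits x) : a ∈ [0, 1] := by
  simp only [bits, List.mem_map] at h
  obtain ⟨b, -, rfl⟩ := h
  cases b <;> simp

theorem initList_self (tm : FinTM2) (x : List (tm.Γ tm.k₀)) : (initList tm x).stk tm.k₀ = x := by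
  simp [initList]

theorem initList_of_ne (tm : FinTM2) (x : List (tm.Γ tm.k₀)) {k : tm.K} (h : k ≠ tm.k₀) :
    (initList tm x).stk k = [] := by
  simp [initList, h]

theorem haltList_self (tm : FinTM2) (x : List (tm.Γ tm.k₁)) : (haltList tm x).stk tm.k₁ = x := by
  simp [haltList]

theorem haltList_of_ne (tm : FinTM2) (x : List (tm.Γ tm.k₁)) {k : tm.K} (h : k ≠ tm.k₁) :
    (haltList tm x).stk k = [] := by
  simp [haltList, h]

theorem rep_eq_update {K : Type} [DecidableEq K] {Γ : K → Type} {kn : K → ℕ}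
    {enc : (Σ k, Γ k) → ℕ} (hkn : Injective kn) (hk2 : ∀ k, 2 ≤ kn k) {S : ∀ k, List (Γ k)}
    {k : K} (hS : ∀ j, j ≠ k → S j = []) :
    rep kn enc [] S = update (st []) (kn k) ((S k).map fun a => enc ⟨k, a⟩) := by
  funext j
  by_cases h1 : j = 1
  · subst h1
    rw [update_of_ne (by have := hk2 k; omega)]
    rfl
  by_cases h : ∃ k', kn k' = j
  · obtain ⟨k', rfl⟩ := h
    rw [rep_kn hkn hk2]
    by_cases hk : k' = k
    · subst hk; simp
    · rw [update_of_ne (hkn.ne hk), hS k' hk]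
      simp
  · push Not at h
    rw [update_of_ne (h k).symm, rep_of_ne h1 h]
    simp

/-- Stack `0` holds input and output, stack `1` the current label and state, and the stacks from `2`
on are those of the machine. The input reaches its stack through stack `1`, two transfers preserving
the order; the result returns in the same way. -/
theorem comp_of_polyTime {α β : Type} {ea : α → List Bool} {eb : β → List Bool} {f : α → β}
    (h : GenSel.PolyTime ea eb f) : Comp (fun a => bits (ea a)) (fun b => bits (eb b)) f := by
  obtain ⟨⟨⟨tm, ia, oa⟩, p, ho⟩⟩ := h
  have := tm.kFin
  have := tm.ΛFin
  have := tm.σFin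
  have : Nonempty (tm.Λ × tm.σ) := ⟨(tm.main, tm.initialState)⟩
  obtain ⟨kn, hkn, hk2⟩ : ∃ kn : tm.K → ℕ, Injective kn ∧ ∀ k, 2 ≤ kn k :=
    ⟨fun k => Fintype.equivFin tm.K k + 2,
      fun a b hab => (Fintype.equivFin tm.K).injective (Fin.ext (Nat.add_right_cancel hab)),
      fun k => Nat.le_add_left _ _⟩
  obtain ⟨ln, hln⟩ := exists_injective_nat (tm.Λ × tm.σ)
  have hUf : (Set.range (fun b => (⟨tm.k₀, ia.symm b⟩ : Σ k, tm.Γ k)) ∪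
      Set.range (fun b => (⟨tm.k₁, oa.symm b⟩ : Σ k, tm.Γ k)) ∪ ⋃ l, pushes (tm.m l)).Finite :=
    ((Set.finite_range _).union (Set.finite_range _)).union
      (Set.finite_iUnion fun l => finite_pushes _)
  obtain ⟨enc, henc⟩ := Set.countable_iff_exists_injOn.1 hUf.countable
  obtain ⟨U, hU⟩ : ∃ U : List (Σ k, tm.Γ k), ∀ a, a ∈ U ↔ a ∈
      (Set.range (fun b => (⟨tm.k₀, ia.symm b⟩ : Σ k, tm.Γ k)) ∪
      Set.range (fun b => (⟨tm.k₁, oa.symm b⟩ : Σ k, tm.Γ k)) ∪ ⋃ l, pushes (tm.m l)) :=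
    ⟨hUf.toFinset.toList, fun a => by simp⟩
  have hUi : ∀ b, (⟨tm.k₀, ia.symm b⟩ : Σ k, tm.Γ k) ∈ U := fun b =>
    (hU _).2 (.inl (.inl ⟨b, rfl⟩))
  have hUo : ∀ b, (⟨tm.k₁, oa.symm b⟩ : Σ k, tm.Γ k) ∈ U := fun b =>
    (hU _).2 (.inl (.inr ⟨b, rfl⟩))
  have hUm : ∀ l, ∀ a ∈ pushes (tm.m l), a ∈ U := fun l a ha =>
    (hU _).2 (.inr (Set.mem_iUnion.2 ⟨l, ha⟩))
  have hinj : Set.InjOn enc {a | a ∈ U} := fun a ha b hb hab =>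
    henc ((hU a).1 ha) ((hU b).1 hb) hab
  obtain ⟨labels, hlab⟩ : ∃ labels : List ℕ, ∀ x, ln x ∈ labels :=
    ⟨Finset.univ.toList.map ln, fun x => by simp⟩
  obtain ⟨C, hC⟩ := run_transMain (m := tm.m) hkn hk2 hln hinj hUm hlab
  set i := kn tm.k₀ with hi
  set j := kn tm.k₁ with hj
  have hi2 : 2 ≤ i := hk2 _
  have hj2 : 2 ≤ j := hk2 _
  set gi : ℕ → ℕ := fun b => enc ⟨tm.k₀, ia.symm (b == 1)⟩ with hgi
  set go : ℕ → ℕ := fun a => if a = enc ⟨tm.k₁, oa.symm true⟩ then 1 else 0 with hgo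
  refine ⟨.seq (.move 0 1 [0, 1] id) (.seq (.move 1 i [0, 1] gi) (.seq (.push 1
    (ln (tm.main, tm.initialState))) (.seq (transMain kn enc ln U tm.m labels)
    (.seq (.move j 1 (U.map enc) go) (.move 1 0 [0, 1] id))))),
    (5 * .X + 1) + ((5 * .X + 1) + (1 + ((.C C * p + 1) + ((.C (U.length + 3) *
      (.X + .C C * p + 1) + 1) + (5 * (.X + .C C * p + 1) + 1))))), fun a => ?_⟩
  set x := ea a with hx
  set y := eb (f a) with hy
  have r1 : Run (.move 0 1 [0, 1] id) (st [bits x]) (update (st []) 1 (bits x).reverse)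
      (5 * x.length + 1) := by
    refine (Run.move (by simp) fun b hb => mem_bits hb).congr rfl ?_ (by simp [bits])
    funext k
    rcases k with _ | _ | k <;> simp
  have r2 : Run (.move 1 i [0, 1] gi) (update (st []) 1 (bits x).reverse)
      (update (st []) i ((bits x).map gi)) (5 * x.length + 1) := by
    refine (Run.move (by omega) fun b hb => ?_).congr rfl ?_ (by simp [bits])
    · rw [update_self, List.mem_reverse] at hb
      exact mem_bits hb
    · funext k
      have : i ≠ 1 := by omega
      rcases k with _ | _ | k <;> simp [update_apply, this]
  have hgib : ∀ b : Bool, gi b.toNat = enc ⟨tm.k₀, ia.symm b⟩ := by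
    intro b; cases b <;> simp [hgi]
  have e1 : rep kn enc [] (initList tm (x.map ia.invFun)).stk
      = update (st []) i ((bits x).map gi) := by
    rw [rep_eq_update hkn hk2 fun k hk => initList_of_ne tm _ hk, initList_self]
    simp only [bits, List.map_map]
    congr 1
    refine List.map_congr_left fun b _ => ?_
    simp only [comp_apply, hgib]
    rfl
  have r3 : Run (.push 1 (ln (tm.main, tm.initialState))) (update (st []) i ((bits x).map gi))
      (rep kn enc (pcOf ln (initList tm (x.map ia.invFun))) (initList tm (x.map ia.invFun)).stk)
      1 := by
    rw [← e1]
    refine (Run.push _ _ _).congr rfl ?_ le_rfl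
    rw [rep_one, update_rep_one]
    rfl
  obtain ⟨⟨n, hn⟩, hnp⟩ := ho a
  have hgood : ∀ k, ∀ b ∈ (initList tm (x.map ia.invFun)).stk k, (⟨k, b⟩ : Σ k, tm.Γ k) ∈ U := by
    intro k b hb
    by_cases hk : k = tm.k₀
    · subst hk
      rw [initList_self, List.mem_map] at hb
      obtain ⟨b', -, rfl⟩ := hb
      exact hUi b'
    · rw [initList_of_ne tm _ hk] at hb
      cases hb
  obtain ⟨r4, -⟩ := hC n _ (haltList tm (y.map oa.invFun)) rfl hgood hn
  have hgob : ∀ b : Bool, go (enc ⟨tm.k₁, oa.symm b⟩) = b.toNat := by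
    intro b
    cases b with
    | true => simp [hgo]
    | false =>
      have : enc ⟨tm.k₁, oa.symm false⟩ ≠ enc ⟨tm.k₁, oa.symm true⟩ := by
        intro h
        have h' := hinj (hUo false) (hUo true) h
        simp at h'
      simp [hgo, this]
  have e2 : rep kn enc [] (haltList tm (y.map oa.invFun)).stk
      = update (st []) j (y.map fun b => enc ⟨tm.k₁, oa.symm b⟩) := by
    rw [rep_eq_update hkn hk2 fun k hk => haltList_of_ne tm _ hk, haltList_self, List.map_map]
    rfl
  rw [e2] at r4
  have hnp' : n ≤ p.eval x.length := hnp
  have hCn : C * n ≤ C * p.eval x.length := Nat.mul_le_mul_left _ hnp'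
  -- The simulation adds at most one symbol per step, which bounds the cost of carrying the output
  -- back.
  have hlen : y.length ≤ x.length + C * p.eval x.length + 1 := by
    have h := r4.length_le j
    rw [update_self, List.length_map] at h
    have h' : (rep kn enc (pcOf ln (initList tm (x.map ia.invFun)))
        (initList tm (x.map ia.invFun)).stk j).length ≤ x.length := by
      rw [rep_kn hkn hk2, List.length_map]
      by_cases hk : tm.k₁ = tm.k₀
      · rw [hk, initList_self, List.length_map]
      · rw [initList_of_ne tm _ hk]
        simp
    omega
  have r5 : Run (.move j 1 (U.map enc) go) (update (st []) j
      (y.map fun b => enc ⟨tm.k₁, oa.symm b⟩)) (update (st []) 1 (bits y).reverse)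
      ((U.length + 3) * y.length + 1) := by
    refine (Run.move (by omega) fun b hb => ?_).congr rfl ?_ (by simp)
    · rw [update_self, List.mem_map] at hb
      obtain ⟨b', -, rfl⟩ := hb
      exact List.mem_map_of_mem (hUo b')
    · have hg : (y.map fun b => enc ⟨tm.k₁, oa.symm b⟩).map go = bits y := by
        rw [List.map_map]
        exact List.map_congr_left fun b _ => hgob b
      have : (1 : ℕ) ≠ j := by omega
      funext k
      rcases k with _ | _ | k <;> simp [update_apply, this, ← hg]
  have r6 : Run (.move 1 0 [0, 1] id) (update (st []) 1 (bits y).reverse) (st [bits y])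
      (5 * y.length + 1) := by
    refine (Run.move (by simp) fun b hb => ?_).congr rfl ?_ (by simp [bits])
    · rw [update_self, List.mem_reverse] at hb
      exact mem_bits hb
    · funext k
      rcases k with _ | _ | k <;> simp
  refine (r1.seq (r2.seq (r3.seq (r4.seq (r5.seq r6))))).mono ?_
  have hl : (bits (ea a)).length = x.length := by simp [bits, hx]
  simp only [hl, Polynomial.eval_add, Polynomial.eval_mul, Polynomial.eval_X, Polynomial.eval_C,
    Polynomial.eval_ofNat, Polynomial.eval_one]
  have := Nat.mul_le_mul_left (U.length + 3) hlen
  omega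

theorem polyTime_iff_comp {α β : Type} {ea : α → List Bool} {eb : β → List Bool} {f : α → β} :
    GenSel.PolyTime ea eb f ↔ Comp (fun a => bits (ea a)) (fun b => bits (eb b)) f :=
  ⟨comp_of_polyTime, Comp.polyTime⟩

theorem bits_injective : Injective bits :=
  List.map_injective_iff.2 fun a b h => by cases a <;> cases b <;> simp_all

/-- There are only countably many polynomial-time computable functions. -/
theorem countable_polyTime {α β : Type} (ea : α → List Bool) {eb : β → List Bool}
    (hb : Injective eb) : {f : α → β | GenSel.PolyTime ea eb f}.Countable := by
  have h : ∀ f : {f : α → β | GenSel.PolyTime ea eb f}, ∃ c : Cmd, ∀ a, ∃ T,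
      Run c (st [bits (ea a)]) (st [bits (eb (f.1 a))]) T := by
    rintro ⟨f, hf⟩
    obtain ⟨c, p, hc⟩ := comp_of_polyTime hf
    exact ⟨c, fun a => ⟨_, hc a⟩⟩
  choose c hc using h
  refine Set.countable_coe_iff.1 (Injective.countable (f := c) fun f g hfg => ?_)
  refine Subtype.ext (funext fun a => hb (bits_injective ?_))
  obtain ⟨T, t, -, h1⟩ := hc f a
  obtain ⟨T', t', -, h2⟩ := hc g a
  rw [hfg] at h1
  exact congrFun (h1.det h2) 0

end StackProg

/-! ### Polynomial-time functions on tree-coded data -/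

namespace StackProg

open Function

/-- Binary trees, the universal data type. -/
inductive Tr : Type
  | nil : Tr
  | node (a b : Tr) : Tr

/-- Trees are coded as self-delimiting strings of symbols `0` and `1`. -/
def Tr.code : Tr → List ℕ
  | .nil => [0]
  | .node a b => 1 :: (a.code ++ b.code)

/-- Data types whose elements are represented by trees. -/
class TreeEnc (α : Type) where
  /-- The tree that represents an element. -/
  toTree : α → Tr

open TreeEnc

/-- The code of an element as a string of symbols. -/
def tcode {α : Type} [TreeEnc α] (a : α) : List ℕ := (toTree a).code

/-- The length of the code of an element. -/
def size {α : Type} [TreeEnc α] (a : α) : ℕ := (tcode a).length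

instance : TreeEnc Unit := ⟨fun _ => .nil⟩

instance : TreeEnc Bool := ⟨fun b => bif b then .node .nil .nil else .nil⟩

instance {α β : Type} [TreeEnc α] [TreeEnc β] : TreeEnc (α × β) :=
  ⟨fun x => .node (toTree x.1) (toTree x.2)⟩

/-- The tree of a list. -/
def listTree {α : Type} [TreeEnc α] : List α → Tr
  | [] => .nil
  | a :: l => .node (toTree a) (listTree l)

instance {α : Type} [TreeEnc α] : TreeEnc (List α) := ⟨listTree⟩

section

variable {α β γ δ σ τ : Type} [TreeEnc α] [TreeEnc β] [TreeEnc γ] [TreeEnc δ] [TreeEnc σ]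
  [TreeEnc τ]

@[simp] theorem tcode_true : tcode true = [1, 0, 0] := rfl

@[simp] theorem tcode_false : tcode false = [0] := rfl

@[simp] theorem tcode_prod (a : α) (b : β) : tcode (a, b) = 1 :: (tcode a ++ tcode b) := rfl

@[simp] theorem tcode_nil : tcode ([] : List α) = [0] := rfl

@[simp] theorem tcode_cons (a : α) (l : List α) : tcode (a :: l) = 1 :: (tcode a ++ tcode l) := rfl

@[simp] theorem size_prod (a : α) (b : β) : size (a, b) = size a + size b + 1 := by simp [size]

@[simp] theorem size_nil : size ([] : List α) = 1 := rfl

@[simp] theorem size_cons (a : α) (l : List α) : size (a :: l) = size a + size l + 1 := by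
  simp [size]

@[simp] theorem size_true : size true = 3 := rfl

@[simp] theorem size_false : size false = 1 := rfl

theorem size_bool_le (b : Bool) : size b ≤ 3 := by cases b <;> simp [size]

theorem Tr.code_mem (t : Tr) : ∀ a ∈ t.code, a ∈ [0, 1] := by
  induction t with
  | nil => simp [Tr.code]
  | node s t ih ih' =>
    intro a ha
    simp only [Tr.code, List.mem_cons, List.mem_append] at ha
    rcases ha with rfl | ha | ha
    · simp
    · exact ih a ha
    · exact ih' a ha

theorem tcode_mem (a : α) : ∀ b ∈ tcode a, b ∈ [0, 1] := Tr.code_mem _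

theorem size_append (l l' : List α) : size (l ++ l') + 1 = size l + size l' := by
  induction l with
  | nil => simp; omega
  | cons a l ih => simp; omega

theorem size_reverse (l : List α) : size l.reverse = size l := by
  induction l with
  | nil => rfl
  | cons a l ih =>
    have := size_append l.reverse [a]
    simp at this ⊢
    omega

theorem size_le_of_mem {a : α} {l : List α} (h : a ∈ l) : size a ≤ size l := by
  induction l with
  | nil => cases h
  | cons b l ih =>
    rw [List.mem_cons] at h
    rcases h with rfl | h
    · simp; omega
    · have := ih h
      simp; omega

theorem length_le_size (l : List α) : l.length ≤ size l := by
  induction l with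
  | nil => simp
  | cons b l ih => simp; omega

/-- Polynomial-time functions between types of tree-coded data. -/
def FP (f : α → β) : Prop := Comp (tcode (α := α)) (tcode (α := β)) f

theorem FP.size_le {f : α → β} (h : FP f) :
    ∃ p : Polynomial ℕ, ∀ a, size (f a) ≤ p.eval (size a) := Comp.length_le h

theorem FP.id : FP fun a : α => a := ⟨.skip, 1, fun a => (Run.skip _).mono (by simp)⟩

theorem FP.comp {g : β → γ} {f : α → β} (hg : FP g) (hf : FP f) : FP fun a => g (f a) :=
  Comp.comp hg hf

theorem FP.congr {f g : α → β} (hf : FP f) (h : ∀ a, f a = g a) : FP g := by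
  rwa [← (funext h : f = g)]

/-- Push a fixed word. -/
def Cmd.pushWord : List ℕ → Cmd
  | [] => .skip
  | a :: w => .seq (Cmd.pushWord w) (.push 0 a)

theorem Run.pushWord (w u : List ℕ) : Run (Cmd.pushWord w) (st [u]) (st [w ++ u])
    (w.length + 1) := by
  induction w with
  | nil => exact Run.skip _
  | cons a w ih => exact ih.seq (Run.push_st (k := 0) (by simp))

theorem FP.const (b : β) : FP fun _ : α => b := by
  refine ⟨.seq (.clear 0 [0, 1]) (.pushWord (tcode b)), 2 * .X + 1 + (.C (size b) + 1),
    fun a => ?_⟩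
  have h1 := Run.clear_st (i := 0) (S := [0, 1]) (L := [tcode a]) (by simp) (tcode_mem a)
  have h2 := Run.pushWord (tcode b) []
  rw [List.append_nil] at h2
  exact (h1.seq h2).mono (by simp [size])

/-- Move stack `1` onto both stacks `2` and `3`. -/
def Cmd.dup : Cmd :=
  .loop 1 [0, 1] (.switch 1 [0, 1] fun a => .seq (.pop 1) (.seq (.push 2 a) (.push 3 a)))

theorem Run.dup (l u v : List ℕ) (hl : ∀ a ∈ l, a ∈ [0, 1]) :
    Run .dup (st [[], l, u, v]) (st [[], [], l.reverse ++ u, l.reverse ++ v])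
      (6 * l.length + 1) := by
  induction l generalizing u v with
  | nil => exact (Run.loop_done rfl).mono (by simp)
  | cons a l ih =>
    have ha := hl a (by simp)
    have h1 : Run (.seq (.pop 1) (.seq (.push 2 a) (.push 3 a))) (st [[], a :: l, u, v])
        (st [[], l, a :: u, a :: v]) 3 :=
      (Run.pop_st (k := 1) (by simp)).seq
        ((Run.push_st (k := 2) (by simp)).seq (Run.push_st (k := 3) (by simp)))
    refine (Run.loop_step ?_ (Run.switch (a := a) rfl ha h1)
      (ih (a :: u) (a :: v) fun b hb => hl b (by simp [hb]))).congr rfl (by simp) ?_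
    · exact decide_eq_true ha
    · simp only [List.length_cons, List.length_nil]; omega

/-- The input is copied to stacks `2` and `3`. One program then uses the even stacks from `2` on,
the other the odd ones from `3` on, so they do not interfere. Finally both results are put on stack
`0` under the symbol `1` of a pair. -/
theorem FP.pair {f : α → β} {g : α → γ} (hf : FP f) (hg : FP g) : FP fun a => (f a, g a) := by
  obtain ⟨q, hq⟩ := hf.size_le
  obtain ⟨r, hr⟩ := hg.size_le
  obtain ⟨c, p, hc⟩ := hf
  obtain ⟨d, p', hd⟩ := hg
  refine ⟨.seq (.move 0 1 [0, 1] _root_.id) (.seq .dup (.seq (c.rename fun j => 2 * j + 2)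
    (.seq (d.rename fun j => 2 * j + 3) (.seq (.move 3 1 [0, 1] _root_.id)
    (.seq (.move 1 0 [0, 1] _root_.id) (.seq (.move 2 1 [0, 1] _root_.id)
    (.seq (.move 1 0 [0, 1] _root_.id) (.push 0 1)))))))),
    (5 * .X + 1) + ((6 * .X + 1) + (p + (p' + ((5 * r + 1) + ((5 * r + 1) + ((5 * q + 1) +
      ((5 * q + 1) + 1))))))), fun a => ?_⟩
  set x := tcode a with hx
  set y := tcode (f a) with hy
  set z := tcode (g a) with hz
  have hx' := tcode_mem a
  have hy' := tcode_mem (f a)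
  have hz' := tcode_mem (g a)
  have rv : ∀ l : List ℕ, (l.map _root_.id).reverse = l.reverse := by simp
  have r1 : Run (.move 0 1 [0, 1] _root_.id) (st [x]) (st [[], x.reverse, [], []])
      (5 * x.length + 1) := by
    have := Run.move_st (i := 0) (j := 1) (by simp) (S := [0, 1]) (g := _root_.id)
      (L := [x, [], [], []]) (by simp) (by simp) (by simpa using hx')
    exact this.congr (st_four x) (by simp) le_rfl
  have r2 := Run.dup x.reverse [] [] (by simpa using hx')
  have r3 : Run (c.rename fun j => 2 * j + 2) (st [[], [], x, x]) (st [[], [], y, x])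
      (p.eval x.length) := by
    refine Run.rename (fun a b h => by simpa using h) (hc a) ?_ ?_ fun k hk => ?_
    · funext j
      cases j <;> rfl
    · funext j
      cases j <;> rfl
    · rcases k with _ | _ | _ | k
      · rfl
      · rfl
      · exact absurd ⟨0, rfl⟩ hk
      · rfl
  have r4 : Run (d.rename fun j => 2 * j + 3) (st [[], [], y, x]) (st [[], [], y, z])
      (p'.eval x.length) := by
    refine Run.rename (fun a b h => by simpa using h) (hd a) ?_ ?_ fun k hk => ?_
    · funext j
      cases j <;> rfl
    · funext j
      cases j <;> rfl
    · rcases k with _ | _ | _ | _ | k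
      · rfl
      · rfl
      · rfl
      · exact absurd ⟨0, rfl⟩ hk
      · rfl
  have r5 := Run.move_st (i := 3) (j := 1) (by simp) (S := [0, 1]) (g := _root_.id)
    (L := [[], [], y, z]) (by simp) (by simp) (by simpa using hz')
  have r6 := Run.move_st (i := 1) (j := 0) (by simp) (S := [0, 1]) (g := _root_.id)
    (L := [[], z.reverse, y, []]) (by simp) (by simp) (by simpa using hz')
  have r7 := Run.move_st (i := 2) (j := 1) (by simp) (S := [0, 1]) (g := _root_.id)
    (L := [z, [], y, []]) (by simp) (by simp) (by simpa using hy')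
  have r8 := Run.move_st (i := 1) (j := 0) (by simp) (S := [0, 1]) (g := _root_.id)
    (L := [z, y.reverse, [], []]) (by simp) (by simp) (by simpa using hy')
  have r9 := Run.push_st (k := 0) (a := 1) (L := [y ++ z, [], [], []]) (by simp)
  simp only [List.set_cons_zero, List.set_cons_succ, List.getD_cons_zero, List.getD_cons_succ,
    List.append_nil, rv, st_four, List.reverse_reverse, List.length_reverse, List.length_cons,
    List.length_nil] at r1 r2 r3 r4 r5 r6 r7 r8 r9
  refine (r1.seq (r2.seq (r3.seq (r4.seq (r5.seq (r6.seq (r7.seq (r8.seq r9)))))))).mono ?_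
  have h1 : y.length ≤ q.eval x.length := hq a
  have h2 : z.length ≤ r.eval x.length := hr a
  simp only [Polynomial.eval_add, Polynomial.eval_mul, Polynomial.eval_X, Polynomial.eval_ofNat,
    Polynomial.eval_one]
  omega

/-- Move one tree from stack `0` to stack `1` (reversing its code); the number of symbols on
stack `2` is the number of trees that are still to be moved. -/
def Cmd.scan : Cmd :=
  .loop 2 [0] (.ite 0 [1] (.seq (.pop 0) (.seq (.push 1 1) (.push 2 0)))
    (.seq (.pop 0) (.seq (.push 1 0) (.pop 2))))

/-- The continuation of the run is arbitrary because a node replaces one pending tree by two, and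
the induction hypotheses are chained. Each symbol costs five steps: loop test, branching and three
stack operations. -/
theorem Run.scan_step (t : Tr) {r u c : List ℕ} {s' : Store} {T : ℕ}
    (h : Run .scan (st [r, t.code.reverse ++ u, c]) s' T) :
    Run .scan (st [t.code ++ r, u, 0 :: c]) s' (5 * t.code.length + T) := by
  induction t generalizing r u c T with
  | nil =>
    have h1 : Run (.seq (.pop 0) (.seq (.push 1 0) (.pop 2))) (st [0 :: r, u, 0 :: c])
        (st [r, 0 :: u, c]) 3 :=
      (Run.pop_st (k := 0) (by simp)).seq
        ((Run.push_st (k := 1) (by simp)).seq (Run.pop_st (k := 2) (by simp)))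
    exact (Run.loop_step rfl (Run.ite_neg rfl h1) h).congr rfl rfl (by simp [Tr.code]; omega)
  | node a b iha ihb =>
    have h1 : Run (.seq (.pop 0) (.seq (.push 1 1) (.push 2 0)))
        (st [1 :: (a.code ++ (b.code ++ r)), u, 0 :: c])
        (st [a.code ++ (b.code ++ r), 1 :: u, 0 :: 0 :: c]) 3 :=
      (Run.pop_st (k := 0) (by simp)).seq
        ((Run.push_st (k := 1) (by simp)).seq (Run.push_st (k := 2) (by simp)))
    have h2 := iha (ihb (r := r) (u := a.code.reverse ++ (1 :: u)) (c := c) (T := T)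
      (by simpa [Tr.code] using h))
    refine (Run.loop_step rfl (Run.ite_pos rfl h1) h2).congr (by simp [Tr.code]) rfl ?_
    simp [Tr.code]; omega

theorem Run.scan_pair (a : α) (b : β) : Run (.seq (.pop 0) (.seq (.push 2 0) .scan))
    (st [tcode (a, b)]) (st [tcode b, (tcode a).reverse, []]) (5 * size a + 3) := by
  have h1 : Run .scan (st [tcode a ++ tcode b, [], [0]]) (st [tcode b, (tcode a).reverse, []])
      (5 * size a + 1) := by
    refine Run.scan_step (toTree a) ?_
    exact (Run.loop_done rfl).congr (by simp [tcode]) rfl le_rfl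
  rw [← st_three]
  exact ((Run.pop_st (k := 0) (by simp)).seq
    ((Run.push_st (k := 2) (by simp)).seq h1)).mono (by omega)

theorem FP.fst : FP fun x : α × β => x.1 := by
  refine ⟨.seq (.seq (.pop 0) (.seq (.push 2 0) .scan)) (.seq (.clear 0 [0, 1])
    (.move 1 0 [0, 1] _root_.id)), 5 * .X + 3 + ((2 * .X + 1) + (5 * .X + 1)), ?_⟩
  rintro ⟨a, b⟩
  have h2 := Run.clear_st (i := 0) (S := [0, 1]) (L := [tcode b, (tcode a).reverse, []])
    (by simp) (tcode_mem b)
  have h3 := Run.move_st (i := 1) (j := 0) (by simp) (S := [0, 1]) (g := _root_.id)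
    (L := [[], (tcode a).reverse, []]) (by simp) (by simp) (by simpa using tcode_mem a)
  refine ((Run.scan_pair a b).seq (h2.seq h3)).congr rfl ?_ ?_
  · simp [st_three]
  · simp [size]; omega

theorem FP.snd : FP fun x : α × β => x.2 := by
  refine ⟨.seq (.seq (.pop 0) (.seq (.push 2 0) .scan)) (.clear 1 [0, 1]),
    5 * .X + 3 + (2 * .X + 1), ?_⟩
  rintro ⟨a, b⟩
  have h2 := Run.clear_st (i := 1) (S := [0, 1]) (L := [tcode b, (tcode a).reverse, []])
    (by simp) (by simpa using tcode_mem a)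
  refine ((Run.scan_pair a b).seq h2).congr rfl ?_ ?_
  · simp [st_three]
  · simp [size]; omega

/-- Case distinction on whether the first component is represented by the empty tree. -/
theorem FP.caseNil {F : δ × α → γ} {f : α → γ} {g : (β × τ) × α → γ} (hf : FP f) (hg : FP g)
    (h : ∀ d a, toTree d = .nil ∧ F (d, a) = f a ∨
      ∃ b, toTree d = toTree b ∧ F (d, a) = g (b, a)) : FP F := by
  obtain ⟨c, p, hc⟩ := hf
  obtain ⟨d, q, hd⟩ := hg
  -- Below the symbol `1` of the pair, a `0` shows that the first component is the empty tree;
  -- deleting it leaves the code of `a`. Otherwise the `1` is put back, and the word is also the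
  -- code of `(b, a)`.
  refine ⟨.seq (.pop 0) (.ite 0 [0] (.seq (.pop 0) c) (.seq (.push 0 1) d)), p + q + 3, ?_⟩
  rintro ⟨e, a⟩
  rcases h e a with ⟨h1, h2⟩ | ⟨b, h1, h2⟩
  · have h3 : tcode e = [0] := by rw [tcode, h1, Tr.code]
    rw [h2, tcode_prod, h3]
    refine ((Run.pop_st (k := 0) (by simp)).seq (Run.ite_pos rfl
      ((Run.pop_st (k := 0) (by simp)).seq (hc a)))).mono ?_
    have := eval_mono p ((Nat.le_succ (tcode a).length).trans (Nat.le_succ _))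
    simp at this ⊢
    omega
  · have h3 : tcode e = tcode b := by rw [tcode, h1, tcode]
    have h4 : tcode (e, a) = tcode (b, a) := by rw [tcode_prod, tcode_prod, h3]
    rw [h2, h4]
    refine ((Run.pop_st (k := 0) (by simp)).seq (Run.ite_neg ?_
      ((Run.push_st (k := 0) (by simp)).seq (hd (b, a))))).mono ?_
    · obtain ⟨b₁, b₂⟩ := b
      simp
    · simp
      omega

/-- Case distinction on a Boolean. -/
theorem FP.cond {b : α → Bool} {f g : α → γ} (hb : FP b) (hf : FP f) (hg : FP g) :
    FP fun a => if b a then f a else g a := by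
  have : FP fun x : Bool × α => if x.1 then f x.2 else g x.2 := by
    refine FP.caseNil (β := Unit) (τ := Unit) hg (hf.comp FP.snd) ?_
    rintro (_ | _) a
    · exact .inl ⟨rfl, rfl⟩
    · exact .inr ⟨((), ()), rfl, rfl⟩
  exact this.comp (hb.pair FP.id)

/-- Case distinction on a list. -/
theorem FP.caseList {l : α → List β} {f : α → γ} {g : (β × List β) × α → γ} (hl : FP l)
    (hf : FP f) (hg : FP g) {F : α → γ} (h0 : ∀ a, l a = [] → F a = f a)
    (h1 : ∀ a b t, l a = b :: t → F a = g ((b, t), a)) : FP F := by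
  have : FP fun x : List β × α => match x.1 with
      | [] => f x.2
      | b :: t => g ((b, t), x.2) := by
    refine FP.caseNil hf hg ?_
    rintro (_ | ⟨b, t⟩) a
    · exact .inl ⟨rfl, rfl⟩
    · exact .inr ⟨(b, t), rfl, rfl⟩
  refine (this.comp (hl.pair FP.id)).congr fun a => ?_
  cases h : l a with
  | nil => exact (h0 a h).symm
  | cons b t => exact (h1 a b t h).symm

/-- A nonempty list has the same code as the pair of its head and its tail. -/
theorem FP.cons {f : α → β} {g : α → List β} (hf : FP f) (hg : FP g) : FP fun a => f a :: g a := by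
  obtain ⟨c, p, h⟩ := hf.pair hg
  exact ⟨c, p, h⟩

/-- Iteration of a step function until the first component becomes empty. -/
theorem FP.iterate {i : α → List β × τ} {step : List β × τ → List β × τ} (hi : FP i)
    (hs : FP step) (N : α → ℕ) (p : Polynomial ℕ) (hN : ∀ a, N a ≤ p.eval (size a))
    (h0 : ∀ a, (step^[N a] (i a)).1 = []) (h1 : ∀ a, ∀ n < N a, (step^[n] (i a)).1 ≠ [])
    (hp : ∀ a, ∀ n ≤ N a, size (step^[n] (i a)) ≤ p.eval (size a)) :
    FP fun a => step^[N a] (i a) := by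
  obtain ⟨c, q, hc⟩ := hi
  obtain ⟨d, r, hd⟩ := hs
  -- Between rounds the symbol `1` of the pair is removed, so that the top symbol tells whether the
  -- list component is empty. A round costs the step function plus `3`: test, push and pop.
  refine ⟨.seq c (.seq (.pop 0) (.seq (.loop 0 [1] (.seq (.push 0 1) (.seq d (.pop 0))))
    (.push 0 1))), q + (1 + (p * (r.comp p + 3) + 1 + 1)), fun a => ?_⟩
  have key : ∀ k n, n + k = N a → Run (.loop 0 [1] (.seq (.push 0 1) (.seq d (.pop 0))))
      (st [(tcode (step^[n] (i a))).tail]) (st [(tcode (step^[N a] (i a))).tail])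
      (k * (r.eval (p.eval (size a)) + 3) + 1) := by
    intro k
    induction k with
    | zero =>
      intro n hn
      simp only [Nat.add_zero] at hn
      subst hn
      refine (Run.loop_done ?_).mono (by simp)
      have := h0 a
      revert this
      generalize step^[N a] (i a) = x
      obtain ⟨l, x⟩ := x
      rintro rfl
      rfl
    | succ k ih =>
      intro n hn
      have h2 := ih (n + 1) (by omega)
      rw [iterate_succ_apply'] at h2
      have h3 := h1 a n (by omega)
      have h4 := hp a n (by omega)
      revert h2 h3 h4
      generalize step^[n] (i a) = x
      intro h2 h3 h4
      have e1 : tcode x = 1 :: (tcode x).tail := by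
        obtain ⟨l, x⟩ := x
        rfl
      have e2 : ((tcode x).tail).head? = some 1 := by
        obtain ⟨_ | ⟨b, l⟩, x⟩ := x
        · exact absurd rfl h3
        · rfl
      have r1 : Run (.push 0 1) (st [(tcode x).tail]) (st [tcode x]) 1 :=
        (Run.push_st (k := 0) (by simp)).congr rfl (by simp [← e1]) le_rfl
      refine (Run.loop_step (by simp [e2]) (r1.seq ((hd x).seq (Run.pop_st (k := 0) (by simp))))
        h2).mono ?_
      have := eval_mono r h4
      simp only [size] at this ⊢
      rw [Nat.succ_mul]
      omega
  have e1 : tcode (step^[N a] (i a)) = 1 :: (tcode (step^[N a] (i a))).tail := by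
    generalize step^[N a] (i a) = x
    obtain ⟨l, x⟩ := x
    rfl
  rw [e1]
  refine ((hc a).seq ((Run.pop_st (k := 0) (by simp)).seq ((key (N a) 0 (by simp)).seq
    (Run.push_st (k := 0) (by simp))))).mono ?_
  have := Nat.mul_le_mul_right (r.eval (p.eval (size a)) + 3) (hN a)
  simp [size] at this ⊢
  omega

/-- Recursion along a list, the size of the intermediate results being polynomially bounded. -/
theorem FP.foldl {l : α → List β} {i : α → σ} {g : α → σ → β → σ} (hl : FP l) (hi : FP i)
    (hg : FP fun x : α × σ × β => g x.1 x.2.1 x.2.2) (p : Polynomial ℕ)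
    (hp : ∀ a l₁ l₂, l a = l₁ ++ l₂ → size (l₁.foldl (g a) (i a)) ≤ p.eval (size a)) :
    FP fun a => (l a).foldl (g a) (i a) := by
  obtain ⟨q, hq⟩ := hl.size_le
  -- The state consists of the rest of the list, the accumulator and the fixed argument.
  let step : List β × σ × α → List β × σ × α := fun x =>
    match x.1 with
    | [] => x
    | b :: t => (t, g x.2.2 x.2.1 b, x.2.2)
  have hstep : FP step := by
    refine FP.caseList (l := fun x : List β × σ × α => x.1)
      (g := fun y => (y.1.2, g y.2.2.2 y.2.2.1 y.1.1, y.2.2.2)) FP.fst FP.id ?_ ?_ ?_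
    · have e1 : FP fun y : (β × List β) × List β × σ × α => y.2.2.2 :=
        FP.snd.comp (FP.snd.comp FP.snd)
      have e2 : FP fun y : (β × List β) × List β × σ × α => y.2.2.1 :=
        FP.fst.comp (FP.snd.comp FP.snd)
      have e3 : FP fun y : (β × List β) × List β × σ × α => y.1.1 := FP.fst.comp FP.fst
      exact (FP.snd.comp FP.fst).pair ((hg.comp (e1.pair (e2.pair e3))).pair e1)
    · rintro ⟨l, x⟩ h
      cases h
      rfl
    · rintro ⟨l, x⟩ b t h
      cases h
      rfl
  have key : ∀ a (l₁ l₂ : List β) (s : σ),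
      step^[l₁.length] (l₁ ++ l₂, s, a) = (l₂, l₁.foldl (g a) s, a) := by
    intro a l₁
    induction l₁ with
    | nil => intro l₂ s; rfl
    | cons b l₁ ih => intro l₂ s; exact ih l₂ (g a s b)
  have key' : ∀ a n, n ≤ (l a).length →
      step^[n] (l a, i a, a) = ((l a).drop n, ((l a).take n).foldl (g a) (i a), a) := by
    intro a n hn
    have := key a ((l a).take n) ((l a).drop n) (i a)
    rwa [List.length_take_of_le hn, List.take_append_drop] at this
  have := FP.iterate (i := fun a => (l a, i a, a)) (hl.pair (hi.pair FP.id)) hstep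
    (fun a => (l a).length) (q + p + .X + 2) (fun a => ?_) (fun a => ?_) (fun a n hn => ?_)
    (fun a n hn => ?_)
  · refine (FP.fst.comp (FP.snd.comp this)).congr fun a => ?_
    rw [key' a _ le_rfl, List.take_length]
  · have := (length_le_size (l a)).trans (hq a)
    simp only [Polynomial.eval_add, Polynomial.eval_X, Polynomial.eval_ofNat]
    omega
  · rw [key' a _ le_rfl, List.drop_length]
  · rw [key' a n hn.le]
    simpa using hn
  · rw [key' a n hn]
    have h1 := hp a ((l a).take n) ((l a).drop n) (List.take_append_drop n (l a)).symm
    have h2 : size ((l a).drop n) ≤ size (l a) := by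
      have := size_append ((l a).take n) ((l a).drop n)
      rw [List.take_append_drop] at this
      have h3 : 1 ≤ size ((l a).take n) := by
        cases (l a).take n <;> simp
      omega
    have h3 := hq a
    simp
    omega

/-- Recursion along a list, each step adding only little to the result. -/
theorem FP.foldl_add {l : α → List β} {i : α → σ} {g : α → σ → β → σ} (hl : FP l) (hi : FP i)
    (hg : FP fun x : α × σ × β => g x.1 x.2.1 x.2.2) (p : Polynomial ℕ)
    (hp : ∀ a s b, b ∈ l a → size (g a s b) ≤ size s + p.eval (size a)) :
    FP fun a => (l a).foldl (g a) (i a) := by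
  obtain ⟨q, hq⟩ := hl.size_le
  obtain ⟨r, hr⟩ := hi.size_le
  refine FP.foldl hl hi hg (r + q * p) fun a l₁ l₂ h => ?_
  have key : ∀ (m : List β) (s : σ), (∀ b ∈ m, b ∈ l a) →
      size (m.foldl (g a) s) ≤ size s + m.length * p.eval (size a) := by
    intro m
    induction m with
    | nil => intro s _; simp
    | cons b m ih =>
      intro s hm
      have h1 := ih (g a s b) fun b' hb' => hm b' (by simp [hb'])
      have h2 := hp a s b (hm b (by simp))
      simp only [List.foldl_cons, List.length_cons, Nat.succ_mul]
      omega
  have h1 := key l₁ (i a) fun b hb => by simp [h, hb]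
  have h2 : l₁.length ≤ q.eval (size a) := by
    have := (length_le_size (l a)).trans (hq a)
    simp [h] at this
    omega
  have h3 := Nat.mul_le_mul_right (p.eval (size a)) h2
  have h4 := hr a
  simp
  omega

end

/-! ### Conversion between strings and their trees -/

/-- Read a string from stack `0` and write the code of its tree. -/
theorem comp_bits_tcode : Comp bits (tcode (α := List Bool)) fun x => x := by
  refine ⟨.seq (.move 0 1 [0, 1] id) (.seq (.push 0 0) (.loop 1 [0, 1] (.ite 1 [0]
    (.seq (.pop 1) (.seq (.push 0 0) (.push 0 1)))
    (.seq (.pop 1) (.seq (.push 0 0) (.seq (.push 0 0) (.seq (.push 0 1) (.push 0 1)))))))),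
    5 * .X + 1 + (1 + (7 * .X + 1)), fun x => ?_⟩
  set body := Cmd.ite 1 [0] (.seq (.pop 1) (.seq (.push 0 0) (.push 0 1)))
    (.seq (.pop 1) (.seq (.push 0 0) (.seq (.push 0 0) (.seq (.push 0 1) (.push 0 1)))))
    with hbody
  have key : ∀ z y : List Bool, Run (.loop 1 [0, 1] body) (st [tcode y, bits z])
      (st [tcode (z.reverse ++ y)]) (7 * z.length + 1) := by
    intro z
    induction z with
    | nil => intro y; exact (Run.loop_done rfl).congr rfl (st_two _) (by simp)
    | cons b z ih =>
      intro y
      have h1 : Run body (st [tcode y, bits (b :: z)]) (st [tcode (b :: y), bits z]) 6 := by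
        cases b with
        | false =>
          exact (Run.ite_pos rfl ((Run.pop_st (k := 1) (by simp)).seq
            ((Run.push_st (k := 0) (by simp)).seq (Run.push_st (k := 0) (by simp))))).mono
              (by simp)
        | true =>
          exact Run.ite_neg rfl ((Run.pop_st (k := 1) (by simp)).seq
            ((Run.push_st (k := 0) (by simp)).seq ((Run.push_st (k := 0) (by simp)).seq
            ((Run.push_st (k := 0) (by simp)).seq (Run.push_st (k := 0) (by simp))))))
      refine (Run.loop_step ?_ h1 (ih (b :: y))).congr rfl (by simp) ?_
      · cases b <;> rfl
      · simp only [List.length_cons]; omega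
  have h1 := Run.move_st (i := 0) (j := 1) (by simp) (S := [0, 1]) (g := id)
    (L := [bits x, []]) (by simp) (by simp) (fun a ha => mem_bits ha)
  have h2 := key x.reverse []
  refine (Run.seq (h1.congr (st_two _) rfl le_rfl)
    ((Run.push_st (k := 0) (by simp)).seq (h2.congr ?_ ?_ le_rfl))).mono ?_
  · simp [bits]
  · simp
  · simp [bits]

/-- Read the code of the tree of a string from stack `0` and write the string. -/
theorem comp_tcode_bits : Comp (tcode (α := List Bool)) bits fun x => x := by
  refine ⟨.seq (.loop 0 [1] (.seq (.pop 0) (.ite 0 [0] (.seq (.pop 0) (.push 1 0))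
    (.seq (.pop 0) (.seq (.pop 0) (.seq (.pop 0) (.push 1 1))))))) (.seq (.pop 0)
    (.move 1 0 [0, 1] id)), 7 * .X + 1 + (1 + (5 * .X + 1)), fun x => ?_⟩
  set body := Cmd.seq (.pop 0) (.ite 0 [0] (.seq (.pop 0) (.push 1 0))
    (.seq (.pop 0) (.seq (.pop 0) (.seq (.pop 0) (.push 1 1))))) with hbody
  have key : ∀ z y : List Bool, Run (.loop 0 [1] body) (st [tcode z, bits y])
      (st [[0], bits (z.reverse ++ y)]) (7 * z.length + 1) := by
    intro z
    induction z with
    | nil => intro y; exact (Run.loop_done rfl).mono (by simp)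
    | cons b z ih =>
      intro y
      have h1 : Run body (st [tcode (b :: z), bits y]) (st [tcode z, bits (b :: y)]) 6 := by
        cases b with
        | false =>
          exact ((Run.pop_st (k := 0) (by simp)).seq (Run.ite_pos rfl
            ((Run.pop_st (k := 0) (by simp)).seq (Run.push_st (k := 1) (by simp))))).mono
              (by simp)
        | true =>
          exact (Run.pop_st (k := 0) (by simp)).seq (Run.ite_neg rfl
            ((Run.pop_st (k := 0) (by simp)).seq ((Run.pop_st (k := 0) (by simp)).seq
            ((Run.pop_st (k := 0) (by simp)).seq (Run.push_st (k := 1) (by simp))))))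
      refine (Run.loop_step rfl h1 (ih (b :: y))).congr rfl (by simp) ?_
      simp only [List.length_cons]; omega
  have h1 := key x []
  have h2 := Run.move_st (i := 1) (j := 0) (by simp) (S := [0, 1]) (g := id)
    (L := [[], bits x.reverse]) (by simp) (by simp) (fun a ha => mem_bits ha)
  refine (Run.seq (h1.congr (st_two _) rfl le_rfl)
    ((Run.pop_st (k := 0) (by simp)).seq (h2.congr ?_ ?_ le_rfl))).mono ?_
  · simp
  · simp [bits, st_two]
  · have := length_le_size x
    simp [bits, size] at this ⊢
    omega

end StackProg

/-! ### A library of polynomial-time functions -/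

namespace StackProg

open Function

section

variable {α β γ δ σ τ : Type} [TreeEnc α] [TreeEnc β] [TreeEnc γ] [TreeEnc δ] [TreeEnc σ]
  [TreeEnc τ]

attribute [fun_prop] FP FP.id FP.const FP.comp FP.pair FP.cons FP.cond

@[fun_prop] theorem FP.fst_comp {f : α → β × γ} (hf : FP f) : FP fun a => (f a).1 :=
  FP.fst.comp hf

@[fun_prop] theorem FP.snd_comp {f : α → β × γ} (hf : FP f) : FP fun a => (f a).2 :=
  FP.snd.comp hf

/-- The results of a function on the elements of a list are polynomially bounded. -/
theorem FP.size_le_of_mem {l : α → List β} {f : α → β → γ} (hl : FP l)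
    (hf : FP fun x : α × β => f x.1 x.2) :
    ∃ p : Polynomial ℕ, ∀ a, ∀ b ∈ l a, size (f a b) ≤ p.eval (size a) := by
  obtain ⟨q, hq⟩ := hl.size_le
  obtain ⟨r, hr⟩ := hf.size_le
  refine ⟨r.comp (.X + q + 1), fun a b hb => (hr (a, b)).trans ?_⟩
  rw [Polynomial.eval_comp]
  refine eval_mono r ?_
  have := (StackProg.size_le_of_mem hb).trans (hq a)
  simp
  omega

@[fun_prop] theorem FP.reverse {l : α → List β} (hl : FP l) : FP fun a => (l a).reverse := by
  obtain ⟨q, hq⟩ := hl.size_le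
  refine (FP.foldl_add (g := fun _ s b => b :: s) hl (FP.const []) (by fun_prop) (q + 1)
    fun a s b hb => ?_).congr fun a => ?_
  · have := (StackProg.size_le_of_mem hb).trans (hq a)
    simp
    omega
  · have : ∀ l s : List β, l.foldl (fun s b => b :: s) s = l.reverse ++ s := by
      intro l
      induction l with
      | nil => simp
      | cons b l ih => simp [ih]
    simp [this]

@[fun_prop] theorem FP.append {l l' : α → List β} (hl : FP l) (hl' : FP l') :
    FP fun a => l a ++ l' a := by
  obtain ⟨q, hq⟩ := hl.size_le
  refine (FP.foldl_add (l := fun a => (l a).reverse) (g := fun _ s b => b :: s) (by fun_prop) hl'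
    (by fun_prop) (q + 1) fun a s b hb => ?_).congr fun a => ?_
  · have := (StackProg.size_le_of_mem (List.mem_reverse.1 hb)).trans (hq a)
    simp
    omega
  · have : ∀ l s : List β, l.foldl (fun s b => b :: s) s = l.reverse ++ s := by
      intro l
      induction l with
      | nil => simp
      | cons b l ih => simp [ih]
    simp [this]

theorem FP.flatMap {l : α → List β} {f : α → β → List γ} (hl : FP l)
    (hf : FP fun x : α × β => f x.1 x.2) : FP fun a => (l a).flatMap (f a) := by
  obtain ⟨q, hq⟩ := FP.size_le_of_mem hl hf
  have : FP fun a => (l a).foldl (fun s b => (f a b).reverse ++ s) [] := by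
    refine FP.foldl_add (g := fun a s b => (f a b).reverse ++ s) hl (FP.const []) (by fun_prop) q
      fun a s b hb => ?_
    have := hq a b hb
    have h2 := size_append (f a b).reverse s
    rw [size_reverse] at h2
    omega
  refine (FP.reverse this).congr fun a => ?_
  have key : ∀ (l : List β) (s : List γ),
      (l.foldl (fun s b => (f a b).reverse ++ s) s).reverse = s.reverse ++ l.flatMap (f a) := by
    intro l
    induction l with
    | nil => simp
    | cons b l ih =>
      intro s
      rw [List.foldl_cons, ih]
      simp
  simpa using key (l a) []

theorem FP.map {l : α → List β} {f : α → β → γ} (hl : FP l)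
    (hf : FP fun x : α × β => f x.1 x.2) : FP fun a => (l a).map (f a) := by
  refine (FP.flatMap (f := fun a b => [f a b]) hl (by fun_prop)).congr fun a => ?_
  induction l a <;> simp_all

theorem FP.filter {l : α → List β} {f : α → β → Bool} (hl : FP l)
    (hf : FP fun x : α × β => f x.1 x.2) : FP fun a => (l a).filter (f a) := by
  refine (FP.flatMap (f := fun a b => if f a b then [b] else []) hl (by fun_prop)).congr
    fun a => ?_
  induction l a with
  | nil => rfl
  | cons b l ih => by_cases h : f a b <;> simp_all

@[fun_prop] theorem FP.not {f : α → Bool} (hf : FP f) : FP fun a => !(f a) :=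
  (FP.cond hf (FP.const false) (FP.const true)).congr fun a => by cases f a <;> rfl

@[fun_prop] theorem FP.and {f g : α → Bool} (hf : FP f) (hg : FP g) : FP fun a => f a && g a :=
  (FP.cond hf hg (FP.const false)).congr fun a => by cases f a <;> rfl

theorem FP.any {l : α → List β} {f : α → β → Bool} (hl : FP l)
    (hf : FP fun x : α × β => f x.1 x.2) : FP fun a => (l a).any (f a) := by
  refine (FP.foldl_add (g := fun a s b => if f a b then true else s) hl (FP.const false)
    (by fun_prop) 3 fun a s b _ => ?_).congr fun a => ?_
  · have := size_bool_le (if f a b then true else s)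
    simp only [Polynomial.eval_ofNat]
    omega
  · have : ∀ (l : List β) (s : Bool),
        l.foldl (fun s b => if f a b then true else s) s = (s || l.any (f a)) := by
      intro l
      induction l with
      | nil => simp
      | cons b l ih =>
        intro s
        rw [List.foldl_cons, ih, List.any_cons]
        cases f a b <;> cases s <;> rfl
    rw [this, Bool.false_or]

@[fun_prop] theorem FP.tail {l : α → List β} (hl : FP l) : FP fun a => (l a).tail := by
  refine FP.caseList (f := fun _ => []) (g := fun x => x.1.2) hl (FP.const _) (by fun_prop) ?_ ?_
  · intro a h; simp [h]
  · intro a b t h; simp [h]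

@[fun_prop] theorem FP.beq_bool {b c : α → Bool} (hb : FP b) (hc : FP c) :
    FP fun a => b a == c a :=
  (FP.cond hb hc hc.not).congr fun a => by cases b a <;> cases c a <;> rfl

end

/-! ### Codings of tuples -/

open GenSel

variable {α β γ : Type} [TreeEnc α] [TreeEnc β] [TreeEnc γ]

@[fun_prop] theorem FP.codeStr {f : α → Str} (hf : FP f) : FP fun a => codeStr (f a) := by
  refine (FP.append (FP.flatMap (f := fun _ b => [true, b]) hf (by fun_prop))
    (FP.const [false])).congr fun a => ?_
  induction f a with
  | nil => rfl
  | cons b x ih => simpa [GenSel.codeStr] using ih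

@[fun_prop] theorem FP.codeTuple {f : α → List Str} (hf : FP f) :
    FP fun a => codeTuple (f a) := by
  refine (FP.flatMap (f := fun _ x => GenSel.codeStr x) hf (by fun_prop)).congr fun a => ?_
  induction f a with
  | nil => rfl
  | cons x l ih => simpa [GenSel.codeTuple] using ih

/-- One step of decoding: the state consists of the information whether a bit of the current string
is expected, of the reversed current string, and of the reversed list of the strings read. -/
def decodeStep (s : Bool × Str × List Str) (b : Bool) : Bool × Str × List Str :=
  if s.1 then (false, b :: s.2.1, s.2.2)
  else if b then (true, s.2.1, s.2.2) else (false, [], s.2.1.reverse :: s.2.2)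

/-- Decoding of tuples. -/
def decodeTuple (z : Str) : List Str := (z.foldl decodeStep (false, [], [])).2.2.reverse

theorem foldl_decodeStep_codeStr (x cur z : Str) (acc : List Str) :
    (codeStr x ++ z).foldl decodeStep (false, cur, acc)
      = z.foldl decodeStep (false, [], (cur.reverse ++ x) :: acc) := by
  induction x generalizing cur with
  | nil => simp [codeStr, decodeStep]
  | cons b x ih =>
    have := ih (b :: cur)
    simpa [codeStr, decodeStep] using this

theorem decodeTuple_codeTuple (l : List Str) : decodeTuple (codeTuple l) = l := by
  have : ∀ acc, (codeTuple l).foldl decodeStep (false, [], acc) = (false, [], l.reverse ++ acc) := by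
    induction l with
    | nil => intro acc; rfl
    | cons x l ih =>
      intro acc
      rw [codeTuple, foldl_decodeStep_codeStr, ih]
      simp
  simp [decodeTuple, this]

@[fun_prop] theorem FP.decodeTuple {f : α → Str} (hf : FP f) : FP fun a => decodeTuple (f a) := by
  have h : FP fun z : Str => z.foldl decodeStep (false, [], []) := by
    refine FP.foldl_add (l := fun z : Str => z) (g := fun _ s b => decodeStep s b) FP.id
      (FP.const _) ?_ 10 ?_
    · unfold decodeStep
      fun_prop
    · rintro - ⟨ph, cur, acc⟩ b -
      have := size_reverse cur
      cases ph <;> cases b <;> simp [decodeStep, this] <;> omega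
  unfold StackProg.decodeTuple
  fun_prop

/-! ### Comparison of strings -/

/-- One step of the comparison: the state consists of the rest of the second string and of the
verdict, if there is one. -/
def lexStep (s : Str × Str) (b : Bool) : Str × Str :=
  match s.2 with
  | _ :: _ => s
  | [] =>
    match s.1 with
    | [] => ([], [false])
    | c :: t => if b == c then (t, []) else (t, [c])

/-- The lexicographical order as a Boolean function. -/
def lexLe : Str → Str → Bool
  | [], _ => true
  | _ :: _, [] => false
  | b :: x, c :: y => if b == c then lexLe x y else c

/-- Recursion on two strings at once becomes a fold along the first, with the rest of the second in
the state, so that `FP.foldl_add` applies. The default `true` covers the case that the first string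
is a prefix of the second. -/
theorem lexLe_eq_foldl (x y : Str) :
    lexLe x y = (x.foldl lexStep (y, [])).2.headD true := by
  have stay : ∀ (x y : Str) (b : Bool), (x.foldl lexStep (y, [b])).2 = [b] := by
    intro x
    induction x with
    | nil => intro y b; rfl
    | cons c x ih => intro y b; exact ih y b
  induction x generalizing y with
  | nil => rfl
  | cons b x ih =>
    cases y with
    | nil =>
      rw [List.foldl_cons, lexStep, stay]
      rfl
    | cons c y =>
      simp only [List.foldl_cons, lexStep, lexLe]
      by_cases hbc : (b == c) = true
      · rw [if_pos hbc, if_pos hbc, ih]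
      · rw [if_neg hbc, if_neg hbc, stay]
        rfl

theorem lexLe_refl (x : Str) : lexLe x x = true := by
  induction x with
  | nil => rfl
  | cons b x ih => simpa [lexLe] using ih

theorem lexLe_total (x y : Str) : lexLe x y = true ∨ lexLe y x = true := by
  induction x generalizing y with
  | nil => exact .inl (by cases y <;> rfl)
  | cons b x ih =>
    cases y with
    | nil => exact .inr rfl
    | cons c y =>
      have := ih y
      cases b <;> cases c <;> simp [lexLe, this]

theorem lexLe_trans {x y z : Str} (h : lexLe x y = true) (h' : lexLe y z = true) :
    lexLe x z = true := by
  induction x generalizing y z with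
  | nil => cases z <;> rfl
  | cons b x ih =>
    rcases y with _ | ⟨c, y⟩
    · cases h
    rcases z with _ | ⟨d, z⟩
    · cases h'
    have := @ih y z
    cases b <;> cases c <;> cases d <;> simp_all [lexLe]

theorem lexLe_antisymm {x y : Str} (h : lexLe x y = true) (h' : lexLe y x = true) : x = y := by
  induction x generalizing y with
  | nil =>
    cases y with
    | nil => rfl
    | cons c y => cases h'
  | cons b x ih =>
    rcases y with _ | ⟨c, y⟩
    · cases h
    have := @ih y
    cases b <;> cases c <;> simp_all [lexLe]

theorem FP.headD {α β : Type} [TreeEnc α] [TreeEnc β] {l : α → List β} (hl : FP l) (b : β) :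
    FP fun a => (l a).headD b := by
  refine FP.caseList (f := fun _ => b) (g := fun x => x.1.1) hl (FP.const _) (by fun_prop) ?_ ?_
  · intro a h; simp [h]
  · intro a b t h; simp [h]

@[fun_prop] theorem FP.lexLe {f g : α → Str} (hf : FP f) (hg : FP g) :
    FP fun a => lexLe (f a) (g a) := by
  have hs : FP fun x : Str × (Str × Str) × Bool => lexStep x.2.1 x.2.2 := by
    refine FP.caseList (l := fun x : Str × (Str × Str) × Bool => x.2.1.2)
      (f := fun x => lexStep (x.2.1.1, []) x.2.2) (g := fun x => x.2.2.1) (by fun_prop) ?_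
      (by fun_prop) ?_ ?_
    · refine FP.caseList (l := fun x : Str × (Str × Str) × Bool => x.2.1.1)
        (f := fun x => ([], [false]))
        (g := fun x => if x.2.2.2 == x.1.1 then (x.1.2, []) else (x.1.2, [x.1.1]))
        (by fun_prop) (by fun_prop) (by fun_prop) ?_ ?_
      · intro a h; simp [lexStep, h]
      · intro a b t h; simp [lexStep, h]
    · rintro ⟨x, ⟨y, v⟩, b⟩ h
      simp at h
      subst h
      rfl
    · rintro ⟨x, ⟨y, v⟩, b⟩ c t h
      simp at h
      subst h
      rfl
  have h : FP fun x : Str × Str => x.1.foldl lexStep (x.2, []) := by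
    refine FP.foldl_add (l := fun x : Str × Str => x.1) (g := fun _ s b => lexStep s b)
      (by fun_prop) (by fun_prop) (hs.comp (f := fun y : (Str × Str) × (Str × Str) × Bool =>
        (y.1.1, y.2)) (by fun_prop)) 10 ?_
    rintro - ⟨y, v⟩ b -
    rcases v with _ | ⟨c, v⟩
    · rcases y with _ | ⟨c, y⟩
      · simp [lexStep, size]
      · have := size_bool_le c
        by_cases hbc : (b == c) = true <;> simp [lexStep, hbc] <;> omega
    · simp [lexStep]
  have h2 : FP fun x : Str × Str => StackProg.lexLe x.1 x.2 :=
    (FP.headD h.snd_comp true).congr fun x => (lexLe_eq_foldl x.1 x.2).symm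
  exact h2.comp (hf.pair hg)

@[fun_prop] theorem FP.beq {f g : α → Str} (hf : FP f) (hg : FP g) : FP fun a => f a == g a := by
  refine (FP.and (hf.lexLe hg) (hg.lexLe hf)).congr fun a => ?_
  rw [Bool.eq_iff_iff, Bool.and_eq_true, beq_iff_eq]
  refine ⟨fun h => lexLe_antisymm h.1 h.2, fun h => ?_⟩
  rw [h]
  exact ⟨lexLe_refl _, lexLe_refl _⟩

@[fun_prop] theorem FP.contains {l : α → List Str} {f : α → Str} (hl : FP l) (hf : FP f) :
    FP fun a => (l a).contains (f a) := by
  refine (FP.any (f := fun a x => f a == x) hl (by fun_prop)).congr fun a => ?_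
  rw [List.contains_eq_any_beq]

/-! ### Polynomial-time functions and `PolyTime` -/

/-- A string given by its tree can be written as a string of bits. -/
theorem FP.comp_bits {f : α → Str} (hf : FP f) : Comp tcode bits f :=
  comp_tcode_bits.comp hf

/-- Tree codes and self-delimiting codes are translated into each other in polynomial time, so
selectors on pairs can be treated through `FP` alone. -/
theorem polyTime_codePair_iff {f : Str × Str → Str} : PolyTime codePair id f ↔ FP f := by
  rw [polyTime_iff_comp]
  have h1 : FP codePair := by
    have : FP fun x : Str × Str => GenSel.codeTuple [x.1, x.2] := by fun_prop
    exact this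
  constructor
  · intro h
    exact (comp_bits_tcode.comp (h.comp h1.comp_bits) :)
  · intro h
    have h2 : Comp bits (tcode (α := Str × Str)) fun z =>
        ((decodeTuple z).headD [], (decodeTuple z).tail.headD []) := by
      have h4 : FP fun z => ((StackProg.decodeTuple z).headD [],
        (StackProg.decodeTuple z).tail.headD []) :=
        (FP.headD (by fun_prop) []).pair (FP.headD (by fun_prop) [])
      exact Comp.comp (eb := tcode (α := Str)) h4 comp_bits_tcode
    obtain ⟨c, p, hc⟩ := comp_tcode_bits.comp (Comp.comp h h2)
    refine ⟨c, p, fun x => (hc (codePair x)).congr rfl ?_ le_rfl⟩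
    simp [codePair, decodeTuple_codeTuple]

/-- The code of a set lists its elements in order, so it suffices to compute on sorted lists. No
converse is needed: about arbitrary functions on finite sets, the lower bounds use only that there
are countably many. -/
theorem polyTime_codeFinset {F : Finset Str → Finset Str} {G : List Str → List Str} (hG : FP G)
    (h : ∀ Y : Finset Str, G (Y.sort (· ≤ ·)) = (F Y).sort (· ≤ ·)) :
    PolyTime codeFinset codeFinset F := by
  rw [polyTime_iff_comp]
  have h1 : FP fun z => GenSel.codeTuple (G (StackProg.decodeTuple z)) := by fun_prop
  obtain ⟨c, p, hc⟩ := comp_tcode_bits.comp (Comp.comp h1 comp_bits_tcode)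
  refine ⟨c, p, fun Y => (hc (codeFinset Y)).congr rfl ?_ le_rfl⟩
  simp only [codeFinset, decodeTuple_codeTuple, h]

/-- The binary representation of a number that is polynomial-time computable from the length of a
list. -/
theorem FP.encodeNat_length {k : ℕ → ℕ}
    (hk : PolyTime (fun n : ℕ => List.replicate n false) Computability.encodeNat k)
    {l : α → List β} (hl : FP l) : FP fun a => Computability.encodeNat (k (l a).length) := by
  have h1 : FP fun a => List.replicate (l a).length false :=
    (FP.map (f := fun _ _ => false) hl (by fun_prop)).congr fun a => by simp
  have h2 : Comp tcode (fun n : ℕ => bits (List.replicate n false)) fun a => (l a).length :=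
    h1.comp_bits
  exact comp_bits_tcode.comp ((polyTime_iff_comp.1 hk).comp h2 :)

end StackProg

/-! ### Selectors -/

namespace GenSel

open StackProg

/-- `f` is a selector for `A`. -/
def IsSelector (f : Str × Str → Str) (A : Lang) : Prop :=
  ∀ x y : Str, (f (x, y) = x ∨ f (x, y) = y) ∧ (x ∈ A ∨ y ∈ A → f (x, y) ∈ A)

theorem mem_PSel_iff {A : Lang} : A ∈ PSel ↔ ∃ f, FP f ∧ IsSelector f A := by
  unfold PSel IsSelector
  simp only [polyTime_codePair_iff, Set.mem_ofPred_eq]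

theorem IsSelector.size_le {f : Str × Str → Str} {A : Lang} (h : IsSelector f A) (x y : Str) :
    size (f (x, y)) ≤ size x + size y := by
  rcases (h x y).1 with h | h <;> rw [h] <;> omega

theorem sort_filter (Y : Finset Str) (p : Str → Bool) :
    (Y.filter fun y => p y = true).sort (· ≤ ·) = (Y.sort (· ≤ ·)).filter p := by
  have h1 : ((Y.sort (· ≤ ·)).filter p).toFinset = Y.filter fun y => p y = true := by
    ext y
    simp
  rw [← h1]
  exact (List.toFinset_sort (· ≤ ·) ((Finset.sort_nodup Y (· ≤ ·)).filter p)).2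
    ((Finset.pairwise_sort Y (· ≤ ·)).filter p)

/-- A polynomial-time list of candidates that is short enough and contains an element of the
language whenever necessary gives membership in `GC(g₁, g₂, 1)`. -/
theorem mem_GC_of_candidates {g₁ g₂ : ℕ → ℕ} {L : Lang} {C : List Str → List Str} (hC : FP C)
    (hlen : ∀ Y : Finset Str, Y.Nonempty → (C (Y.sort (· ≤ ·))).length ≤ g₂ Y.card)
    (hL : ∀ Y : Finset Str, Y.Nonempty → g₁ Y.card ≤ (L ∩ (Y : Set Str)).ncard →
      ∃ y ∈ C (Y.sort (· ≤ ·)), y ∈ Y ∧ y ∈ L) :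
    L ∈ GC g₁ g₂ fun _ => 1 := by
  -- Candidates may be repeated or lie outside `Y`; keeping those elements of `Y` that are
  -- candidates repairs both.
  refine ⟨fun Y => Y.filter fun y => (C (Y.sort (· ≤ ·))).contains y = true, ?_, fun Y hY => ?_⟩
  · refine polyTime_codeFinset (G := fun l => l.filter fun y => (C l).contains y)
      (FP.filter (f := fun l y => (C l).contains y) FP.id (by fun_prop)) fun Y => ?_
    rw [sort_filter]
  · refine ⟨Finset.filter_subset _ _, ?_, fun h => ?_⟩
    · refine le_trans (Finset.card_le_card (t := (C (Y.sort (· ≤ ·))).toFinset) fun y hy => ?_)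
        ((List.toFinset_card_le _).trans (hlen Y hY))
      simpa using (Finset.mem_filter.1 hy).2
    · obtain ⟨y, hy, hyY, hyL⟩ := hL Y hY h
      rw [Nat.one_le_iff_ne_zero, ← Nat.pos_iff_ne_zero, Set.ncard_pos
        (Set.Finite.inter_of_right (Finset.finite_toSet _) _)]
      exact ⟨y, hyL, by simp [hyY, hy]⟩

/-! ### Champions -/

/-- The result of a knock-out tournament. -/
def champ (f : Str × Str → Str) (l : List Str) : Str := l.tail.foldl (fun s y => f (s, y)) (l.headD [])

theorem FP.champ {f : Str × Str → Str} {A : Lang} (hf : FP f) (hA : IsSelector f A) :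
    FP (champ f) := by
  refine FP.foldl_add (l := fun l : List Str => l.tail) (g := fun _ s y => f (s, y))
    (i := fun l => l.headD []) (by fun_prop) (FP.headD FP.id []) (by fun_prop) .X
    fun l s y hy => ?_
  have h1 := hA.size_le s y
  have h2 := size_le_of_mem (List.mem_of_mem_tail hy)
  simp only [Polynomial.eval_X]
  omega

/-- After the match of an element of `A` the winner belongs to `A`, and this survives every later
match. -/
theorem IsSelector.champ {f : Str × Str → Str} {A : Lang} (hA : IsSelector f A) {l : List Str}
    (h : ∃ y ∈ l, y ∈ A) : champ f l ∈ l ∧ champ f l ∈ A := by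
  have key : ∀ (t : List Str) (x : Str), (∃ y ∈ x :: t, y ∈ A) →
      t.foldl (fun s y => f (s, y)) x ∈ x :: t ∧ t.foldl (fun s y => f (s, y)) x ∈ A := by
    intro t
    induction t with
    | nil => intro x h; simpa using h
    | cons y t ih =>
      rintro x ⟨z, hz, hzA⟩
      have h1 : ∃ z ∈ f (x, y) :: t, z ∈ A := by
        simp only [List.mem_cons] at hz
        rcases hz with rfl | rfl | hz
        · exact ⟨f (z, y), by simp, (hA _ _).2 (.inl hzA)⟩
        · exact ⟨f (x, z), by simp, (hA _ _).2 (.inr hzA)⟩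
        · exact ⟨z, by simp [hz], hzA⟩
      obtain ⟨h2, h3⟩ := ih _ h1
      refine ⟨?_, h3⟩
      rw [List.foldl_cons]
      rw [List.mem_cons] at h2
      rcases h2 with h2 | h2
      · rw [h2]
        rcases (hA x y).1 with h | h <;> rw [h] <;> simp
      · simp [h2]
  cases l with
  | nil => simp at h
  | cons x t => exact key t x h

/-! ### Upper bounds for unions and joins -/

/-- If `Y` meets the union, it meets some `A i`, and then the champion of `Y` for `A i` lies in `A
i`. The candidates are the `k` champions. -/
theorem unionClass_subset_GC (k : ℕ) :
    unionClass k PSel ⊆ GC (fun _ => 1) (fun _ => k) (fun _ => 1) := by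
  rintro L ⟨A, hA, rfl⟩
  choose f hf hs using fun i => mem_PSel_iff.1 (hA i)
  refine mem_GC_of_candidates (C := fun l => (List.finRange k).map fun i => champ (f i) l) ?_ ?_ ?_
  · induction List.finRange k with
    | nil => exact FP.const []
    | cons i t ih => exact (FP.champ (hf i) (hs i)).cons ih
  · intro Y _
    simp
  · intro Y _ h
    rw [Nat.one_le_iff_ne_zero, ← Nat.pos_iff_ne_zero, Set.ncard_pos
        (Set.Finite.inter_of_right (Finset.finite_toSet _) _)] at h
    obtain ⟨y, hyL, hyY⟩ := h
    obtain ⟨i, hi⟩ := Set.mem_iUnion.1 hyL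
    obtain ⟨h1, h2⟩ := (hs i).champ (l := Y.sort (· ≤ ·)) ⟨y, by simpa using hyY, hi⟩
    exact ⟨champ (f i) (Y.sort (· ≤ ·)), List.mem_map.2 ⟨i, List.mem_finRange i, rfl⟩,
      by simpa using h1, Set.mem_iUnion.2 ⟨i, h2⟩⟩

/-- Two strings beginning with `b` are compared through their tails; a string that does not begin
with `b` is outside the set, so the other one may be chosen. -/
theorem cons_image_mem_PSel {A : Lang} (hA : A ∈ PSel) (b : Bool) :
    {z | ∃ x ∈ A, z = b :: x} ∈ PSel := by
  obtain ⟨f, hf, hs⟩ := mem_PSel_iff.1 hA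
  -- The default `!b` makes the empty string count as not beginning with `b`.
  let g : Str × Str → Str := fun p =>
    if p.1.headD (!b) == b then
      (if p.2.headD (!b) == b then b :: f (p.1.tail, p.2.tail) else p.1)
    else p.2
  have h1 : FP fun p : Str × Str => p.1.headD (!b) := FP.headD (by fun_prop) _
  have h2 : FP fun p : Str × Str => p.2.headD (!b) := FP.headD (by fun_prop) _
  refine mem_PSel_iff.2 ⟨g, by fun_prop, fun x y => ?_⟩
  have key : ∀ z : Str, (z.headD (!b) == b) = true → z = b :: z.tail := by
    rintro (_ | ⟨c, z⟩) h
    · simp at h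
    · simp at h
      simp [h]
  have key' : ∀ z : Str, ¬ (z.headD (!b) == b) = true → ¬ ∃ x ∈ A, z = b :: x := by
    rintro z h ⟨x, -, rfl⟩
    simp at h
  simp only [Set.mem_ofPred_eq, g]
  by_cases hx : (x.headD (!b) == b) = true
  · by_cases hy : (y.headD (!b) == b) = true
    · rw [if_pos hx, if_pos hy]
      have ex := key x hx
      have ey := key y hy
      obtain ⟨h3, h4⟩ := hs x.tail y.tail
      refine ⟨?_, fun h => ⟨_, h4 ?_, rfl⟩⟩
      · rcases h3 with h3 | h3
        · exact .inl (by rw [h3, ← ex])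
        · exact .inr (by rw [h3, ← ey])
      · rcases h with ⟨z, hz, rfl⟩ | ⟨z, hz, rfl⟩
        · exact .inl hz
        · exact .inr hz
    · rw [if_pos hx, if_neg hy]
      exact ⟨.inl rfl, fun h => h.resolve_right (key' y hy)⟩
  · rw [if_neg hx]
    exact ⟨.inr rfl, fun h => h.resolve_left (key' x hx)⟩

theorem append_image_mem_PSel {A : Lang} (hA : A ∈ PSel) (w : Str) :
    {z | ∃ x ∈ A, z = w ++ x} ∈ PSel := by
  induction w with
  | nil => simpa using hA
  | cons b w ih =>
    convert cons_image_mem_PSel ih b using 1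
    ext z
    simp only [Set.mem_ofPred_eq, List.cons_append]
    constructor
    · rintro ⟨x, hx, rfl⟩
      exact ⟨_, ⟨x, hx, rfl⟩, rfl⟩
    · rintro ⟨_, ⟨x, hx, rfl⟩, rfl⟩
      exact ⟨x, hx, rfl⟩

/-- A join is the union of its marked components. Hence the upper bound for unions covers joins, and
the lower bound for joins covers unions. -/
theorem joinClass_subset_unionClass (k : ℕ) : joinClass k PSel ⊆ unionClass k PSel := by
  rintro L ⟨A, hA, rfl⟩
  refine ⟨fun i => {z | ∃ x ∈ A i, z = indexBits (Nat.clog 2 k) i ++ x},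
    fun i => append_image_mem_PSel (hA i) _, ?_⟩
  ext z
  simp [join]

/-! ### Sorting by a selector -/

/-- Insertion into a list ordered by a selector. -/
def insertBy (f : Str × Str → Str) (y : Str) : List Str → List Str
  | [] => [y]
  | z :: t => if f (y, z) == y then y :: z :: t else z :: insertBy f y t

/-- One step of the insertion of `y`: the state tells whether `y` has already been inserted and
contains the reversed initial segment of the result. -/
def insertStep (f : Str × Str → Str) (y : Str) (s : Bool × List Str) (z : Str) :
    Bool × List Str :=
  if s.1 then (true, z :: s.2)
  else if f (y, z) == y then (true, z :: y :: s.2) else (false, z :: s.2)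

theorem insertBy_eq_foldl (f : Str × Str → Str) (y : Str) (l out : List Str) :
    let s := l.foldl (insertStep f y) (false, out)
    (if s.1 then s.2 else y :: s.2).reverse = out.reverse ++ insertBy f y l := by
  have stay : ∀ (l out : List Str),
      l.foldl (insertStep f y) (true, out) = (true, l.reverse ++ out) := by
    intro l
    induction l with
    | nil => intro out; rfl
    | cons z l ih => intro out; simp [insertStep, ih]
  induction l generalizing out with
  | nil => simp [insertBy]
  | cons z l ih =>
    by_cases h : (f (y, z) == y) = true
    · simp only [List.foldl_cons, insertStep, insertBy, if_pos h]
      simp [stay]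
    · simp only [List.foldl_cons, insertStep, insertBy, if_neg h, Bool.false_eq_true, if_false]
      rw [ih (z :: out)]
      simp

theorem insertBy_perm (f : Str × Str → Str) (y : Str) (l : List Str) :
    (insertBy f y l).Perm (y :: l) := by
  induction l with
  | nil => rfl
  | cons z t ih =>
    rw [insertBy]
    split
    · rfl
    · exact (ih.cons z).trans (List.Perm.swap y z t)

theorem FP.insertBy {f : Str × Str → Str} (hf : FP f) :
    FP fun p : Str × List Str => insertBy f p.1 p.2 := by
  have h : FP fun p : Str × List Str => p.2.foldl (insertStep f p.1) (false, []) := by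
    refine FP.foldl_add (l := fun p : Str × List Str => p.2) (g := fun p => insertStep f p.1)
      (by fun_prop) (by fun_prop) ?_ (.X + 10) ?_
    · unfold insertStep
      fun_prop
    · rintro ⟨y, l⟩ ⟨b, s⟩ z hz
      have := size_le_of_mem (show z ∈ l from hz)
      cases b with
      | true => simp [insertStep]; omega
      | false =>
        by_cases h : (f (y, z) == y) = true
        · simp only [insertStep, if_pos h]
          simp; omega
        · simp only [insertStep, if_neg h]
          simp; omega
  refine (FP.reverse (FP.cond h.fst_comp h.snd_comp
    (FP.cons FP.fst h.snd_comp))).congr fun p => ?_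
  exact (insertBy_eq_foldl f p.1 p.2 []).trans (by simp)

/-- Insertion sort. -/
def sortBy (f : Str × Str → Str) (l : List Str) : List Str := l.foldl (fun s y => insertBy f y s) []

theorem size_perm {α : Type} [TreeEnc α] {l l' : List α} (h : l.Perm l') : size l = size l' := by
  induction h with
  | nil => rfl
  | cons a _ ih => simp [ih]
  | swap a b l => simp; omega
  | trans _ _ ih ih' => exact ih.trans ih'

theorem FP.sortBy {f : Str × Str → Str} (hf : FP f) : FP (sortBy f) := by
  have hi := FP.insertBy hf
  refine FP.foldl_add (l := fun l : List Str => l) (i := fun _ => [])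
    (g := fun _ s y => GenSel.insertBy f y s) FP.id (FP.const _) ?_ (.X + 1)
    fun l s y hy => ?_
  · exact hi.comp (f := fun x : List Str × List Str × Str => (x.2.2, x.2.1)) (by fun_prop)
  · have h1 := size_perm (insertBy_perm f y s)
    have h2 := size_le_of_mem hy
    simp at h1 ⊢
    omega

theorem sortBy_perm (f : Str × Str → Str) (l : List Str) : (sortBy f l).Perm l := by
  have : ∀ l s : List Str, (l.foldl (fun s y => insertBy f y s) s).Perm (l ++ s) := by
    intro l
    induction l with
    | nil => intro s; rfl
    | cons y l ih =>
      intro s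
      exact (ih _).trans (((insertBy_perm f y s).append_left l).trans List.perm_middle)
  simpa [sortBy] using this l []

/-- A selector need be neither symmetric nor transitive, but order matters only relative to `A`. The
string `y` is put before the first `z` with `f (y, z) = y`, so `y` is in `A` if `z` or anything
after it is; every `z` passed over was preferred to `y`, so it is in `A` if `y` is. -/
theorem IsSelector.pairwise_insertBy {f : Str × Str → Str} {A : Lang} (hA : IsSelector f A)
    (y : Str) {l : List Str} (hl : l.Pairwise fun a b => b ∈ A → a ∈ A) :
    (insertBy f y l).Pairwise fun a b => b ∈ A → a ∈ A := by
  induction l with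
  | nil => simp [insertBy]
  | cons z t ih =>
    rw [List.pairwise_cons] at hl
    rw [insertBy]
    have h := (hA y z).2
    split
    · rename_i hf
      rw [beq_iff_eq] at hf
      rw [hf] at h
      refine List.pairwise_cons.2 ⟨fun b hb hbA => h ?_, List.pairwise_cons.2 hl⟩
      rw [List.mem_cons] at hb
      rcases hb with rfl | hb
      · exact .inr hbA
      · exact .inr (hl.1 b hb hbA)
    · rename_i hf
      have hf' : f (y, z) = z := (hA y z).1.resolve_left (by simpa using hf)
      rw [hf'] at h
      refine List.pairwise_cons.2 ⟨fun b hb hbA => ?_, ih hl.2⟩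
      rw [(insertBy_perm f y t).mem_iff, List.mem_cons] at hb
      rcases hb with rfl | hb
      · exact h (.inl hbA)
      · exact hl.1 b hb hbA

theorem IsSelector.pairwise_sortBy {f : Str × Str → Str} {A : Lang} (hA : IsSelector f A)
    (l : List Str) : (sortBy f l).Pairwise fun a b => b ∈ A → a ∈ A := by
  have : ∀ l s : List Str, s.Pairwise (fun a b => b ∈ A → a ∈ A) →
      (l.foldl (fun s y => insertBy f y s) s).Pairwise fun a b => b ∈ A → a ∈ A := by
    intro l
    induction l with
    | nil => intro s hs; exact hs
    | cons y l ih => intro s hs; exact ih _ (hA.pairwise_insertBy y hs)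
  exact this l [] List.Pairwise.nil

/-! ### Arithmetic on unary numbers -/

/-- The number with a given binary representation, least significant bit first. -/
def binVal (z : Str) : ℕ := z.foldr (fun b n => 2 * n + b.toNat) 0

theorem binVal_encodeNat (n : ℕ) : binVal (Computability.encodeNat n) = n := by
  have key : ∀ p : PosNum, binVal (Computability.encodePosNum p) = (p : ℕ) := by
    intro p
    induction p with
    | one => rfl
    | bit0 p ih =>
      simp only [Computability.encodePosNum, binVal, List.foldr_cons, PosNum.cast_bit0] at ih ⊢
      rw [ih]
      simp [two_mul]
    | bit1 p ih =>
      simp only [Computability.encodePosNum, binVal, List.foldr_cons, PosNum.cast_bit1] at ih ⊢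
      rw [ih]
      simp [two_mul]
  have h2 : ∀ m : Num, binVal (Computability.encodeNum m) = (m : ℕ) := by
    rintro (_ | p)
    · rfl
    · exact key p
  rw [Computability.encodeNat, h2, Num.to_of_nat]

/-- Horner's scheme in unary notation, from the most significant bit on. -/
theorem foldl_double (z : Str) :
    z.reverse.foldl (fun (s : Str) b => if b then false :: (s ++ s) else s ++ s) []
      = List.replicate (binVal z) false := by
  rw [List.foldl_reverse]
  induction z with
  | nil => rfl
  | cons b z ih =>
    have : binVal (b :: z) = 2 * binVal z + b.toNat := rfl
    rw [List.foldr_cons, ih, this]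
    cases b <;> simp [two_mul, List.replicate_succ]

/-- The leading bits represent a number no larger than the whole; this bounds the intermediate
results of Horner's scheme. -/
theorem binVal_drop_le (z₁ z₂ : Str) : binVal z₂ ≤ binVal (z₁ ++ z₂) := by
  induction z₁ with
  | nil => rfl
  | cons b z ih =>
    have : binVal (b :: (z ++ z₂)) = 2 * binVal (z ++ z₂) + b.toNat := rfl
    rw [List.cons_append, this]
    omega

theorem size_replicate_false (n : ℕ) : size (List.replicate n false) = 2 * n + 1 := by
  induction n with
  | zero => rfl
  | succ n ih => rw [List.replicate_succ, size_cons, ih, size_false]; ring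

/-- Conversion from binary to unary is polynomial here because `k n ≤ n`. Nothing is assumed about
`k 0`, so it enters the bound as a constant for the empty list. -/
theorem FP.replicate_length {α β : Type} [TreeEnc α] [TreeEnc β] {k : ℕ → ℕ}
    (hk : PolyTime (fun n : ℕ => List.replicate n false) Computability.encodeNat k)
    (hkn : ∀ n, 1 ≤ n → k n ≤ n) {l : α → List β} (hl : FP l) :
    FP fun a => List.replicate (k (l a).length) false := by
  have h1 := FP.encodeNat_length hk hl
  obtain ⟨q, hq⟩ := hl.size_le
  refine (FP.foldl (i := fun _ => ([] : Str)) (g := fun _ s b => if b then false :: (s ++ s)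
    else s ++ s) (FP.reverse h1) (FP.const _) (by fun_prop) (2 * (q + .C (k 0)) + 1)
    fun a l₁ l₂ h => ?_).congr fun a => ?_
  · have h2 : Computability.encodeNat (k (l a).length) = l₂.reverse ++ l₁.reverse := by
      rw [← List.reverse_append, ← h, List.reverse_reverse]
    have h3 := binVal_drop_le l₂.reverse l₁.reverse
    rw [← h2, binVal_encodeNat] at h3
    have h4 := foldl_double l₁.reverse
    rw [List.reverse_reverse] at h4
    rw [h4, size_replicate_false]
    have h5 := (length_le_size (l a)).trans (hq a)
    have h6 : k (l a).length ≤ (l a).length + k 0 := by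
      rcases Nat.eq_zero_or_pos (l a).length with h | h
      · rw [h]; omega
      · have := hkn _ h; omega
    simp
    omega
  · rw [foldl_double, binVal_encodeNat]

/-- One step of the division (rounding up) of the length of a list by the length of `k`: the state
consists of the number of elements still to be skipped and of the quotient so far. -/
def divStep {β : Type} (k : Str) (s : Str × Str) (_ : β) : Str × Str :=
  match s.1 with
  | [] => (k.tail, false :: s.2)
  | _ :: r => (r, s.2)

/-- Divisor times quotient is the number of elements read plus the number still to be skipped, which
is less than the divisor: the quotient is rounded up. -/
theorem divStep_spec {β : Type} {k : Str} (hk : 1 ≤ k.length) (l : List β) :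
    k.length * (l.foldl (divStep k) ([], [])).2.length
        = l.length + (l.foldl (divStep k) ([], [])).1.length ∧
      (l.foldl (divStep k) ([], [])).1.length < k.length := by
  induction l using List.reverseRecOn with
  | nil => exact ⟨rfl, hk⟩
  | append_singleton l b ih =>
    rw [List.foldl_append]
    simp only [List.foldl_cons, List.foldl_nil]
    generalize l.foldl (divStep k) ([], []) = s at ih
    obtain ⟨_ | ⟨c, r⟩, q⟩ := s
    · simp only [divStep, List.length_cons, List.length_tail, List.length_append,
        List.length_nil] at ih ⊢
      rw [Nat.mul_succ]
      omega
    · simp only [divStep, List.length_cons, List.length_append, List.length_nil] at ih ⊢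
      omega

theorem FP.div {α β : Type} [TreeEnc α] [TreeEnc β] {k : α → Str} {l : α → List β} (hk : FP k)
    (hl : FP l) : FP fun a => ((l a).foldl (divStep (k a)) ([], [])).2 := by
  obtain ⟨q, hq⟩ := hk.size_le
  have : FP fun a => (l a).foldl (divStep (k a)) ([], []) := by
    refine FP.foldl_add (g := fun a => divStep (k a)) hl (FP.const _) ?_ (q + 2) ?_
    · refine FP.caseList (l := fun x : α × (Str × Str) × β => x.2.1.1)
        (f := fun x => ((k x.1).tail, false :: x.2.1.2)) (g := fun y => (y.1.2, y.2.2.1.2))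
        (by fun_prop) (by fun_prop) (by fun_prop) ?_ ?_
      · intro a h; simp [divStep, h]
      · intro a b t h; simp [divStep, h]
    · rintro a ⟨_ | ⟨c, r⟩, s⟩ b -
      · have h1 : size (k a).tail ≤ size (k a) := by
          cases k a with
          | nil => simp
          | cons c t => simp; omega
        have h2 := hq a
        simp [divStep]
        omega
      · simp [divStep]
        omega
  exact this.snd_comp

/-! ### Champions of blocks -/

/-- One step of the computation of the champions of the blocks of `m.length + 1` consecutive
elements: the state consists of the number of elements that the current block still lacks and of the
champions so far, the one of the current block being the first. -/
def blockStep (g : Str × Str → Str) (m : Str) (s : Str × List Str) (y : Str) : Str × List Str :=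
  match s.1 with
  | [] => (m, y :: s.2)
  | _ :: c => match s.2 with
    | [] => (c, [y])
    | o :: os => (c, g (o, y) :: os)

theorem FP.block {α : Type} [TreeEnc α] {g : Str × Str → Str} {B : Lang} (hg : FP g)
    (hB : IsSelector g B) {m : α → Str} {l : α → List Str} (hm : FP m) (hl : FP l) :
    FP fun a => ((l a).foldl (blockStep g (m a)) ([], [])).2 := by
  obtain ⟨q, hq⟩ := hm.size_le
  obtain ⟨r, hr⟩ := hl.size_le
  have : FP fun a => (l a).foldl (blockStep g (m a)) ([], []) := by
    refine FP.foldl_add (g := fun a => blockStep g (m a)) hl (FP.const _) ?_ (q + r + 2) ?_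
    · have h2 : FP fun z : (Bool × List Bool) × α × (Str × List Str) × Str =>
          blockStep g (m z.2.1) (z.1.1 :: z.1.2, z.2.2.1.2) z.2.2.2 := by
        refine FP.caseList
          (l := fun z : (Bool × List Bool) × α × (Str × List Str) × Str => z.2.2.1.2)
          (f := fun z => (z.1.2, [z.2.2.2]))
          (g := fun y => (y.2.1.2, g (y.1.1, y.2.2.2.2) :: y.1.2))
          (by fun_prop) (by fun_prop) (by fun_prop) ?_ ?_
        · intro a h; simp [blockStep, h]
        · intro a b t h; simp [blockStep, h]
      refine FP.caseList (l := fun x : α × (Str × List Str) × Str => x.2.1.1)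
        (f := fun x => (m x.1, x.2.2 :: x.2.1.2)) (by fun_prop) (by fun_prop) h2 ?_ ?_
      · intro a h; simp [blockStep, h]
      · rintro ⟨a, ⟨_, s⟩, y⟩ b t h
        simp at h
        subst h
        rfl
    · rintro a ⟨_ | ⟨c, t⟩, _ | ⟨o, os⟩⟩ y hy
      all_goals
        have h1 := hq a
        have h2 := (size_le_of_mem hy).trans (hr a)
        simp [blockStep]
      · omega
      · omega
      · omega
      · have := hB.size_le o y
        omega
  exact this.snd_comp

/-- Each block is counted with its full size, so what the current block still lacks appears on the
right. -/
theorem blockStep_length (g : Str × Str → Str) (m : Str) (l : List Str) :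
    (l.foldl (blockStep g m) ([], [])).2.length * (m.length + 1)
        = l.length + (l.foldl (blockStep g m) ([], [])).1.length ∧
      (l.foldl (blockStep g m) ([], [])).1.length ≤ m.length := by
  induction l using List.reverseRecOn with
  | nil => simp
  | append_singleton l b ih =>
    rw [List.foldl_append]
    simp only [List.foldl_cons, List.foldl_nil]
    generalize l.foldl (blockStep g m) ([], []) = s at ih
    obtain ⟨_ | ⟨c, t⟩, _ | ⟨o, os⟩⟩ := s <;>
      simp only [blockStep, List.length_cons, List.length_append, List.length_nil,
        Nat.add_mul] at ih ⊢ <;> omega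

theorem blockStep_subset {g : Str × Str → Str} {B : Lang} (hB : IsSelector g B) (m : Str)
    (l : List Str) : ∀ o ∈ (l.foldl (blockStep g m) ([], [])).2, o ∈ l := by
  induction l using List.reverseRecOn with
  | nil => simp
  | append_singleton l b ih =>
    rw [List.foldl_append]
    simp only [List.foldl_cons, List.foldl_nil]
    generalize l.foldl (blockStep g m) ([], []) = s at ih
    obtain ⟨_ | ⟨c, t⟩, _ | ⟨o, os⟩⟩ := s
    · simp [blockStep]
    · simp only [blockStep, List.mem_cons, List.mem_append] at ih ⊢
      rintro x (rfl | h)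
      · simp
      · exact .inl (ih x h)
    · simp [blockStep]
    · simp only [blockStep, List.mem_cons, List.mem_append] at ih ⊢
      rintro x (rfl | h)
      · rcases (hB o b).1 with h | h <;> rw [h]
        · exact .inl (ih o (.inl rfl))
        · simp
      · exact .inl (ih x (.inr h))

open Classical in
/-- Either the champion of a completed block belongs to `B`, or all elements of `B` are in the
current block. -/
theorem blockStep_invariant {g : Str × Str → Str} {B : Lang} (hB : IsSelector g B) (m : Str)
    (l : List Str) (s : Str × List Str) (hs : l.foldl (blockStep g m) ([], []) = s) :
    (∃ o ∈ s.2.tail, o ∈ B) ∨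
      ((l.filter (· ∈ B)).length + s.1.length ≤ m.length + 1 ∧
        (0 < (l.filter (· ∈ B)).length → ∃ o os, s.2 = o :: os ∧ o ∈ B)) := by
  induction l using List.reverseRecOn generalizing s with
  | nil => subst hs; simp
  | append_singleton l b ih =>
    have hlen := blockStep_length g m l
    rw [List.foldl_append] at hs
    simp only [List.foldl_cons, List.foldl_nil] at hs
    specialize ih _ rfl
    subst hs
    have hf : ((l ++ [b]).filter (· ∈ B)).length
        = (l.filter (· ∈ B)).length + if b ∈ B then 1 else 0 := by
      by_cases hb : b ∈ B <;> simp [List.filter_append, hb]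
    rw [hf]
    generalize l.foldl (blockStep g m) ([], []) = s at ih hlen
    generalize (l.filter (· ∈ B)).length = n at ih
    obtain ⟨_ | ⟨c, t⟩, _ | ⟨o, os⟩⟩ := s
    · simp only [blockStep]
      rcases ih with ⟨o, ho, -⟩ | ⟨h1, h2⟩
      · cases ho
      · have hn : n = 0 := by
          by_contra hn
          obtain ⟨o, os, h, -⟩ := h2 (by omega)
          cases h
        refine .inr ⟨by split <;> simp_all <;> omega, fun h => ⟨b, [], rfl, ?_⟩⟩
        by_contra hb
        simp [hn, hb] at h
    · simp only [blockStep]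
      rcases ih with ⟨o', ho, hoB⟩ | ⟨h1, h2⟩
      · exact .inl ⟨o', List.mem_of_mem_tail (by simpa using ho), hoB⟩
      -- The current block is complete and `b` opens a new one. If elements of `B` have been read,
      -- the champion `o` is in `B` and now belongs to a completed block.
      · by_cases hn : 0 < n
        · obtain ⟨o', os', h, hoB⟩ := h2 hn
          cases h
          exact .inl ⟨o, by simp, hoB⟩
        · refine .inr ⟨by split <;> omega, fun h => ⟨b, o :: os, rfl, ?_⟩⟩
          by_contra hb
          simp [hb] at h
          omega
    · simp at hlen
    · simp only [blockStep]
      rcases ih with ⟨o', ho, hoB⟩ | ⟨h1, h2⟩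
      · exact .inl ⟨o', ho, hoB⟩
      · simp only [List.length_cons] at h1
        refine .inr ⟨by split <;> omega, fun h => ⟨_, os, rfl, (hB o b).2 ?_⟩⟩
        by_cases hb : b ∈ B
        · exact .inr hb
        · rw [if_neg hb] at h
          obtain ⟨o', os', h', hoB⟩ := h2 (by omega)
          cases h'
          exact .inl hoB

/-- The champion of a completed block is never replaced, whereas that of an incomplete block may
still lose to a string outside `L`. This is needed when the elements of `A` are followed by strings
outside `A`. -/
theorem blockStep_persist (g : Str × Str → Str) (m : Str) (L : Lang) (l : List Str)
    (s : Str × List Str) (h : ∃ o ∈ s.2, o ∈ L ∧ (o ∈ s.2.tail ∨ s.1 = [])) :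
    ∃ o ∈ (l.foldl (blockStep g m) s).2, o ∈ L := by
  induction l generalizing s with
  | nil =>
    obtain ⟨o, ho, hoL, -⟩ := h
    exact ⟨o, ho, hoL⟩
  | cons y l ih =>
    refine ih _ ?_
    obtain ⟨o, ho, hoL, h⟩ := h
    obtain ⟨_ | ⟨c, t⟩, _ | ⟨o', os⟩⟩ := s
    · cases ho
    · exact ⟨o, by simp [blockStep, ho], hoL, .inl ho⟩
    · cases ho
    · have ho' : o ∈ os := by simpa using h
      exact ⟨o, by simp [blockStep, ho'], hoL, .inl ho'⟩

open Classical in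
/-- If a list is ordered by a selector for `A` and contains sufficiently many elements of `A ∩ B`,
then some block has a champion in `A ∩ B`. -/
theorem exists_mem_block {g : Str × Str → Str} {A B : Lang} (hB : IsSelector g B) (m : Str)
    {l : List Str} (hl : l.Pairwise fun a b => b ∈ A → a ∈ A)
    (hc : m.length + 1 ≤ (l.filter (· ∈ A ∩ B)).length) :
    ∃ o ∈ (l.foldl (blockStep g m) ([], [])).2, o ∈ A ∩ B := by
  -- The elements of `A` form an initial segment `u`, so the elements of `A ∩ B` are those of `B` in
  -- `u`. If no earlier block of `u` has a champion in `B`, then all of them, at least a block's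
  -- worth, are in the current block, which is therefore complete at the end of `u`.
  obtain ⟨u, v, rfl, hu, hv⟩ : ∃ u v, l = u ++ v ∧ (∀ a ∈ u, a ∈ A) ∧ ∀ a ∈ v, a ∉ A := by
    clear hc
    induction l with
    | nil => exact ⟨[], [], rfl, by simp, by simp⟩
    | cons a l ih =>
      rw [List.pairwise_cons] at hl
      by_cases ha : a ∈ A
      · obtain ⟨u, v, rfl, hu, hv⟩ := ih hl.2
        exact ⟨a :: u, v, rfl, by simpa [ha] using hu, hv⟩
      · exact ⟨[], a :: l, rfl, by simp,
          by simpa [ha] using fun b hb hbA => ha (hl.1 b hb hbA)⟩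
  have h1 : (u ++ v).filter (· ∈ A ∩ B) = u.filter (· ∈ B) := by
    have hv' : v.filter (· ∈ A ∩ B) = [] := by
      rw [List.filter_eq_nil_iff]
      intro a ha
      simp [hv a ha]
    rw [List.filter_append, hv', List.append_nil]
    exact List.filter_congr fun a ha => by simp [hu a ha]
  rw [h1] at hc
  rw [List.foldl_append]
  refine blockStep_persist g m _ v _ ?_
  have hsub := blockStep_subset hB m u
  rcases blockStep_invariant hB m u _ rfl with ⟨o, ho, hoB⟩ | ⟨h2, h3⟩
  · have ho' := List.mem_of_mem_tail ho
    exact ⟨o, ho', ⟨hu o (hsub o ho'), hoB⟩, .inl ho⟩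
  · obtain ⟨o, os, h, hoB⟩ := h3 (by omega)
    have ho' : o ∈ (u.foldl (blockStep g m) ([], [])).2 := by simp [h]
    exact ⟨o, ho', ⟨hu o (hsub o ho'), hoB⟩, .inr (List.length_eq_zero_iff.1 (by omega))⟩

/-! ### Upper bound for intersections -/

/-- The blocks have `⌈n / k n⌉` elements, which is also the threshold, as `exists_mem_block`
requires. Since `m` is one shorter than a block, it is the tail of the unary quotient `q`. -/
theorem inter_subset_GC {k : ℕ → ℕ}
    (hk : PolyTime (fun n : ℕ => List.replicate n false) Computability.encodeNat k)
    (hkn : ∀ n : ℕ, 1 ≤ n → 1 ≤ k n ∧ k n ≤ n) :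
    opClass (· ∩ ·) PSel PSel ⊆ GC (fun n => ⌈(n : ℚ) / (k n : ℚ)⌉₊) k fun _ => 1 := by
  classical
  rintro L ⟨A, hA, B, hB, rfl⟩
  obtain ⟨f, hf, hfA⟩ := mem_PSel_iff.1 hA
  obtain ⟨g, hg, hgB⟩ := mem_PSel_iff.1 hB
  let q : List Str → Str := fun l =>
    (l.foldl (divStep (List.replicate (k l.length) false)) ([], [])).2
  have hq : FP q := FP.div (FP.replicate_length hk (fun n hn => (hkn n hn).2) FP.id) FP.id
  have key : ∀ Y : Finset Str, Y.Nonempty → ∃ r, k Y.card * (q (Y.sort (· ≤ ·))).length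
      = Y.card + r ∧ r < k Y.card ∧ (q (Y.sort (· ≤ ·))).tail.length + 1
        = (q (Y.sort (· ≤ ·))).length := by
    intro Y hY
    have h := divStep_spec (k := List.replicate (k (Y.sort (· ≤ ·)).length) false)
      (by simpa using (hkn _ hY.card_pos).1) (Y.sort (· ≤ ·))
    simp only [List.length_replicate, Finset.length_sort] at h
    have hq' : q (Y.sort (· ≤ ·)) = ((Y.sort (· ≤ ·)).foldl
        (divStep (List.replicate (k Y.card) false)) ([], [])).2 := by
      simp only [q, Finset.length_sort]
    rw [hq']
    refine ⟨_, h.1, h.2, ?_⟩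
    rw [List.length_tail]
    have := hY.card_pos
    rcases Nat.eq_zero_or_pos (((Y.sort (· ≤ ·)).foldl
        (divStep (List.replicate (k Y.card) false)) ([], [])).2).length with h0 | h0
    · rw [h0] at h
      omega
    · omega
  refine mem_GC_of_candidates
    (C := fun l => ((sortBy f l).foldl (blockStep g (q l).tail) ([], [])).2)
    (FP.block hg hgB (by fun_prop) (FP.sortBy hf)) (fun Y hY => ?_) fun Y hY hL => ?_
  · obtain ⟨r, h1, h2, h3⟩ := key Y hY
    obtain ⟨h4, h5⟩ := blockStep_length g (q (Y.sort (· ≤ ·))).tail (sortBy f (Y.sort (· ≤ ·)))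
    rw [h3, (sortBy_perm f _).length_eq, Finset.length_sort] at h4
    -- Otherwise `k Y.card` full blocks, which already exhaust the set, would be followed by a
    -- nonempty one.
    by_contra h6
    push Not at h6
    have h7 := Nat.mul_le_mul_right (q (Y.sort (· ≤ ·))).length (Nat.succ_le_of_lt h6)
    rw [h4, Nat.succ_mul, h1] at h7
    omega
  · obtain ⟨r, h1, h2, h3⟩ := key Y hY
    obtain ⟨o, ho, hoL⟩ := exists_mem_block (A := A) hgB (q (Y.sort (· ≤ ·))).tail
      (hfA.pairwise_sortBy (Y.sort (· ≤ ·))) (by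
        rw [h3, ((sortBy_perm f (Y.sort (· ≤ ·))).filter _).length_eq]
        have h4 : (A ∩ B ∩ (Y : Set Str)).ncard
            = ((Y.sort (· ≤ ·)).filter (· ∈ A ∩ B)).length := by
          rw [← List.toFinset_card_of_nodup ((Finset.sort_nodup Y (· ≤ ·)).filter _),
            ← Set.ncard_coe_finset]
          congr 1
          ext y
          simp [and_comm]
        rw [← h4]
        have h5 : (0 : ℚ) < k Y.card := by exact_mod_cast (hkn _ hY.card_pos).1
        rw [Nat.ceil_le, div_le_iff₀ h5] at hL
        have h6 : Y.card ≤ (A ∩ B ∩ (Y : Set Str)).ncard * k Y.card := by exact_mod_cast hL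
        by_contra h7
        push Not at h7
        have h8 := Nat.mul_le_mul_left (k Y.card) (Nat.succ_le_of_lt h7)
        rw [h1, Nat.mul_succ, Nat.mul_comm] at h8
        omega)
    refine ⟨o, ho, ?_, hoL⟩
    have := blockStep_subset hgB _ _ o ho
    rw [(sortBy_perm f _).mem_iff] at this
    simpa using this

end GenSel

/-! ### Cuts of the lexicographical order -/

namespace GenSel

open StackProg

/-- Sets that are closed downwards with respect to a polynomial-time comparison are P-selective. -/
theorem mem_PSel_of_compare {c : Str → Str → Bool} (hc : FP fun p : Str × Str => c p.1 p.2)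
    {A : Lang} (h : ∀ x y, c x y = true → y ∈ A → x ∈ A)
    (h' : ∀ x y, c x y = false → x ∈ A → y ∈ A) : A ∈ PSel := by
  refine mem_PSel_iff.2 ⟨fun p => if c p.1 p.2 then p.1 else p.2, by fun_prop, fun x y => ?_⟩
  cases hxy : c x y with
  | true => simpa [hxy] using fun hA : x ∈ A ∨ y ∈ A => hA.elim id (h x y hxy)
  | false => simpa [hxy] using fun hA : x ∈ A ∨ y ∈ A => hA.elim (h' x y hxy) id

/-- The set of all strings that are at most some element of a sequence of strings. -/
def cut (r : ℕ → Str) : Lang := {x | ∃ n, lexLe x (r n) = true}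

theorem mem_cut_of_lexLe {r : ℕ → Str} {x y : Str} (h : lexLe x y = true) (hy : y ∈ cut r) :
    x ∈ cut r := by
  obtain ⟨n, hn⟩ := hy
  exact ⟨n, lexLe_trans h hn⟩

theorem lexLe_of_not {x y : Str} (h : lexLe x y = false) : lexLe y x = true :=
  (lexLe_total x y).resolve_left (by simp [h])

theorem cut_mem_PSel (r : ℕ → Str) : cut r ∈ PSel :=
  mem_PSel_of_compare (c := lexLe) (by fun_prop) (fun _ _ h => mem_cut_of_lexLe h)
    fun _ _ h => mem_cut_of_lexLe (lexLe_of_not h)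

/-- Exchange of the two symbols. -/
def flip (x : Str) : Str := x.map not

theorem fp_flip {α : Type} [TreeEnc α] {f : α → Str} (hf : FP f) : FP fun a => flip (f a) :=
  FP.map (f := fun _ b => !b) hf (by fun_prop)

theorem flip_cut_mem_PSel (r : ℕ → Str) : {x | flip x ∈ cut r} ∈ PSel :=
  mem_PSel_of_compare (c := fun x y => lexLe (flip x) (flip y))
    (FP.lexLe (fp_flip FP.fst) (fp_flip FP.snd)) (fun _ _ h => mem_cut_of_lexLe h)
    fun _ _ h => mem_cut_of_lexLe (lexLe_of_not h)

theorem compl_flip_cut_mem_PSel (r : ℕ → Str) : {x | flip x ∈ cut r}ᶜ ∈ PSel :=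
  mem_PSel_of_compare (c := fun x y => lexLe (flip y) (flip x))
    (FP.lexLe (fp_flip FP.snd) (fp_flip FP.fst))
    (fun _ _ h hy hx => hy (mem_cut_of_lexLe h hx))
    fun _ _ h hx hy => hx (mem_cut_of_lexLe (lexLe_of_not h) hy)

theorem lexLe_append (p x y : Str) : lexLe (p ++ x) (p ++ y) = lexLe x y := by
  induction p with
  | nil => rfl
  | cons b p ih => simpa [lexLe] using ih

/-- If `x` does not extend `p`, its comparison with any extension of `p` is decided inside `p`. -/
theorem lexLe_of_prefix {p q x : Str} (hpq : p <+: q) (hx : lexLe x q = true) (hpx : ¬ p <+: x) :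
    lexLe x p = true := by
  induction p generalizing q x with
  | nil => exact absurd (List.nil_prefix) hpx
  | cons b p ih =>
    obtain ⟨t, rfl⟩ := hpq
    rcases x with _ | ⟨c, x⟩
    · rfl
    · rw [List.cons_append, lexLe] at hx
      rw [lexLe]
      by_cases hcb : (c == b) = true
      · rw [if_pos hcb] at hx ⊢
        refine ih (List.prefix_append p t) hx fun h => hpx ?_
        rw [beq_iff_eq] at hcb
        subst hcb
        exact List.cons_prefix_cons.2 ⟨rfl, h⟩
      · rw [if_neg hcb] at hx ⊢
        exact hx

theorem prefix_of_le {r : ℕ → Str} (hr : ∀ n, r n <+: r (n + 1)) {m n : ℕ} (h : m ≤ n) :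
    r m <+: r n := by
  induction h with
  | refl => exact List.prefix_rfl
  | step _ ih => exact ih.trans (hr _)

/-- For strings not extending `r n`, later elements of the sequence change nothing by
`lexLe_of_prefix`, and earlier ones are prefixes of `r n`, hence no larger. A decision taken at
stage `n` is final. -/
theorem mem_cut_iff {r : ℕ → Str} (hr : ∀ n, r n <+: r (n + 1)) {n : ℕ} {x : Str}
    (hx : ¬ r n <+: x) : x ∈ cut r ↔ lexLe x (r n) = true := by
  refine ⟨?_, fun h => ⟨n, h⟩⟩
  rintro ⟨m, hm⟩
  rcases le_total n m with h | h
  · exact lexLe_of_prefix (prefix_of_le hr h) hm hx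
  · obtain ⟨t, ht⟩ := prefix_of_le hr h
    have : lexLe (r m ++ []) (r m ++ t) = true := by rw [lexLe_append]; cases t <;> rfl
    rw [List.append_nil, ht] at this
    exact lexLe_trans hm this

/-- Distinct strings of equal length differ at some position, and exchanging the symbols reverses
the verdict there. Without equal lengths this fails for prefixes. -/
theorem lexLe_flip {x y : Str} (hl : x.length = y.length) (hne : x ≠ y) :
    lexLe (flip x) (flip y) = !(lexLe x y) := by
  induction x generalizing y with
  | nil =>
    cases y with
    | nil => exact absurd rfl hne
    | cons c y => cases hl
  | cons b x ih =>
    rcases y with _ | ⟨c, y⟩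
    · cases hl
    · have := @ih y (by simpa using hl)
      cases b <;> cases c <;> simp_all [flip, lexLe]

/-! ### Diagonalization against joins -/

/-- A test string in the `i`-th part of a join. -/
def testStr (k : ℕ) (P : Fin k → Str) (i : Fin k) (j : ℕ) : Str :=
  indexBits (Nat.clog 2 k) i ++ (P i ++ true :: List.replicate (j + 1) false)

/-- A set of test strings. -/
def testSet (k : ℕ) (P : Fin k → Str) (m : ℕ) : Finset Str :=
  (Finset.univ ×ˢ Finset.range m).image fun x : Fin k × ℕ => testStr k P x.1 x.2

theorem indexBits_injective {k : ℕ} {i j : Fin k}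
    (h : indexBits (Nat.clog 2 k) i = indexBits (Nat.clog 2 k) j) : i = j := by
  have h1 := List.ofFn_injective h
  have hk : k ≤ 2 ^ Nat.clog 2 k := Nat.le_pow_clog (by norm_num) k
  refine Fin.ext (Nat.eq_of_testBit_eq fun t => ?_)
  rcases lt_or_ge t (Nat.clog 2 k) with ht | ht
  · have := congrFun h1 ⟨Nat.clog 2 k - 1 - t, by omega⟩
    have e : Nat.clog 2 k - 1 - (Nat.clog 2 k - 1 - t) = t := by omega
    simpa [e] using this
  · have h2 : k ≤ 2 ^ t := hk.trans (Nat.pow_le_pow_right (by norm_num) ht)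
    rw [Nat.testBit_eq_false_of_lt (i.2.trans_le h2), Nat.testBit_eq_false_of_lt (j.2.trans_le h2)]

theorem append_indexBits_inj {k : ℕ} {i j : Fin k} {x y : Str}
    (h : indexBits (Nat.clog 2 k) i ++ x = indexBits (Nat.clog 2 k) j ++ y) : i = j ∧ x = y := by
  obtain ⟨h1, h2⟩ := List.append_inj h (by simp [indexBits])
  exact ⟨indexBits_injective h1, h2⟩

theorem mem_join_iff {k : ℕ} {A : Fin k → Lang} {i : Fin k} {x : Str} :
    indexBits (Nat.clog 2 k) i ++ x ∈ join k A ↔ x ∈ A i := by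
  constructor
  · rintro ⟨j, y, hy, h⟩
    obtain ⟨rfl, rfl⟩ := append_indexBits_inj h
    exact hy
  · intro h
    exact ⟨i, x, h, rfl⟩

theorem testStr_inj {k : ℕ} {P : Fin k → Str} {i i' : Fin k} {j j' : ℕ}
    (h : testStr k P i j = testStr k P i' j') : i = i' ∧ j = j' := by
  obtain ⟨rfl, h⟩ := append_indexBits_inj h
  simpa using h

/-- The `i`-th string that describes the memberships decided in the first `n` stages. -/
noncomputable def stages (k : ℕ) (H : ℕ → (Fin k → Str) → Fin k → Prop) : ℕ → Fin k → Str
  | 0 => fun _ => []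
  | n + 1 => fun i =>
    open Classical in
    stages k H n i ++ if H n (stages k H n) i then [true, true] else [false]

/-- The test strings of a stage continue `P i` by `10`. Extending the branch by `11` puts all of
them below it, extending it by `0` puts all of them above it. In neither case does a test string
extend the new prefix, so `mem_cut_iff` makes the choice permanent. The `k` branches are
independent. -/
theorem exists_join {k : ℕ} (H : ℕ → (Fin k → Str) → Fin k → Prop) :
    ∃ L ∈ joinClass k PSel, ∀ n, ∃ P : Fin k → Str, ∀ i j, testStr k P i j ∈ L ↔ H n P i := by
  have hpre : ∀ i n, stages k H n i <+: stages k H (n + 1) i := fun i n => List.prefix_append _ _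
  refine ⟨_, ⟨fun i => cut fun n => stages k H n i, fun i => cut_mem_PSel _, rfl⟩, fun n =>
    ⟨stages k H n, fun i j => ?_⟩⟩
  rw [testStr, mem_join_iff, mem_cut_iff (hpre i) (n := n + 1)]
  · simp only [stages, lexLe_append]
    by_cases h : H n (stages k H n) i
    · simp [h, lexLe, List.replicate_succ]
    · simp [h, lexLe]
  · simp only [stages, List.prefix_append_right_inj]
    by_cases h : H n (stages k H n) i <;> simp [h, List.replicate_succ, List.cons_prefix_cons]

theorem exists_join_forall {k : ℕ} {R : ℕ → Lang → Prop}
    (hR : ∀ n (P : Fin k → Str), ∃ h : Fin k → Prop, ∀ L : Lang,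
      (∀ i j, testStr k P i j ∈ L ↔ h i) → R n L) :
    ∃ L ∈ joinClass k PSel, ∀ n, R n L := by
  choose H hH using hR
  obtain ⟨L, hL, h⟩ := exists_join H
  refine ⟨L, hL, fun n => ?_⟩
  obtain ⟨P, hP⟩ := h n
  exact hH n P L hP

theorem mem_testSet {k : ℕ} {P : Fin k → Str} {m : ℕ} {y : Str} :
    y ∈ testSet k P m ↔ ∃ i, ∃ j < m, y = testStr k P i j := by
  simp only [testSet, Finset.mem_image, Finset.mem_product, Finset.mem_univ, true_and,
    Finset.mem_range, Prod.exists]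
  constructor
  · rintro ⟨i, j, hj, rfl⟩
    exact ⟨i, j, hj, rfl⟩
  · rintro ⟨i, j, hj, rfl⟩
    exact ⟨i, j, hj, rfl⟩

/-- One test string is taken from each part. If `f` drops one of them, only its part is put into the
language, and `f` misses the only member. If `f` keeps all, it selects at least `k` strings, more
than allowed. -/
theorem not_GCCondition_of_join {k : ℕ} (hk : 2 ≤ k) (f : Finset Str → Finset Str)
    (P : Fin k → Str) : ∃ h : Fin k → Prop, ∀ L : Lang, (∀ i j, testStr k P i j ∈ L ↔ h i) →
      ∃ Y : Finset Str, Y.Nonempty ∧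
        ¬ GCCondition (fun _ => 1) (fun _ => k - 1) (fun _ => 1) L f Y := by
  have h0 : (⟨0, by omega⟩ : Fin k) ∈ Finset.univ := Finset.mem_univ _
  have hne : (testSet k P 1).Nonempty := ⟨_, mem_testSet.2 ⟨⟨0, by omega⟩, 0, one_pos, rfl⟩⟩
  by_cases hf : ∃ i, testStr k P i 0 ∉ f (testSet k P 1)
  · obtain ⟨i, hi⟩ := hf
    refine ⟨fun i' => i' = i, fun L hL => ⟨testSet k P 1, hne, ?_⟩⟩
    rintro ⟨h1, -, h3⟩
    have h4 : L ∩ (f (testSet k P 1) : Set Str) = ∅ := by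
      ext y
      simp only [Set.mem_inter_iff, Finset.mem_coe, Set.mem_empty_iff_false, iff_false, not_and]
      intro hyL hy
      obtain ⟨i', j, hj, rfl⟩ := mem_testSet.1 (h1 hy)
      obtain rfl : j = 0 := by omega
      rw [hL] at hyL
      subst hyL
      exact hi hy
    rw [h4, Set.ncard_empty] at h3
    have h5 : 0 < (L ∩ (testSet k P 1 : Set Str)).ncard := by
      rw [Set.ncard_pos (Set.Finite.inter_of_right (Finset.finite_toSet _) _)]
      exact ⟨testStr k P i 0, (hL i 0).2 rfl,
        Finset.mem_coe.2 (mem_testSet.2 ⟨i, 0, one_pos, rfl⟩)⟩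
    exact absurd (h3 h5) (by simp)
  · push Not at hf
    refine ⟨fun _ => True, fun L _ => ⟨testSet k P 1, hne, ?_⟩⟩
    rintro ⟨-, h2, -⟩
    have h3 : (Finset.univ.image fun i => testStr k P i 0) ⊆ f (testSet k P 1) := by
      intro y hy
      obtain ⟨i, -, rfl⟩ := Finset.mem_image.1 hy
      exact hf i
    have h4 := Finset.card_le_card h3
    rw [Finset.card_image_of_injective _ fun i i' h => (testStr_inj h).1, Finset.card_univ,
      Fintype.card_fin] at h4
    have h5 : (f (testSet k P 1)).card ≤ k - 1 := h2
    omega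

theorem le_ncard_testSet {k : ℕ} {P : Fin k → Str} {m : ℕ} {L : Lang} {i : Fin k}
    (h : ∀ j, testStr k P i j ∈ L) : m ≤ (L ∩ (testSet k P m : Set Str)).ncard := by
  have h1 : (((Finset.range m).image (testStr k P i) : Finset Str) : Set Str)
      ⊆ L ∩ (testSet k P m : Set Str) := by
    intro y hy
    obtain ⟨j, hj, rfl⟩ := Finset.mem_image.1 (Finset.mem_coe.1 hy)
    exact ⟨h j, Finset.mem_coe.2 (mem_testSet.2 ⟨i, j, Finset.mem_range.1 hj, rfl⟩)⟩
  have h2 := Set.ncard_le_ncard h1 (Set.Finite.inter_of_right (Finset.finite_toSet _) _)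
  rwa [Set.ncard_coe_finset, Finset.card_image_of_injective _ fun j j' h => (testStr_inj h).2,
    Finset.card_range] at h2

/-- With `m` test strings from each part the threshold is reached as soon as one part is in the
language. If `f` selects a string of part `0`, exactly the other parts are put in, and this choice
is wrong; here `2 ≤ k` is essential. Otherwise only part `0` is put in, and `f` selects nothing
correct. -/
theorem not_S_of_join {k : ℕ} (hk : 2 ≤ k) {m : ℕ} (hm : 1 ≤ m) (f : Finset Str → Finset Str)
    (P : Fin k → Str) : ∃ h : Fin k → Prop, ∀ L : Lang, (∀ i j, testStr k P i j ∈ L ↔ h i) →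
      ∃ Y : Finset Str, Y.Nonempty ∧ ¬ (f Y ⊆ Y ∧ (m ≤ (L ∩ (Y : Set Str)).ncard →
        (f Y : Set Str) ⊆ L ∧ 1 ≤ (f Y).card)) := by
  have hne : (testSet k P m).Nonempty := ⟨_, mem_testSet.2 ⟨⟨0, by omega⟩, 0, hm, rfl⟩⟩
  by_cases hf : ∃ j, testStr k P ⟨0, by omega⟩ j ∈ f (testSet k P m)
  · obtain ⟨j, hj⟩ := hf
    refine ⟨fun i => i ≠ ⟨0, by omega⟩, fun L hL => ⟨testSet k P m, hne, ?_⟩⟩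
    rintro ⟨-, h⟩
    obtain ⟨h1, -⟩ := h (le_ncard_testSet (i := ⟨1, by omega⟩) fun j => (hL _ j).2 (by simp))
    exact (hL _ j).1 (h1 hj) rfl
  · push Not at hf
    refine ⟨fun i => i = ⟨0, by omega⟩, fun L hL => ⟨testSet k P m, hne, ?_⟩⟩
    rintro ⟨h0, h⟩
    obtain ⟨h1, h2⟩ := h (le_ncard_testSet (i := ⟨0, by omega⟩) fun j => (hL _ j).2 rfl)
    obtain ⟨y, hy⟩ := Finset.card_pos.1 h2
    obtain ⟨i, j, -, rfl⟩ := mem_testSet.1 (h0 hy)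
    have h3 := (hL i j).1 (h1 hy)
    subst h3
    exact hf j hy

/-- No effectivity is required of the list, since the P-selective sets to be built need not be
computable. -/
theorem exists_enumeration : ∃ e : ℕ → Finset Str → Finset Str,
    ∀ f, PolyTime codeFinset codeFinset f → ∃ n, e n = f := by
  have hc := countable_polyTime (α := Finset Str) codeFinset codeFinset_injective
  have hne : {f : Finset Str → Finset Str | PolyTime codeFinset codeFinset f}.Nonempty :=
    ⟨id, ⟨Turing.idComputableInPolyTime codeFinset⟩⟩
  obtain ⟨e, he⟩ := hc.exists_eq_range hne
  refine ⟨e, fun f hf => ?_⟩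
  have : f ∈ Set.range e := he ▸ hf
  exact this

theorem joinClass_not_subset {k : ℕ} (hk : 2 ≤ k) :
    ¬ joinClass k PSel ⊆ SH ∪ GC (fun _ => 1) (fun _ => k - 1) (fun _ => 1) := by
  obtain ⟨e, he⟩ := exists_enumeration
  -- A stage is a pair of the index of a function and a number: `0` stands for the requirement about
  -- `GC`, and `m ≥ 1` for the one about `S(m)`.
  obtain ⟨L, hL, h⟩ := exists_join_forall (k := k) (R := fun n L =>
    if n.unpair.2 = 0 then ∃ Y : Finset Str, Y.Nonempty ∧
        ¬ GCCondition (fun _ => 1) (fun _ => k - 1) (fun _ => 1) L (e n.unpair.1) Y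
    else ∃ Y : Finset Str, Y.Nonempty ∧ ¬ (e n.unpair.1 Y ⊆ Y ∧
        (n.unpair.2 ≤ (L ∩ (Y : Set Str)).ncard →
        (e n.unpair.1 Y : Set Str) ⊆ L ∧ 1 ≤ (e n.unpair.1 Y).card))) (by
      intro n P
      by_cases hn : n.unpair.2 = 0
      · simp only [if_pos hn]
        exact not_GCCondition_of_join hk _ P
      · simp only [if_neg hn]
        exact not_S_of_join hk (Nat.one_le_iff_ne_zero.2 hn) _ P)
  intro hsub
  rcases hsub hL with ⟨m, hm, f, hf, hfL⟩ | ⟨f, hf, hfL⟩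
  · obtain ⟨a, rfl⟩ := he f hf
    have h1 := h (Nat.pair a m)
    simp only [Nat.unpair_pair, if_neg (Nat.one_le_iff_ne_zero.1 hm)] at h1
    obtain ⟨Y, hY, hn⟩ := h1
    exact hn (hfL Y hY)
  · obtain ⟨a, rfl⟩ := he f hf
    have h1 := h (Nat.pair a 0)
    simp only [Nat.unpair_pair, if_true] at h1
    obtain ⟨Y, hY, hn⟩ := h1
    exact hn (hfL Y hY)

/-! ### Diagonalization against Boolean combinations of two cuts -/

/-- All extensions of `p` by `p.length + 2` bits. -/
def cube (p : Str) : Finset Str :=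
  Finset.univ.image fun v : Fin (p.length + 2) → Bool => p ++ List.ofFn v

theorem card_cube (p : Str) : (cube p).card = 2 ^ (p.length + 2) := by
  rw [cube, Finset.card_image_of_injective]
  · simp
  · intro v w h
    exact List.ofFn_injective (List.append_cancel_left h)

theorem length_of_mem_cube {p y : Str} (hy : y ∈ cube p) : y.length = p.length + (p.length + 2) := by
  obtain ⟨v, -, rfl⟩ := Finset.mem_image.1 hy
  simp

theorem prefix_of_mem_cube {p y : Str} (hy : y ∈ cube p) : p <+: y := by
  obtain ⟨v, -, rfl⟩ := Finset.mem_image.1 hy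
  exact List.prefix_append _ _

/-- This is the fairness condition and the reason for the `p.length + 2` new bits: with `ℓ =
p.length`, the strings have length `2ℓ + 2`, and the cube has `4 · 2 ^ ℓ` elements. -/
theorem length_le_card_cube {p y : Str} (hy : y ∈ cube p) : y.length ≤ (cube p).card := by
  rw [length_of_mem_cube hy, card_cube, pow_add]
  have := Nat.lt_two_pow_self (n := p.length)
  omega

theorem three_le_card_cube (p : Str) : 3 ≤ (cube p).card := by
  rw [card_cube, pow_add]
  have := Nat.one_le_two_pow (n := p.length)
  omega

/-- The conclusion is conditional so that a string can be chosen at every stage; a function that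
selects too many strings violates its bound anyway. -/
theorem exists_missed (f : Finset Str → Finset Str) (p : Str) : ∃ q ∈ cube p,
    (f (cube p)).card < (cube p).card → q ∉ f (cube p) := by
  by_cases h : (f (cube p)).card < (cube p).card
  · obtain ⟨q, hq, hqf⟩ := Finset.exists_mem_notMem_of_card_lt_card h
    exact ⟨q, hq, fun _ => hqf⟩
  · obtain ⟨q, hq⟩ : (cube p).Nonempty :=
      Finset.card_pos.1 (lt_of_lt_of_le (by norm_num) (three_le_card_cube p))
    exact ⟨q, hq, fun h' => absurd h' h⟩

/-- On the strings of the same length as `r n`, exactly `r n` belongs to both cuts, and all others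
belong to exactly one of them. -/
theorem mem_cut_flip_cut {r : ℕ → Str} (hr : ∀ n, r n <+: r (n + 1)) (n : ℕ) :
    (r n ∈ cut r ∧ flip (r n) ∈ cut fun n => flip (r n)) ∧
      ∀ x, x.length = (r n).length → x ≠ r n →
        (flip x ∈ cut (fun n => flip (r n)) ↔ x ∉ cut r) := by
  refine ⟨⟨⟨n, lexLe_refl _⟩, ⟨n, lexLe_refl _⟩⟩, fun x hl hne => ?_⟩
  have h1 : ¬ r n <+: x := fun h => hne (h.eq_of_length hl.symm).symm
  have hinv : ∀ z : Str, flip (flip z) = z := fun z => by simp [flip, Function.comp_def]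
  have h2 : ¬ flip (r n) <+: flip x := by
    intro h
    have h3 := h.eq_of_length (by simp [flip, hl])
    exact hne ((hinv x).symm.trans ((congrArg flip h3.symm).trans (hinv _)))
  rw [mem_cut_iff hr h1, mem_cut_iff (r := fun m => flip (r m)) (fun m => (hr m).map not) h2,
    lexLe_flip hl hne]
  simp

/-- Stage `n` extends the branch to a string of the cube over `r n` that the `n`-th function drops.
All strings of the cube have the length of `r (n + 1)`, so `mem_cut_flip_cut` applies to them. That
`Bᶜ` is P-selective too serves the case of xor. -/
theorem exists_cuts : ∃ A ∈ PSel, ∃ B ∈ PSel, Bᶜ ∈ PSel ∧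
    ∀ f, PolyTime codeFinset codeFinset f → ∃ Y : Finset Str, ∃ q ∈ Y, 3 ≤ Y.card ∧
      (∀ y ∈ Y, y.length ≤ Y.card) ∧ ((f Y).card < Y.card → q ∉ f Y) ∧
      (q ∈ A ∧ q ∈ B) ∧ ∀ x ∈ Y, x ≠ q → (x ∈ B ↔ x ∉ A) := by
  obtain ⟨e, he⟩ := exists_enumeration
  choose s hs hs' using fun n => exists_missed (e n)
  let r : ℕ → Str := fun n => Nat.rec [] (fun n p => s n p) n
  have hr : ∀ n, r n <+: r (n + 1) := fun n => prefix_of_mem_cube (hs n (r n))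
  refine ⟨_, cut_mem_PSel r, _, flip_cut_mem_PSel fun n => flip (r n),
    compl_flip_cut_mem_PSel _, fun f hf => ?_⟩
  obtain ⟨n, rfl⟩ := he f hf
  obtain ⟨h1, h2⟩ := mem_cut_flip_cut hr (n + 1)
  refine ⟨cube (r n), r (n + 1), hs n (r n), three_le_card_cube _,
    fun y hy => length_le_card_cube hy, hs' n (r n), h1, fun x hx hne => h2 x ?_ hne⟩
  rw [length_of_mem_cube hx, length_of_mem_cube (hs n (r n))]

/-! ### Lower bounds for intersection, nxor and xor -/

/-- The bound `g₂` forces `f` to drop something from `Y`, hence the string `q`, which is the only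
member of the language in `Y`. -/
theorem not_GCCondition_of_unique {g₂ : ℕ → ℕ} {L : Lang} {f : Finset Str → Finset Str}
    {Y : Finset Str} {q : Str} (hq : q ∈ Y) (hg : g₂ Y.card < Y.card)
    (hf : (f Y).card < Y.card → q ∉ f Y) (hL : ∀ x ∈ Y, x ∈ L ↔ x = q) :
    ¬ GCCondition (fun _ => 1) g₂ (fun _ => 1) L f Y := by
  rintro ⟨h1, h2, h3⟩
  have h4 : 0 < (L ∩ (Y : Set Str)).ncard := by
    rw [Set.ncard_pos (Set.Finite.inter_of_right (Finset.finite_toSet _) _)]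
    exact ⟨q, (hL q hq).2 rfl, hq⟩
  have h5 : 0 < (L ∩ (f Y : Set Str)).ncard := h3 h4
  rw [Set.ncard_pos (Set.Finite.inter_of_right (Finset.finite_toSet _) _)] at h5
  obtain ⟨x, hxL, hx⟩ := h5
  have := (hL x (h1 hx)).1 hxL
  subst this
  exact hf (h2.trans_lt hg) hx

theorem predThreshold_lt {n : ℕ} (h : 3 ≤ n) : predThreshold n < n := by
  unfold predThreshold
  omega

/-- The bound `g₂` is left open so as to cover both the constant `2` and the threshold `n - 1`. -/
theorem inter_not_subset {g₂ : ℕ → ℕ} (hg : ∀ n, 3 ≤ n → g₂ n < n) :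
    ¬ opClass (· ∩ ·) PSel PSel ⊆ FairGC (fun _ => 1) g₂ fun _ => 1 := by
  obtain ⟨A, hA, B, hB, -, h⟩ := exists_cuts
  intro hsub
  obtain ⟨f, hf, hfL⟩ := hsub ⟨A, hA, B, hB, rfl⟩
  obtain ⟨Y, q, hq, hY, hlen, hmiss, hqL, hL⟩ := h f hf
  refine not_GCCondition_of_unique hq (hg _ hY) hmiss (fun x hx => ⟨fun hxL => ?_, ?_⟩)
    (hfL Y ⟨q, hq⟩ hlen)
  · by_contra hne
    exact (hL x hx hne).1 hxL.2 hxL.1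
  · rintro rfl
    exact hqL

theorem nxor_not_subset :
    ¬ opClass nxorLang PSel PSel ⊆ FairGC (fun _ => 1) predThreshold fun _ => 1 := by
  obtain ⟨A, hA, B, hB, -, h⟩ := exists_cuts
  intro hsub
  obtain ⟨f, hf, hfL⟩ := hsub ⟨A, hA, B, hB, rfl⟩
  obtain ⟨Y, q, hq, hY, hlen, hmiss, hqL, hL⟩ := h f hf
  refine not_GCCondition_of_unique hq (predThreshold_lt hY) hmiss (fun x hx => ⟨fun hxL => ?_, ?_⟩)
    (hfL Y ⟨q, hq⟩ hlen)
  · by_contra hne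
    rcases hxL with hxL | hxL
    · exact (hL x hx hne).1 hxL.2 hxL.1
    · exact hxL.2 ((hL x hx hne).2 hxL.1)
  · rintro rfl
    exact .inl hqL

theorem xorLang_compl (A B : Lang) : xorLang A Bᶜ = nxorLang A B := by
  rw [xorLang, nxorLang, compl_compl]

theorem xor_not_subset :
    ¬ opClass xorLang PSel PSel ⊆ FairGC (fun _ => 1) predThreshold fun _ => 1 := by
  obtain ⟨A, hA, B, -, hB, h⟩ := exists_cuts
  intro hsub
  obtain ⟨f, hf, hfL⟩ := hsub ⟨A, hA, Bᶜ, hB, rfl⟩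
  obtain ⟨Y, q, hq, hY, hlen, hmiss, hqL, hL⟩ := h f hf
  refine not_GCCondition_of_unique hq (predThreshold_lt hY) hmiss (fun x hx => ⟨fun hxL => ?_, ?_⟩)
    (hfL Y ⟨q, hq⟩ hlen)
  · rw [xorLang_compl] at hxL
    by_contra hne
    rcases hxL with hxL | hxL
    · exact (hL x hx hne).1 hxL.2 hxL.1
    · exact hxL.2 ((hL x hx hne).2 hxL.1)
  · rintro rfl
    rw [xorLang_compl]
    exact .inl hqL

theorem GC_subset_FairGC (g₁ g₂ g₃ : ℕ → ℕ) : GC g₁ g₂ g₃ ⊆ FairGC g₁ g₂ g₃ := by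
  rintro L ⟨f, hf, h⟩
  exact ⟨f, hf, fun Y hY _ => h Y hY⟩

end GenSel

theorem mainTheorem8 :
    (∀ k : ℕ, 2 ≤ k →
      (joinClass k PSel ⊆ GC (fun _ => 1) (fun _ => k) (fun _ => 1) ∧
        ¬ joinClass k PSel ⊆ SH ∪ GC (fun _ => 1) (fun _ => k - 1) (fun _ => 1)) ∧
      (unionClass k PSel ⊆ GC (fun _ => 1) (fun _ => k) (fun _ => 1) ∧
        ¬ unionClass k PSel ⊆ SH ∪ GC (fun _ => 1) (fun _ => k - 1) (fun _ => 1))) ∧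
    (¬ opClass (· ∩ ·) PSel PSel ⊆ GC (fun _ => 1) (fun _ => 2) (fun _ => 1) ∧
      ∀ k : ℕ → ℕ,
        PolyTime (fun n : ℕ => List.replicate n false) Computability.encodeNat k →
        (∀ n : ℕ, 1 ≤ n → 1 ≤ k n ∧ k n ≤ n) →
        opClass (· ∩ ·) PSel PSel ⊆ GC (fun n => ⌈(n : ℚ) / (k n : ℚ)⌉₊) k (fun _ => 1)) ∧
    (¬ opClass (· ∩ ·) PSel PSel ⊆ FairGC (fun _ => 1) predThreshold (fun _ => 1) ∧
      ¬ opClass xorLang PSel PSel ⊆ FairGC (fun _ => 1) predThreshold (fun _ => 1) ∧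
      ¬ opClass nxorLang PSel PSel ⊆ FairGC (fun _ => 1) predThreshold (fun _ => 1)) := by
  refine ⟨fun k hk => ⟨⟨(joinClass_subset_unionClass k).trans (unionClass_subset_GC k),
      joinClass_not_subset hk⟩, unionClass_subset_GC k,
        fun h => joinClass_not_subset hk ((joinClass_subset_unionClass k).trans h)⟩,
    -- Failure of the fair version is the stronger statement. With the constant bound `2`, the
    -- condition `2 < n` is `3 ≤ n` itself.
    ⟨fun h => inter_not_subset (g₂ := fun _ => 2) (fun _ hn => hn)
      (h.trans (GC_subset_FairGC _ _ _)), fun k hk hkn => inter_subset_GC hk hkn⟩,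
    inter_not_subset fun _ => predThreshold_lt, xor_not_subset, nxor_not_subset⟩
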